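/- **Setting.** Let $(M,d)$ be a metric space of diameter at most $D>0$, $s_0\in M$, and let $\ell\ge 1$, $m\ge 2$. An input is a sequence of cost functions $c_1,\dots,c_T\colon M\to[0,\infty]$ ($T$ arbitrary) such that each $c_t$ vanishes at some state and $\operatorname{argmin}_s(d(b,s)+c_t(s))$ exists for every $b\in M$. A solution $s_1,\dots,s_T$ costs $\sum_{t=1}^T \big(c_t(s_t)+d(s_{t-1},s_t)\big)$; $\mathrm{OFF}$ is the infimum of this cost over all solutions. The heuristics $H_1,\dots,H_\ell$ are (possibly randomized, arbitrarily correlated) online algorithms starting in $s_0$, with state $s_t^i$ and cost $f_t(i)=c_t(s_t^i)+d(s_{t-1}^i,s_t^i)\le 2D$ in round $t$, and $\mathrm{OPT}_{\le 0}=\min_i\sum_{t=1}^T f_t(i)$. $H_i$ is *$R$-competitive with high probability* if for every $\beta\ge1$ there is a constant $\alpha$ such that on every input its cost exceeds $R\cdot\mathrm{OFF}+\alpha$ with probability at most $(2+\mathrm{OFF})^{-\beta}$. In each round one heuristic is queried, and a query of $H_i$ reveals $s^i_t$ only if $H_i$ was queried in all of the rounds $t-m+2,\dots,t$. **The algorithm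 $\mathrm{ALG}(\omega)$.** Put $\epsilon(\omega)=(D\ell\ln\ell)^{1/3}m^{-4/3}\omega^{-1/3}$, $\gamma(\omega)=(D\ell\ln\ell)^{1/3}m^{2/3}\omega^{-1/3}$ and $\eta=-\ln(1-\gamma(\omega))$. It maintains the HEDGE distribution $x_t$ over the heuristics with learning rate $\eta$ (initially uniform) and an exploited heuristic $i_t$ (initially uniformly random). Its first round is an exploitation round. After an exploitation round $t$, with probability $1-\epsilon$ the next round is again an exploitation round; with probability $\epsilon$ a uniformly random heuristic $e$ is queried in the rounds $t+1,\dots,t+m$, in round $t+m$ HEDGE is fed the loss $f_{t+m}(e)/(2D)$ for $e$ and $0$ for the others, $i_{t+m+1}$ is obtained from $i_{t+m}$ by an optimal transport of $x_{t+m}$ to $x_{t+m+1}$ (with respect to the total variation distance), and round $t+m+1$ is an exploitation round. In exploitation rounds $i_t$ is queried. If $s_t^{i_t}$ is known from the queries, the algorithm moves there and sets $b_t=s_t^{i_t}$; otherwise it sets $b_t=b_{t-1}$ and makes the greedy step $s_t\in\operatorname{argmin}_s(d(b_t,s)+c_t(s))$, where $b$ is initially the starting position. **The doubling algorithm** with initial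 guess $\omega$ starts with $i=0$, $a_0=1$ and the instance $\mathrm{ALG}(\omega)$. Before each round $t$ it computes the offline optimum $\mathrm{OFF}_i$ of the rounds $a_i,\dots,t-1$ (with free initial state). If $\mathrm{OFF}_i>R\cdot2^i\omega$, it increases $i$ by one, sets $a_i=t$ and starts a new instance $\mathrm{ALG}(2^i\omega)$ from the current position. Then it makes the step of the current instance. **Proposition.** For all $D,\ell,m$ and every $\omega_0>0$ with $\gamma(\omega_0)<1$ there is a constant $C$ such that the following holds. Let $\omega\ge\omega_0$ and $R\ge 1$, and let $H_1,\dots,H_\ell$ be heuristics as above on a metric space of diameter at most $D$, at least one of which is $R$-competitive with high probability. Then for every $\beta\ge 1$ there is a constant $K$, independent of the input, such that on every input, with probability at least $1-(2+\mathrm{OFF})^{-\beta}$ over the random bits of the heuristics, the expected cost $\mathbb E[\mathrm{ALG}]$ of the doubling algorithm, the expectation being over its own random bits, satisfies $$\mathbb E[\mathrm{ALG}]-\mathrm{OPT}_{\le0}\;\le\; C\,R^{2/3}\,\mathrm{OPT}_{\le0}^{2/3}+K .$$ -/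

import Mathlib

open scoped ENNReal NNReal

noncomputable section

namespace MTS

/-! ### Metrical task systems -/

/-- A cost function on the states, with values in `[0, ∞]`. -/
abbrev CostFn (M : Type*) := M → ℝ≥0∞

/-- The admissible cost functions: some state has cost zero, and the greedy step
`argmin_s (d(b, s) + c(s))` exists for every `b` (the latter is automatic on a finite space). -/
def Admissible {M : Type*} [MetricSpace M] (c : CostFn M) : Prop :=
  (∃ s, c s = 0) ∧ ∀ b, ∃ s, ∀ s', edist b s + c s ≤ edist b s' + c s'

/-- Cost of the trajectory `s` in the rounds `a, …, b - 1` (rounds are numbered from `1`;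
`s 0` is the position before round `1`). -/
def pathCost {M : Type*} [MetricSpace M] (c : ℕ → CostFn M) (s : ℕ → M) (a b : ℕ) : ℝ≥0∞ :=
  ∑ t ∈ Finset.Ico a b, (c t (s t) + edist (s (t - 1)) (s t))

/-- `OFF`: the offline optimum of the rounds `1, …, T`, starting in `s₀`. -/
def offline {M : Type*} [MetricSpace M] (s₀ : M) (c : ℕ → CostFn M) (T : ℕ) : ℝ≥0∞ :=
  ⨅ (s : ℕ → M) (_ : s 0 = s₀), pathCost c s 1 (T + 1)

/-- The offline optimum of the interval of rounds `a, …, b - 1` alone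
(the position before round `a` is free). -/
def offlineOn {M : Type*} [MetricSpace M] (c : ℕ → CostFn M) (a b : ℕ) : ℝ≥0∞ :=
  ⨅ s : ℕ → M, pathCost c s a b

/-! ### Heuristics -/

/-- A (deterministic) online algorithm started in `s₀`: its state after a round is a function of
the cost functions revealed so far, the one of the current round included. -/
structure OnlineAlg (M : Type*) (s₀ : M) where
  state : List (CostFn M) → M
  state_nil : state [] = s₀

/-- The cost functions of the rounds `1, …, t`. -/
def history {M : Type*} (c : ℕ → CostFn M) (t : ℕ) : List (CostFn M) :=
  (List.range t).map fun k => c (k + 1)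

/-- The state of `A` after round `t`. -/
def OnlineAlg.traj {M : Type*} {s₀ : M} (A : OnlineAlg M s₀) (c : ℕ → CostFn M) (t : ℕ) : M :=
  A.state (history c t)

/-- `f_t`: the cost incurred by `A` in round `t ≥ 1`. -/
def OnlineAlg.stepCost {M : Type*} [MetricSpace M] {s₀ : M} (A : OnlineAlg M s₀)
    (c : ℕ → CostFn M) (t : ℕ) : ℝ≥0∞ :=
  c t (A.traj c t) + edist (A.traj c (t - 1)) (A.traj c t)

/-- The cost of `A` on the rounds `1, …, T`. -/
def OnlineAlg.totalCost {M : Type*} [MetricSpace M] {s₀ : M} (A : OnlineAlg M s₀)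
    (c : ℕ → CostFn M) (T : ℕ) : ℝ≥0∞ :=
  ∑ t ∈ Finset.Icc 1 T, A.stepCost c t

/-- `OPT_{≤ 0}`: the cost of the best of the heuristics. -/
def opt {M : Type*} [MetricSpace M] {s₀ : M} {ℓ : ℕ} (H : Fin ℓ → OnlineAlg M s₀)
    (c : ℕ → CostFn M) (T : ℕ) : ℝ≥0∞ :=
  ⨅ i, (H i).totalCost c T

/-- The randomized online algorithm `A` (a random variable on `(Ω, P)` with values in the
deterministic online algorithms) is `R`-competitive with high probability: for every `β ≥ 1` there
is a constant `α` such that, on every input, its cost exceeds `R * OFF + α` with probability at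
most `(2 + OFF) ^ (-β)`. -/
def CompetitiveWHP {M : Type*} [MetricSpace M] {s₀ : M} {Ω : Type*} [MeasurableSpace Ω]
    (P : MeasureTheory.Measure Ω) (A : Ω → OnlineAlg M s₀) (R : ℝ≥0) : Prop :=
  ∀ β : ℝ, 1 ≤ β → ∃ α : ℝ≥0, ∀ c : ℕ → CostFn M, (∀ t, Admissible (c t)) → ∀ T : ℕ,
    P {w | (R : ℝ≥0∞) * offline s₀ c T + α < (A w).totalCost c T}
      ≤ (2 + offline s₀ c T) ^ (-β)

/-! ### The algorithm `ALG(ω)` for `m`-delayed bandit access -/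

/-- The exploration rate `ε = (D ℓ ln ℓ)^{1/3} m^{-4/3} ω^{-1/3}`. -/
def epsParam (D : ℝ) (ℓ m : ℕ) (ω : ℝ) : ℝ :=
  (D * ℓ * Real.log ℓ) ^ (1 / 3 : ℝ) * (m : ℝ) ^ (-4 / 3 : ℝ) * ω ^ (-1 / 3 : ℝ)

/-- The parameter `γ = (D ℓ ln ℓ)^{1/3} m^{2/3} ω^{-1/3}`. -/
def gammaParam (D : ℝ) (ℓ m : ℕ) (ω : ℝ) : ℝ :=
  (D * ℓ * Real.log ℓ) ^ (1 / 3 : ℝ) * (m : ℝ) ^ (2 / 3 : ℝ) * ω ^ (-1 / 3 : ℝ)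

/-- The learning rate `η` of HEDGE, given by `γ = 1 - exp (-η)`. -/
def etaParam (D : ℝ) (ℓ m : ℕ) (ω : ℝ) : ℝ :=
  -Real.log (1 - gammaParam D ℓ m ω)

/-- The distribution proportional to the HEDGE weights `w`. -/
def hedgeDist {ℓ : ℕ} (w : Fin ℓ → ℝ≥0) (i : Fin ℓ) : ℝ≥0 :=
  w i / ∑ j, w j

/-- The HEDGE update of the weights for the loss vector `g`. -/
def hedgeUpdate {ℓ : ℕ} (η : ℝ) (g : Fin ℓ → ℝ) (w : Fin ℓ → ℝ≥0) (i : Fin ℓ) : ℝ≥0 :=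
  w i * (Real.exp (-η * g i)).toNNReal

/-- The distribution proportional to a nonzero nonnegative vector `v`; if `v = 0`,
the point mass at `i`. -/
def proportional {ℓ : ℕ} (i : Fin ℓ) (v : Fin ℓ → ℝ≥0) : PMF (Fin ℓ) :=
  open Classical in
  if h : ∃ j, v j ≠ 0 then
    PMF.normalize (fun j => (v j : ℝ≥0∞))
      (by
        obtain ⟨j, hj⟩ := h
        exact fun h0 => hj (by simpa using ENNReal.tsum_eq_zero.1 h0 j))
      (by
        rw [tsum_fintype]
        exact ENNReal.sum_ne_top.2 fun j _ => ENNReal.coe_ne_top)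
  else PMF.pure i

/-- A coin that shows `true` with probability `p` (with probability `1` if `p > 1`). -/
def coin (p : ℝ≥0) : PMF Bool :=
  PMF.ofFintype (fun b => if b then ((min 1 p : ℝ≥0) : ℝ≥0∞) else ((1 - min 1 p : ℝ≥0) : ℝ≥0∞))
    (by
      rw [Fintype.sum_bool]
      simp only [if_true, Bool.false_eq_true, if_false]
      rw [← ENNReal.coe_add, add_tsub_cancel_of_le (min_le_left 1 p), ENNReal.coe_one])

/-- The procedure Round: a step from `i ∼ x` to `j ∼ x'` according to an optimal transport plan `τ`
from `x` to `x'` for the discrete metric, that is, `j` has probability `τ i j / x i`.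
The plan is `τ i i = min (x i) (x' i)` and
`τ i j = (x i - x' i)⁺ (x' j - x j)⁺ / ∑ k, (x' k - x k)⁺` for `j ≠ i`
(subtraction in `ℝ≥0` is truncated at `0`). -/
def round {ℓ : ℕ} (x x' : Fin ℓ → ℝ≥0) (i : Fin ℓ) : PMF (Fin ℓ) :=
  (coin (min (x i) (x' i) / x i)).bind fun stay =>
    if stay then PMF.pure i else proportional i fun j => x' j - x j

/-- The greedy step `argmin_s (d(b, s) + c(s))`. -/
def greedy {M : Type*} [MetricSpace M] (c : CostFn M) (b : M) : M :=
  open Classical in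
  if h : ∃ s, ∀ s', edist b s + c s ≤ edist b s' + c s' then h.choose else b

/-- The memory of a running instance of the algorithm before a round. -/
structure AlgState (M : Type*) (ℓ : ℕ) where
  /-- the HEDGE weights -/
  weights : Fin ℓ → ℝ≥0
  /-- the exploited heuristic -/
  leader : Fin ℓ
  /-- `0` if the coming round is an exploitation round; otherwise, the exploration takes place
  `wait - 1` rounds after the coming one -/
  wait : ℕ
  /-- the explored heuristic (meaningful if `wait ≠ 0`) -/
  explored : Fin ℓ
  /-- the heuristic queried last -/
  lastQuery : Fin ℓ
  /-- the number of consecutive queries of `lastQuery` so far -/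
  run : ℕ
  /-- the state obtained by following the exploited heuristic for the last time -/
  base : M
  /-- the current position -/
  pos : M
  /-- the cost paid so far -/
  paid : ℝ≥0∞

/-- A new instance of the algorithm, started at the position `p` with cost `z` paid before. -/
def fresh {M : Type*} {ℓ : ℕ} [NeZero ℓ] (p : M) (z : ℝ≥0∞) : PMF (AlgState M ℓ) :=
  (PMF.uniformOfFintype (Fin ℓ)).map fun i =>
    { weights := fun _ => 1, leader := i, wait := 0, explored := i, lastQuery := i, run := 0,
      base := p, pos := p, paid := z }

/-- The moves of one round with cost function `c`, where `h i` is the state of the `i`-th heuristic.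
The algorithm queries the exploited heuristic in exploitation rounds and the explored one
in the `m` rounds up to an exploration. The state of the exploited heuristic is known if
this heuristic was queried in the last `m - 1` rounds, the present one included; then the algorithm
goes there, and otherwise it makes a greedy step from the last state known in this way. -/
def move {M : Type*} [MetricSpace M] {ℓ : ℕ} (m : ℕ) (c : CostFn M) (h : Fin ℓ → M)
    (σ : AlgState M ℓ) : AlgState M ℓ :=
  let q := if σ.wait = 0 then σ.leader else σ.explored
  let r := if q = σ.lastQuery then σ.run + 1 else 1
  let b := if q = σ.leader ∧ m ≤ r + 1 then h σ.leader else σ.base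
  let p := if q = σ.leader ∧ m ≤ r + 1 then h σ.leader else greedy c σ.base
  { σ with lastQuery := q, run := r, base := b, pos := p, paid := σ.paid + (c p + edist σ.pos p) }

/-- One round of the algorithm with exploration rate `ε` and learning rate `η`, where `h i` is the
state and `f i` the cost of the `i`-th heuristic in this round. After an exploitation round,
an exploration of a uniformly random heuristic is scheduled with probability `ε`;
it takes place `m` rounds later. In an exploration round the cost `f e` of the explored heuristic
`e` is fed to HEDGE (it is available, as `e` was queried `m` times in a row)
and the exploited heuristic is updated by Round. -/
def step {M : Type*} [MetricSpace M] {ℓ : ℕ} [NeZero ℓ] (D : ℝ) (m : ℕ) (ε η : ℝ)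
    (c : CostFn M) (h : Fin ℓ → M) (f : Fin ℓ → ℝ≥0∞) (σ : AlgState M ℓ) :
    PMF (AlgState M ℓ) :=
  let σ' := move m c h σ
  if σ.wait = 0 then
    (coin ε.toNNReal).bind fun explore =>
      if explore then
        (PMF.uniformOfFintype (Fin ℓ)).map fun e => { σ' with wait := m, explored := e }
      else PMF.pure σ'
  else if σ.wait = 1 then
    let g : Fin ℓ → ℝ := fun j => if j = σ.explored then (f j).toReal / (2 * D) else 0
    let w' := hedgeUpdate η g σ.weights
    (round (hedgeDist σ.weights) (hedgeDist w') σ.leader).map fun j =>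
      { σ' with wait := 0, weights := w', leader := j }
  else PMF.pure { σ' with wait := σ.wait - 1 }

/-! ### The doubling algorithm -/

/-- The index `i` of the instance running in round `t` of the doubling algorithm and its first
round `a_i`: before round `t`, if the offline optimum of the rounds `a_i, …, t - 1` exceeds
`R * 2 ^ i * ω`, instance `i` is replaced by instance `i + 1`. -/
def phase {M : Type*} [MetricSpace M] (R ω : ℝ≥0) (c : ℕ → CostFn M) : ℕ → ℕ × ℕ
  | 0 => (0, 1)
  | t + 1 =>
    open Classical in
    if (R : ℝ≥0∞) * 2 ^ (phase R ω c t).1 * ω < offlineOn c (phase R ω c t).2 (t + 1)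
    then ((phase R ω c t).1 + 1, t + 1)
    else phase R ω c t

/-- The law of the memory of the doubling algorithm after `t` rounds, when the heuristics are
`H`. Instance `i` is `ALG(2 ^ i * ω)`, started in the position reached by its predecessor. -/
def law {M : Type*} [MetricSpace M] {s₀ : M} {ℓ : ℕ} [NeZero ℓ] (D : ℝ) (m : ℕ) (R ω : ℝ≥0)
    (H : Fin ℓ → OnlineAlg M s₀) (c : ℕ → CostFn M) : ℕ → PMF (AlgState M ℓ)
  | 0 => fresh s₀ 0
  | t + 1 =>
    (law D m R ω H c t).bind fun σ =>
      (if (phase R ω c (t + 1)).2 = t + 1 then fresh σ.pos σ.paid else PMF.pure σ).bind fun σ' =>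
        step D m (epsParam D ℓ m (2 ^ (phase R ω c (t + 1)).1 * ω))
          (etaParam D ℓ m (2 ^ (phase R ω c (t + 1)).1 * ω))
          (c (t + 1)) (fun i => (H i).traj c (t + 1)) (fun i => (H i).stepCost c (t + 1)) σ'

/-- `E[ALG]`: the expected cost of the doubling algorithm on the rounds `1, …, T`. -/
def expectedCost {M : Type*} [MetricSpace M] {s₀ : M} {ℓ : ℕ} [NeZero ℓ] (D : ℝ) (m : ℕ)
    (R ω : ℝ≥0) (H : Fin ℓ → OnlineAlg M s₀) (c : ℕ → CostFn M) (T : ℕ) : ℝ≥0∞ :=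
  ∑' σ, law D m R ω H c T σ * σ.paid

end MTS

end

/-! One instance. Given the weights and the waiting time, the exploited heuristic (the leader) is
distributed according to HEDGE (`Ex_run_leader`). A loss fed to HEDGE in round `n + m` belongs to a
uniform heuristic chosen after an exploitation round `n`, and the weights are frozen in between.
Averaging over that choice, HEDGE pays `ε / ℓ` times the loss its round-`n` leader would have in
round `n + m`. The potential `-log x_i` therefore bounds the sampled losses on exploitation states
by those of any fixed heuristic (`sum_Exw_run_le`). Passing from these states to the true leader
cost costs factors `1 + O(γ)` (`round_cost_le`): the law of the leader changes by a factor of at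
most `1 / (1 - γ)` per round, and waiting states carry only an `O(ε)` share of the mass.

The algorithm does not sit on its leader, so its cost is controlled by the potential `paid + d(pos,
base) + coeff * d(base, leader)`. When the leader's state is known, both distances vanish and the
growth is at most the leader's cost. In a bad round, which may need a greedy step, it is `O(m)`
times that cost (`Ex_step_potential_le`). Bad rounds carry an `O(ε)` share of the leader's cost
after the start-up rounds (`Ex_run_bad_le`). In total an instance costs at most `exp (A γ)` times
(best heuristic in the phase plus `O(ω ^ (2/3))`), up to a constant (`Ex_run_paid_le`).

Doubling. Phases depend on the input only. In a phase with guess `w`, the total offline optimum so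
far is `O(R w)` (`offline_le_phase`). If a heuristic is competitive at the phase ends, the best cost
is at most `B R² w + Y`. Then `γ ∼ w ^ (-1/3)` times the growth of the best cost `x` is dominated by
the growth of `R ^ (2/3) (x - Y)⁺ ^ (2/3)`, up to the contribution of `min x Y`. The terms `w ^
(2/3)` sum geometrically (`regret_increment`, `expectedCost_le`).

Probability. At an early phase end the failure probability is too large in terms of the final
optimum. Competitiveness is therefore invoked only from a round `τ` on, where `2 + OFF` has reached
the square root of its final value. This costs `Y ≈ R √OFF`, which `R ^ (2/3) OPT ^ (2/3) + R²`
absorbs. Asking for twice the exponent and a surplus for the number of phases makes the union bound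
work. -/

namespace MTS

set_option linter.unusedSectionVars false

/-! ### Expectations under a `PMF`, with values in `[0, ∞]`. -/

/-- The expectation of `F` under `p`. -/
noncomputable def Ex {α : Type*} (p : PMF α) (F : α → ℝ≥0∞) : ℝ≥0∞ := ∑' a, p a * F a

section Expectation

variable {α β : Type*}

theorem Ex_pure (a : α) (F : α → ℝ≥0∞) : Ex (PMF.pure a) F = F a := by
  classical
  unfold Ex
  rw [tsum_eq_single a]
  · simp
  · intro b hb
    simp [PMF.pure_apply, hb]

theorem Ex_bind (p : PMF α) (q : α → PMF β) (F : β → ℝ≥0∞) :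
    Ex (p.bind q) F = Ex p fun a => Ex (q a) F := by
  unfold Ex
  simp only [PMF.bind_apply, ← ENNReal.tsum_mul_right, ← ENNReal.tsum_mul_left, mul_assoc]
  rw [ENNReal.tsum_comm]

theorem Ex_map (p : PMF α) (g : α → β) (F : β → ℝ≥0∞) :
    Ex (p.map g) F = Ex p fun a => F (g a) := by
  rw [← PMF.bind_pure_comp, Ex_bind]
  simp [Ex_pure]

theorem Ex_congr (p : PMF α) {F G : α → ℝ≥0∞} (h : ∀ a ∈ p.support, F a = G a) :
    Ex p F = Ex p G := by
  unfold Ex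
  refine tsum_congr fun a => ?_
  by_cases ha : p a = 0
  · simp [ha]
  · rw [h a ((PMF.mem_support_iff _ _).2 ha)]

theorem Ex_mono (p : PMF α) {F G : α → ℝ≥0∞} (h : ∀ a ∈ p.support, F a ≤ G a) :
    Ex p F ≤ Ex p G := by
  unfold Ex
  refine ENNReal.tsum_le_tsum fun a => ?_
  by_cases ha : p a = 0
  · simp [ha]
  · gcongr
    exact h a ((PMF.mem_support_iff _ _).2 ha)

theorem Ex_add (p : PMF α) (F G : α → ℝ≥0∞) :
    Ex p (fun a => F a + G a) = Ex p F + Ex p G := by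
  unfold Ex
  simp only [mul_add]
  exact ENNReal.tsum_add

theorem Ex_const_mul (p : PMF α) (c : ℝ≥0∞) (F : α → ℝ≥0∞) :
    Ex p (fun a => c * F a) = c * Ex p F := by
  unfold Ex
  rw [← ENNReal.tsum_mul_left]
  exact tsum_congr fun a => by ring

theorem Ex_const (p : PMF α) (c : ℝ≥0∞) : Ex p (fun _ => c) = c := by
  unfold Ex
  rw [ENNReal.tsum_mul_right, p.tsum_coe, one_mul]

theorem Ex_zero (p : PMF α) : Ex p (fun _ => 0) = 0 := Ex_const p 0

theorem Ex_le_const (p : PMF α) {F : α → ℝ≥0∞} {c : ℝ≥0∞} (h : ∀ a ∈ p.support, F a ≤ c) :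
    Ex p F ≤ c :=
  (Ex_mono p h).trans_eq (Ex_const p c)

theorem Ex_sum {ι : Type*} (s : Finset ι) (p : PMF α) (F : ι → α → ℝ≥0∞) :
    Ex p (fun a => ∑ i ∈ s, F i a) = ∑ i ∈ s, Ex p (F i) := by
  classical
  induction s using Finset.induction_on with
  | empty => simp [Ex_zero]
  | insert i s hi ih => simp only [Finset.sum_insert hi, Ex_add, ih]

theorem Ex_fintype [Fintype α] (p : PMF α) (F : α → ℝ≥0∞) : Ex p F = ∑ a, p a * F a :=
  tsum_fintype _

theorem Ex_coin (p : ℝ≥0) (F : Bool → ℝ≥0∞) :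
    Ex (coin p) F = (min 1 p : ℝ≥0) * F true + (1 - (min 1 p : ℝ≥0) : ℝ≥0∞) * F false := by
  rw [Ex_fintype, Fintype.sum_bool]
  simp [coin]

theorem Ex_uniform [Fintype α] [Nonempty α] (F : α → ℝ≥0∞) :
    Ex (PMF.uniformOfFintype α) F = (Fintype.card α : ℝ≥0∞)⁻¹ * ∑ a, F a := by
  rw [Ex_fintype, Finset.mul_sum]
  simp

end Expectation

/-! ### The transport step between HEDGE distributions. -/

section Round

variable {ℓ : ℕ}

theorem Ex_round (x x' : Fin ℓ → ℝ≥0) (i : Fin ℓ) (F : Fin ℓ → ℝ≥0∞) :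
    Ex (round x x' i) F = (min 1 (min (x i) (x' i) / x i) : ℝ≥0) * F i
      + (1 - (min 1 (min (x i) (x' i) / x i) : ℝ≥0) : ℝ≥0∞)
        * Ex (proportional i fun j => x' j - x j) F := by
  unfold round
  rw [Ex_bind, Ex_coin]
  simp [Ex_pure]

theorem min_div_self_le_one {a b : ℝ≥0} : min a b / a ≤ 1 :=
  NNReal.div_le_of_le_mul (by simp)

theorem Ex_proportional {i : Fin ℓ} {v : Fin ℓ → ℝ≥0} (hv : ∃ j, v j ≠ 0) (F : Fin ℓ → ℝ≥0∞) :
    Ex (proportional i v) F = (∑ j, (v j : ℝ≥0∞))⁻¹ * ∑ j, v j * F j := by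
  unfold proportional
  rw [dif_pos hv, Ex_fintype, Finset.mul_sum]
  refine Finset.sum_congr rfl fun j _ => ?_
  rw [PMF.normalize_apply, tsum_fintype]
  ring

/-- `round` is a transport plan from `x` to `x'`. -/
theorem sum_mul_Ex_round {x x' : Fin ℓ → ℝ≥0} (hx : ∀ i, 0 < x i) (hs : ∑ i, x i = 1)
    (hs' : ∑ i, x' i = 1) (F : Fin ℓ → ℝ≥0∞) :
    ∑ i, x i * Ex (round x x' i) F = ∑ i, x' i * F i := by
  have key : ∀ i, (x i : ℝ≥0∞) * Ex (round x x' i) F = (min (x i) (x' i) : ℝ≥0) * F i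
      + (x i - x' i : ℝ≥0) * Ex (proportional i fun j => x' j - x j) F := by
    intro i
    have h1 : (x i : ℝ≥0∞) * (min (x i) (x' i) / x i : ℝ≥0) = (min (x i) (x' i) : ℝ≥0) := by
      rw [← ENNReal.coe_mul, mul_div_cancel₀ _ (hx i).ne']
    have h2 : (x i : ℝ≥0∞) * (1 - (min (x i) (x' i) / x i : ℝ≥0)) = (x i - x' i : ℝ≥0) := by
      rw [ENNReal.mul_sub (fun _ _ => ENNReal.coe_ne_top), h1, mul_one, ← ENNReal.coe_sub]
      congr 1
      rcases le_total (x i) (x' i) with h | h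
      · simp [h, tsub_eq_zero_of_le h]
      · simp [h]
    rw [Ex_round, min_eq_right min_div_self_le_one, mul_add, ← mul_assoc, ← mul_assoc, h1, h2]
  simp only [key, Finset.sum_add_distrib]
  have hmin : ∀ i, min (x i) (x' i) + (x i - x' i) = x i := fun i => by
    rcases le_total (x i) (x' i) with h | h
    · simp [h, tsub_eq_zero_of_le h]
    · simp [h]
  have hmin' : ∀ i, min (x i) (x' i) + (x' i - x i) = x' i := fun i => by
    rcases le_total (x i) (x' i) with h | h
    · simp [h]
    · simp [h, tsub_eq_zero_of_le h]
  have hsum : ∑ i, (x i - x' i) = ∑ i, (x' i - x i) := by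
    have h1 : ∑ i, min (x i) (x' i) + ∑ i, (x i - x' i) = 1 := by
      rw [← Finset.sum_add_distrib]; simp [hmin, hs]
    have h2 : ∑ i, min (x i) (x' i) + ∑ i, (x' i - x i) = 1 := by
      rw [← Finset.sum_add_distrib]; simp [hmin', hs']
    exact add_left_cancel (h1.trans h2.symm)
  have hfin : ∑ i, ((x i - x' i : ℝ≥0) : ℝ≥0∞) * Ex (proportional i fun j => x' j - x j) F
      = ∑ i, ((x' i - x i : ℝ≥0) : ℝ≥0∞) * F i := by
    by_cases hv : ∃ j, x' j - x j ≠ 0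
    · simp only [Ex_proportional hv]
      rw [← Finset.sum_mul, ← mul_assoc]
      have : ∑ i, ((x i - x' i : ℝ≥0) : ℝ≥0∞) = ∑ i, ((x' i - x i : ℝ≥0) : ℝ≥0∞) := by
        exact_mod_cast hsum
      rw [this, ENNReal.mul_inv_cancel, one_mul]
      · obtain ⟨j, hj⟩ := hv
        intro h0
        have := (Finset.sum_eq_zero_iff.1 h0) j (Finset.mem_univ j)
        exact hj (by exact_mod_cast this)
      · exact ENNReal.sum_ne_top.2 fun j _ => ENNReal.coe_ne_top
    -- Here the fallback point mass of `proportional` is used, but with total weight zero: equal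
    -- masses force `x = x'`.
    · push Not at hv
      have h0 : ∑ i, (x i - x' i) = 0 := by rw [hsum]; simp [hv]
      have h1 : ∀ i, x i - x' i = 0 := fun i => Finset.sum_eq_zero_iff.1 h0 i (Finset.mem_univ i)
      simp only [hv, h1]
      simp
  rw [hfin, ← Finset.sum_add_distrib]
  refine Finset.sum_congr rfl fun i _ => ?_
  rw [← add_mul, ← ENNReal.coe_add, hmin']

/-- The plan stays at `i` with probability `min (x i) (x' i) / x i`, which is at least `q`. -/
theorem Ex_round_ne_le {x x' : Fin ℓ → ℝ≥0} {i : Fin ℓ} {q : ℝ≥0} (hx : 0 < x i)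
    (h : q * x i ≤ x' i) (hq : q ≤ 1) :
    Ex (round x x' i) (fun j => if j = i then 0 else 1) ≤ 1 - q := by
  rw [Ex_round, min_eq_right min_div_self_le_one]
  simp only [if_true, mul_zero, zero_add]
  have h1 : Ex (proportional i fun j => x' j - x j) (fun j => if j = i then 0 else 1) ≤ 1 :=
    Ex_le_const _ fun j _ => by split_ifs <;> simp
  refine (mul_le_mul_right h1 _).trans ?_
  rw [mul_one]
  refine tsub_le_tsub_left ?_ 1
  rw [ENNReal.coe_le_coe, le_div_iff₀ hx]
  exact le_min (mul_le_of_le_one_left zero_le hq) h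

end Round

/-! ### HEDGE: stability of the distribution and the logarithmic potential. -/

section Hedge

variable {ℓ : ℕ} [NeZero ℓ]

theorem sum_weights_pos {w : Fin ℓ → ℝ≥0} (hw : ∀ i, 0 < w i) : 0 < ∑ j, w j :=
  Finset.sum_pos (fun i _ => hw i) ⟨0, Finset.mem_univ _⟩

theorem hedgeDist_pos {w : Fin ℓ → ℝ≥0} (hw : ∀ i, 0 < w i) (i : Fin ℓ) : 0 < hedgeDist w i :=
  div_pos (hw i) (sum_weights_pos hw)

theorem sum_hedgeDist {w : Fin ℓ → ℝ≥0} (hw : ∀ i, 0 < w i) : ∑ i, hedgeDist w i = 1 := by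
  unfold hedgeDist
  rw [← Finset.sum_div, div_self (sum_weights_pos hw).ne']

theorem hedgeUpdate_pos {η : ℝ} {g : Fin ℓ → ℝ} {w : Fin ℓ → ℝ≥0} (hw : ∀ i, 0 < w i)
    (i : Fin ℓ) : 0 < hedgeUpdate η g w i :=
  mul_pos (hw i) (Real.toNNReal_pos.2 (Real.exp_pos _))

theorem hedgeUpdate_le {η : ℝ} {g : Fin ℓ → ℝ} {w : Fin ℓ → ℝ≥0} (hη : 0 ≤ η) (i : Fin ℓ)
    (hg : 0 ≤ g i) : hedgeUpdate η g w i ≤ w i := by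
  refine mul_le_of_le_one_right zero_le (Real.toNNReal_le_one.2 (Real.exp_le_one_iff.2 ?_))
  nlinarith [mul_nonneg hη hg]

theorem le_hedgeUpdate {η : ℝ} {g : Fin ℓ → ℝ} {w : Fin ℓ → ℝ≥0} (hη : 0 ≤ η) (i : Fin ℓ)
    (hg : g i ≤ 1) : (Real.exp (-η)).toNNReal * w i ≤ hedgeUpdate η g w i := by
  unfold hedgeUpdate
  rw [mul_comm]
  gcongr
  nlinarith

/-- Losses are nonnegative, so the normalising sum can only decrease. This later bounds the
probability of leaving the leader. -/
theorem le_hedgeDist_update {η : ℝ} {g : Fin ℓ → ℝ} {w : Fin ℓ → ℝ≥0} (hη : 0 ≤ η)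
    (hw : ∀ i, 0 < w i) (hg : ∀ i, 0 ≤ g i) (i : Fin ℓ) :
    (Real.exp (-η * g i)).toNNReal * hedgeDist w i ≤ hedgeDist (hedgeUpdate η g w) i := by
  have h : ∑ j, hedgeUpdate η g w j ≤ ∑ j, w j :=
    Finset.sum_le_sum fun j _ => hedgeUpdate_le hη j (hg j)
  have h' := sum_weights_pos (hedgeUpdate_pos (η := η) (g := g) hw)
  calc _ = hedgeUpdate η g w i / ∑ j, w j := by unfold hedgeDist hedgeUpdate; ring
    _ ≤ hedgeUpdate η g w i / ∑ j, hedgeUpdate η g w j := by gcongr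

/-- Losses are at most one, so the normalising sum keeps at least the fraction `exp (-η)`. This
gives the comparison of leaders at different times. -/
theorem hedgeDist_update_le {η : ℝ} {g : Fin ℓ → ℝ} {w : Fin ℓ → ℝ≥0} (hη : 0 ≤ η)
    (hw : ∀ i, 0 < w i) (hg : ∀ i, 0 ≤ g i) (hg1 : ∀ i, g i ≤ 1) (i : Fin ℓ) :
    (Real.exp (-η)).toNNReal * hedgeDist (hedgeUpdate η g w) i ≤ hedgeDist w i := by
  have h : (Real.exp (-η)).toNNReal * ∑ j, w j ≤ ∑ j, hedgeUpdate η g w j := by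
    rw [Finset.mul_sum]
    exact Finset.sum_le_sum fun j _ => le_hedgeUpdate hη j (hg1 j)
  have h' := sum_weights_pos (hedgeUpdate_pos (η := η) (g := g) hw)
  have h2 := hedgeUpdate_le (w := w) hη i (hg i)
  have h3 := sum_weights_pos hw
  unfold hedgeDist
  rw [le_div_iff₀ h3, ← mul_div_assoc, div_mul_eq_mul_div, div_le_iff₀ h']
  calc _ = hedgeUpdate η g w i * ((Real.exp (-η)).toNNReal * ∑ j, w j) := by ring
    _ ≤ _ := mul_le_mul' h2 h

/-- The loss vector with entry `y` at `e`, all others zero. -/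
def singleLoss (e : Fin ℓ) (y : ℝ) : Fin ℓ → ℝ := fun j => if j = e then y else 0

/-- The potential of HEDGE with respect to the comparator `i`. -/
noncomputable def hedgePot (w : Fin ℓ → ℝ≥0) (i : Fin ℓ) : ℝ := -Real.log (hedgeDist w i)

theorem hedgePot_nonneg {w : Fin ℓ → ℝ≥0} (hw : ∀ i, 0 < w i) (i : Fin ℓ) : 0 ≤ hedgePot w i := by
  have h1 : hedgeDist w i ≤ 1 := by
    rw [← sum_hedgeDist hw]
    exact Finset.single_le_sum (f := hedgeDist w) (fun _ _ => zero_le) (Finset.mem_univ i)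
  exact neg_nonneg.2 (Real.log_nonpos (NNReal.coe_nonneg _) (by exact_mod_cast h1))

theorem hedgePot_one (i : Fin ℓ) : hedgePot (fun _ => 1) i = Real.log ℓ := by
  simp [hedgePot, hedgeDist]

theorem exp_neg_mul_le {η y : ℝ} (hy : 0 ≤ y) (hy1 : y ≤ 1) :
    Real.exp (-η * y) ≤ 1 - (1 - Real.exp (-η)) * y := by
  have := convexOn_exp.2 (Set.mem_univ (-η)) (Set.mem_univ 0) hy (sub_nonneg.2 hy1) (by ring)
  simp only [smul_eq_mul, mul_zero, add_zero, Real.exp_zero, mul_one] at this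
  calc _ = Real.exp (y * -η) := by ring_nf
    _ ≤ _ := this
    _ = _ := by ring

/-- The potential is the log of the weight sum minus `log (w i)`. By convexity of `exp` the sum
shrinks by the factor `1 - (1 - exp (-η)) x_e y`, and `log u ≤ u - 1` turns this into the loss of
HEDGE; the second logarithm contributes the comparator's loss. -/
theorem hedgePot_update {η y : ℝ} {w : Fin ℓ → ℝ≥0} (hw : ∀ i, 0 < w i) (hy : 0 ≤ y)
    (hy1 : y ≤ 1) (e i : Fin ℓ) :
    hedgePot (hedgeUpdate η (singleLoss e y) w) i + (1 - Real.exp (-η)) * (hedgeDist w e * y)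
      ≤ hedgePot w i + η * (if e = i then y else 0) := by
  set w' := hedgeUpdate η (singleLoss e y) w with hw'
  have hW : (0 : ℝ) < ∑ j, (w j : ℝ) := by exact_mod_cast sum_weights_pos hw
  have hwp' : ∀ i, 0 < w' i := hedgeUpdate_pos hw
  have hW' : (0 : ℝ) < ∑ j, (w' j : ℝ) := by exact_mod_cast sum_weights_pos hwp'
  have hwj : ∀ j, (w' j : ℝ) = w j * Real.exp (-η * singleLoss e y j) := fun j => by
    simp [hw', hedgeUpdate, Real.coe_toNNReal _ (Real.exp_pos _).le]
  have hpot : ∀ v : Fin ℓ → ℝ≥0, (∀ i, 0 < v i) →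
      hedgePot v i = Real.log (∑ j, (v j : ℝ)) - Real.log (v i) := fun v hv => by
    have : (0 : ℝ) < ∑ j, (v j : ℝ) := by exact_mod_cast sum_weights_pos hv
    unfold hedgePot hedgeDist
    push_cast
    rw [Real.log_div (by exact_mod_cast (hv i).ne') this.ne']
    ring
  have hsum : ∑ j, (w' j : ℝ)
      ≤ (∑ j, (w j : ℝ)) * (1 - (1 - Real.exp (-η)) * (hedgeDist w e * y)) := by
    have h1 : ∀ j, (w' j : ℝ) ≤ w j - (if j = e then (1 - Real.exp (-η)) * (w e * y) else 0) := by
      intro j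
      rw [hwj]
      unfold singleLoss
      split_ifs with h
      · subst h
        nlinarith [exp_neg_mul_le (η := η) hy hy1, (w j).coe_nonneg]
      · simp
    refine (Finset.sum_le_sum fun j _ => h1 j).trans_eq ?_
    rw [Finset.sum_sub_distrib, Finset.sum_ite_eq' Finset.univ e]
    simp only [Finset.mem_univ, if_true, hedgeDist]
    push_cast
    field_simp
  rw [hpot w hw, hpot w' hwp', hwj i, Real.log_mul (by exact_mod_cast (hw i).ne')
    (Real.exp_pos _).ne', Real.log_exp]
  have hlog : Real.log (∑ j, (w' j : ℝ))
      ≤ Real.log (∑ j, (w j : ℝ)) - (1 - Real.exp (-η)) * (hedgeDist w e * y) := by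
    have hpos := hW'.trans_le hsum
    have hpos2 := (pos_iff_pos_of_mul_pos hpos).1 hW
    calc _ ≤ _ := Real.log_le_log hW' hsum
      _ = _ := Real.log_mul hW.ne' hpos2.ne'
      _ ≤ _ := by linarith [Real.log_le_sub_one_of_pos hpos2]
  have : singleLoss e y i = if e = i then y else 0 := by
    unfold singleLoss
    simp only [eq_comm]
  rw [this]
  linarith

end Hedge

/-! ### One round, split by waiting time. -/

section Step

variable {M : Type*} [MetricSpace M] {ℓ : ℕ} [NeZero ℓ] {D : ℝ} {m : ℕ} {ε η : ℝ}
  {c : CostFn M} {h : Fin ℓ → M} {f : Fin ℓ → ℝ≥0∞} {σ : AlgState M ℓ}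

/-- The probability of scheduling an exploration. -/
noncomputable def exploreProb (ε : ℝ) : ℝ≥0 := min 1 ε.toNNReal

/-- The weights after an exploration of `e`. -/
noncomputable def newWeights (D η : ℝ) (f : Fin ℓ → ℝ≥0∞) (w : Fin ℓ → ℝ≥0) (e : Fin ℓ) :
    Fin ℓ → ℝ≥0 :=
  hedgeUpdate η (singleLoss e ((f e).toReal / (2 * D))) w

theorem Ex_step_exploit (hσ : σ.wait = 0) (F : AlgState M ℓ → ℝ≥0∞) :
    Ex (step D m ε η c h f σ) F
      = exploreProb ε * ((ℓ : ℝ≥0∞)⁻¹ * ∑ e, F { move m c h σ with wait := m, explored := e })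
        + (1 - (exploreProb ε : ℝ≥0∞)) * F (move m c h σ) := by
  unfold step
  simp only [hσ, if_true]
  rw [Ex_bind, Ex_coin]
  simp [Ex_map, Ex_uniform, Ex_pure, exploreProb]

theorem Ex_step_explore (hσ : σ.wait = 1) (F : AlgState M ℓ → ℝ≥0∞) :
    Ex (step D m ε η c h f σ) F
      = Ex (round (hedgeDist σ.weights) (hedgeDist (newWeights D η f σ.weights σ.explored))
          σ.leader) fun j => F { move m c h σ with
            wait := 0, weights := newWeights D η f σ.weights σ.explored, leader := j } := by
  have : (fun j => if j = σ.explored then (f j).toReal / (2 * D) else 0)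
      = singleLoss σ.explored ((f σ.explored).toReal / (2 * D)) := by
    funext j
    unfold singleLoss
    split_ifs with hj
    · rw [hj]
    · rfl
  unfold step
  simp only [hσ, one_ne_zero, if_true, if_false, this]
  rw [Ex_map]
  rfl

theorem Ex_step_wait (h0 : σ.wait ≠ 0) (h1 : σ.wait ≠ 1) (F : AlgState M ℓ → ℝ≥0∞) :
    Ex (step D m ε η c h f σ) F = F { move m c h σ with wait := σ.wait - 1 } := by
  unfold step
  simp only [h0, h1, if_false]
  rw [Ex_pure]


/-- The invariant of a running instance: positive weights, and waiting time at most `m`. -/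
def AlgState.Valid (m : ℕ) (σ : AlgState M ℓ) : Prop := (∀ i, 0 < σ.weights i) ∧ σ.wait ≤ m

theorem valid_of_mem_support_step (hσ : σ.Valid m) {τ : AlgState M ℓ}
    (hτ : τ ∈ (step D m ε η c h f σ).support) : τ.Valid m := by
  unfold step at hτ
  split_ifs at hτ with h0 h1
  · rw [PMF.mem_support_bind_iff] at hτ
    obtain ⟨b, -, hb⟩ := hτ
    cases b with
    | false =>
      simp only [Bool.false_eq_true, if_false, PMF.support_pure, Set.mem_singleton_iff] at hb
      subst hb
      exact hσ
    | true =>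
      simp only [if_true, PMF.mem_support_map_iff] at hb
      obtain ⟨e, -, rfl⟩ := hb
      exact ⟨hσ.1, le_rfl⟩
  · rw [PMF.mem_support_map_iff] at hτ
    obtain ⟨e, -, rfl⟩ := hτ
    exact ⟨hedgeUpdate_pos hσ.1, Nat.zero_le _⟩
  · simp only [PMF.support_pure, Set.mem_singleton_iff] at hτ
    subst hτ
    exact ⟨hσ.1, (Nat.sub_le _ _).trans hσ.2⟩

end Step

/-! ### The law of one instance: leader, weights and waiting time. -/

/-- The law of the memory of `ALG` with exploration rate `ε` and learning rate `η` after `n` rounds,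
when started at the position (and with the cost) drawn from `μ`. -/
noncomputable def run {M : Type*} [MetricSpace M] {ℓ : ℕ} [NeZero ℓ] (D : ℝ) (m : ℕ) (ε η : ℝ)
    (c : ℕ → CostFn M) (s : ℕ → Fin ℓ → M) (f : ℕ → Fin ℓ → ℝ≥0∞) (μ : PMF (AlgState M ℓ)) :
    ℕ → PMF (AlgState M ℓ)
  | 0 => μ.bind fun σ => fresh σ.pos σ.paid
  | n + 1 => (run D m ε η c s f μ n).bind (step D m ε η (c n) (s (n + 1)) (f n))

section Run

variable {M : Type*} [MetricSpace M] {ℓ : ℕ} [NeZero ℓ] {D : ℝ} {m : ℕ} {ε η : ℝ}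
  {c : ℕ → CostFn M} {s : ℕ → Fin ℓ → M} {f : ℕ → Fin ℓ → ℝ≥0∞} {μ : PMF (AlgState M ℓ)}

theorem Ex_run_succ (n : ℕ) (F : AlgState M ℓ → ℝ≥0∞) :
    Ex (run D m ε η c s f μ (n + 1)) F
      = Ex (run D m ε η c s f μ n) fun σ => Ex (step D m ε η (c n) (s (n + 1)) (f n) σ) F :=
  Ex_bind _ _ _

theorem Ex_fresh (p : M) (z : ℝ≥0∞) (F : AlgState M ℓ → ℝ≥0∞) :
    Ex (fresh p z) F = (ℓ : ℝ≥0∞)⁻¹ * ∑ i, F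
      { weights := fun _ => 1, leader := i, wait := 0, explored := i, lastQuery := i, run := 0,
        base := p, pos := p, paid := z } := by
  unfold fresh
  rw [Ex_map, Ex_uniform, Fintype.card_fin]

theorem valid_of_mem_support_run (n : ℕ) {σ : AlgState M ℓ}
    (hσ : σ ∈ (run D m ε η c s f μ n).support) : σ.Valid m := by
  induction n generalizing σ with
  | zero =>
    simp only [run, PMF.mem_support_bind_iff, fresh, PMF.mem_support_map_iff] at hσ
    obtain ⟨_, -, i, -, rfl⟩ := hσ
    exact ⟨fun _ => one_pos, Nat.zero_le _⟩
  | succ n ih =>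
    simp only [run, PMF.mem_support_bind_iff] at hσ
    obtain ⟨τ, hτ, hσ⟩ := hσ
    exact valid_of_mem_support_step (ih hτ) hσ

theorem newWeights_pos {g : Fin ℓ → ℝ≥0∞} {w : Fin ℓ → ℝ≥0} (hw : ∀ i, 0 < w i) (e i : Fin ℓ) :
    0 < newWeights D η g w e i := hedgeUpdate_pos hw i

/-- In every round, the exploited heuristic is distributed according to HEDGE, independently of
the waiting time and of the explored heuristic. -/
theorem Ex_run_leader (n : ℕ) (F : (Fin ℓ → ℝ≥0) → Fin ℓ → ℕ → Fin ℓ → ℝ≥0∞)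
    (hF : ∀ w l e e', F w l 0 e = F w l 0 e') :
    Ex (run D m ε η c s f μ n) (fun σ => F σ.weights σ.leader σ.wait σ.explored)
      = Ex (run D m ε η c s f μ n) fun σ =>
        ∑ i, hedgeDist σ.weights i * F σ.weights i σ.wait σ.explored := by
  induction n generalizing F with
  | zero =>
    simp only [run, Ex_bind, Ex_fresh]
    refine Ex_congr _ fun σ _ => ?_
    congr 1
    have hd : ∀ i : Fin ℓ, (hedgeDist (fun _ : Fin ℓ => (1 : ℝ≥0)) i : ℝ≥0∞) = (ℓ : ℝ≥0∞)⁻¹ := by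
      intro i
      have : (ℓ : ℝ≥0) ≠ 0 := by exact_mod_cast NeZero.ne ℓ
      simp [hedgeDist, ENNReal.coe_inv this]
    simp only [hd]
    -- A new instance stores its leader in `explored`, so independence fails for this field at
    -- waiting time zero; `hF` keeps `F` from reading it there.
    have hrow : ∀ e : Fin ℓ, ∑ i, (ℓ : ℝ≥0∞)⁻¹ * F (fun _ => 1) i 0 e
        = (ℓ : ℝ≥0∞)⁻¹ * ∑ i, F (fun _ => 1) i 0 i := fun e => by
      rw [← Finset.mul_sum]
      congr 1
      exact Finset.sum_congr rfl fun i _ => hF _ _ _ _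
    simp only [hrow]
    rw [Finset.sum_const, Finset.card_univ, Fintype.card_fin, nsmul_eq_mul, ← mul_assoc,
      ENNReal.mul_inv_cancel (by exact_mod_cast NeZero.ne ℓ) (ENNReal.natCast_ne_top ℓ), one_mul]
  | succ n ih =>
    -- The expectation of `F` after one round depends on the same four fields, so the induction
    -- hypothesis applies to it. Averaging over the leader is then preserved because `round`
    -- transports the old distribution to the new one.
    let G : (Fin ℓ → ℝ≥0) → Fin ℓ → ℕ → Fin ℓ → ℝ≥0∞ := fun w l k e =>
      if k = 0 then exploreProb ε * ((ℓ : ℝ≥0∞)⁻¹ * ∑ e', F w l m e')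
        + (1 - (exploreProb ε : ℝ≥0∞)) * F w l 0 e
      else if k = 1 then Ex (round (hedgeDist w) (hedgeDist (newWeights D η (f n) w e)) l)
        fun j => F (newWeights D η (f n) w e) j 0 e
      else F w l (k - 1) e
    have hG : ∀ w l e e', G w l 0 e = G w l 0 e' := fun w l e e' => by
      simp only [G, if_true, hF w l e e']
    rw [Ex_run_succ, Ex_run_succ]
    calc _ = Ex (run D m ε η c s f μ n) fun σ => G σ.weights σ.leader σ.wait σ.explored := by
          refine Ex_congr _ fun σ _ => ?_
          by_cases h0 : σ.wait = 0
          · simp [Ex_step_exploit h0, G, h0, move]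
          by_cases h1 : σ.wait = 1
          · simp [Ex_step_explore h1, G, h1, move]
          · simp [Ex_step_wait h0 h1, G, h0, h1, move]
      _ = _ := ih G hG
      _ = _ := by
          refine Ex_congr _ fun σ hσ => ?_
          have hv := (valid_of_mem_support_run n hσ).1
          by_cases h0 : σ.wait = 0
          · simp only [Ex_step_exploit h0, G, h0, move, if_true, mul_add, Finset.sum_add_distrib,
              Finset.mul_sum]
            congr 1
            · rw [Finset.sum_comm]
              exact Finset.sum_congr rfl fun e _ => Finset.sum_congr rfl fun i _ => by ring
            · exact Finset.sum_congr rfl fun i _ => by ring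
          by_cases h1 : σ.wait = 1
          · simp only [Ex_step_explore h1, G, h1, one_ne_zero, if_true, if_false]
            rw [Ex_const, sum_mul_Ex_round (hedgeDist_pos hv) (sum_hedgeDist hv)
              (sum_hedgeDist (newWeights_pos hv _))]
            rfl
          · simp [Ex_step_wait h0 h1, G, h0, h1, move]

theorem loss_nonneg (hD : 0 < D) (a : ℝ≥0∞) : 0 ≤ a.toReal / (2 * D) := by positivity

theorem loss_le_one (hD : 0 < D) {a : ℝ≥0∞} (ha : a ≤ ENNReal.ofReal (2 * D)) :
    a.toReal / (2 * D) ≤ 1 :=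
  (div_le_one (by positivity)).2 (ENNReal.toReal_le_of_le_ofReal (by positivity) ha)

theorem singleLoss_nonneg {e : Fin ℓ} {y : ℝ} (hy : 0 ≤ y) (i : Fin ℓ) : 0 ≤ singleLoss e y i := by
  unfold singleLoss; split_ifs <;> simp [hy]

theorem singleLoss_le_one {e : Fin ℓ} {y : ℝ} (hy : y ≤ 1) (i : Fin ℓ) : singleLoss e y i ≤ 1 := by
  unfold singleLoss; split_ifs <;> simp [hy]

/-- A round of the algorithm increases the probability of a leader by a factor of at most
`exp η`. -/
theorem Ex_run_step_leader_le (hD : 0 < D) (hη : 0 ≤ η)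
    (hf : ∀ n i, f n i ≤ ENNReal.ofReal (2 * D)) (n : ℕ) (φ : ℕ → ℝ≥0∞) (g : Fin ℓ → ℝ≥0∞) :
    (Real.exp (-η)).toNNReal * Ex (run D m ε η c s f μ n) (fun σ => φ σ.wait *
        Ex (step D m ε η (c n) (s (n + 1)) (f n) σ) fun τ => g τ.leader)
      ≤ Ex (run D m ε η c s f μ n) fun σ => φ σ.wait * g σ.leader := by
  have h1 : ∀ σ : AlgState M ℓ, φ σ.wait *
        Ex (step D m ε η (c n) (s (n + 1)) (f n) σ) (fun τ => g τ.leader) = φ σ.wait *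
      if σ.wait = 1 then Ex (round (hedgeDist σ.weights)
        (hedgeDist (newWeights D η (f n) σ.weights σ.explored)) σ.leader) g else g σ.leader := by
    intro σ
    congr 1
    by_cases h0 : σ.wait = 0
    · simp only [Ex_step_exploit h0, h0, zero_ne_one, if_false, move, Finset.sum_const,
        Finset.card_univ, Fintype.card_fin, nsmul_eq_mul]
      rw [← mul_assoc (ℓ : ℝ≥0∞)⁻¹, ENNReal.inv_mul_cancel (by exact_mod_cast NeZero.ne ℓ)
        (ENNReal.natCast_ne_top ℓ), one_mul, ← add_mul, add_tsub_cancel_of_le, one_mul]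
      exact_mod_cast min_le_left _ _
    by_cases h1 : σ.wait = 1
    · simp [Ex_step_explore h1, h1]
    · simp [Ex_step_wait h0 h1, h1, move]
  simp only [h1]
  rw [Ex_run_leader n (fun w l k e => φ k * if k = 1 then Ex (round (hedgeDist w)
        (hedgeDist (newWeights D η (f n) w e)) l) g else g l) (fun _ _ _ _ => by simp),
    Ex_run_leader n (fun _ l k _ => φ k * g l) (fun _ _ _ _ => rfl), ← Ex_const_mul]
  refine Ex_mono _ fun σ hσ => ?_
  have hv := (valid_of_mem_support_run n hσ).1
  have hq : ((Real.exp (-η)).toNNReal : ℝ≥0∞) ≤ 1 := by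
    exact_mod_cast Real.toNNReal_le_one.2 (Real.exp_le_one_iff.2 (by linarith))
  by_cases hw : σ.wait = 1
  · simp only [hw, if_true]
    have h2 := sum_mul_Ex_round (hedgeDist_pos hv) (sum_hedgeDist hv)
      (sum_hedgeDist (newWeights_pos (D := D) (η := η) (g := f n) hv σ.explored)) g
    calc _ = φ 1 * ((Real.exp (-η)).toNNReal * ∑ i, (hedgeDist σ.weights i : ℝ≥0∞) *
          Ex (round (hedgeDist σ.weights)
            (hedgeDist (newWeights D η (f n) σ.weights σ.explored)) i) g) := by
          simp only [Finset.mul_sum]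
          exact Finset.sum_congr rfl fun i _ => by ring
      _ ≤ φ 1 * ∑ i, hedgeDist σ.weights i * g i := by
          rw [h2, Finset.mul_sum]
          refine mul_le_mul' le_rfl (Finset.sum_le_sum fun i _ => ?_)
          rw [← mul_assoc, ← ENNReal.coe_mul]
          refine mul_le_mul' (ENNReal.coe_le_coe.2 ?_) le_rfl
          exact hedgeDist_update_le hη hv (singleLoss_nonneg (loss_nonneg hD _))
            (singleLoss_le_one (loss_le_one hD (hf n _))) i
      _ = _ := by
          rw [Finset.mul_sum]
          exact Finset.sum_congr rfl fun i _ => by ring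
  · simp only [hw, if_false]
    exact mul_le_of_le_one_left (zero_le) hq

theorem Ex_run_leader_succ_le (hD : 0 < D) (hη : 0 ≤ η)
    (hf : ∀ n i, f n i ≤ ENNReal.ofReal (2 * D)) (n : ℕ) (g : Fin ℓ → ℝ≥0∞) :
    (Real.exp (-η)).toNNReal * Ex (run D m ε η c s f μ (n + 1)) (fun σ => g σ.leader)
      ≤ Ex (run D m ε η c s f μ n) fun σ => g σ.leader := by
  rw [Ex_run_succ]
  simpa using Ex_run_step_leader_le (m := m) (ε := ε) (c := c) (s := s) (μ := μ) hD hη hf n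
    (fun _ => 1) g

theorem Ex_run_leader_add_le (hD : 0 < D) (hη : 0 ≤ η)
    (hf : ∀ n i, f n i ≤ ENNReal.ofReal (2 * D)) (n k : ℕ) (g : Fin ℓ → ℝ≥0∞) :
    ((Real.exp (-η)).toNNReal : ℝ≥0∞) ^ k * Ex (run D m ε η c s f μ (n + k)) (fun σ => g σ.leader)
      ≤ Ex (run D m ε η c s f μ n) fun σ => g σ.leader := by
  induction k with
  | zero => simp
  | succ k ih =>
    refine le_trans ?_ ih
    rw [pow_succ, mul_assoc]
    gcongr
    exact Ex_run_leader_succ_le hD hη hf (n + k) g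

/-- The expectation of `F` over the states with waiting time `k`. -/
noncomputable def Exw (p : PMF (AlgState M ℓ)) (k : ℕ) (F : AlgState M ℓ → ℝ≥0∞) : ℝ≥0∞ :=
  Ex p fun σ => if σ.wait = k then F σ else 0

/-- A waiting time strictly between `0` and `m` arises only by counting down, which leaves weights,
leader and explored heuristic untouched. -/
theorem Exw_run_succ_lt {k : ℕ} (hk : 1 ≤ k) (hkm : k < m) (n : ℕ)
    (F : (Fin ℓ → ℝ≥0) → Fin ℓ → Fin ℓ → ℝ≥0∞) :
    Exw (run D m ε η c s f μ (n + 1)) k (fun σ => F σ.weights σ.leader σ.explored)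
      = Exw (run D m ε η c s f μ n) (k + 1) fun σ => F σ.weights σ.leader σ.explored := by
  unfold Exw
  rw [Ex_run_succ]
  refine Ex_congr _ fun σ _ => ?_
  have hk0 : k ≠ 0 := by omega
  have hkm' : m ≠ k := by omega
  by_cases h0 : σ.wait = 0
  · simp [Ex_step_exploit h0, h0, hk0.symm, hkm', move]
  by_cases h1 : σ.wait = 1
  · simp [Ex_step_explore h1, h1, hk0.symm, hk0, Ex_zero]
  · have : σ.wait - 1 = k ↔ σ.wait = k + 1 := by omega
    simp [Ex_step_wait h0 h1, move, this]

theorem Exw_run_succ_self (hm : 2 ≤ m) (n : ℕ)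
    (F : (Fin ℓ → ℝ≥0) → Fin ℓ → Fin ℓ → ℝ≥0∞) :
    Exw (run D m ε η c s f μ (n + 1)) m (fun σ => F σ.weights σ.leader σ.explored)
      = exploreProb ε * Exw (run D m ε η c s f μ n) 0 fun σ =>
          (ℓ : ℝ≥0∞)⁻¹ * ∑ e, F σ.weights σ.leader e := by
  unfold Exw
  rw [Ex_run_succ, ← Ex_const_mul]
  refine Ex_congr _ fun σ hσ => ?_
  have hm0 : m ≠ 0 := by omega
  by_cases h0 : σ.wait = 0
  · simp [Ex_step_exploit h0, h0, hm0.symm, move]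
  by_cases h1 : σ.wait = 1
  · simp [Ex_step_explore h1, h1, hm0.symm, Ex_zero]
  · have hv := (valid_of_mem_support_run n hσ).2
    have : σ.wait - 1 ≠ m := by omega
    simp [Ex_step_wait h0 h1, this, h0]

theorem Exw_run_zero {k : ℕ} (hk : k ≠ 0) (F : AlgState M ℓ → ℝ≥0∞) :
    Exw (run D m ε η c s f μ 0) k F = 0 := by
  unfold Exw
  simp [run, Ex_bind, Ex_fresh, hk.symm, Ex_zero]

/-- The states with waiting time `m - i` stem from the exploitation states `i + 1` rounds before. -/
theorem Exw_run_add (hm : 2 ≤ m) (n i : ℕ) (hi : i < m)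
    (F : (Fin ℓ → ℝ≥0) → Fin ℓ → Fin ℓ → ℝ≥0∞) :
    Exw (run D m ε η c s f μ (n + (i + 1))) (m - i) (fun σ => F σ.weights σ.leader σ.explored)
      = exploreProb ε * Exw (run D m ε η c s f μ n) 0 fun σ =>
          (ℓ : ℝ≥0∞)⁻¹ * ∑ e, F σ.weights σ.leader e := by
  induction i with
  | zero => exact Exw_run_succ_self hm n F
  | succ i ih =>
    rw [← ih (by omega), ← add_assoc n, Exw_run_succ_lt (by omega) (by omega)]
    congr 1
    omega

/-- An instance begins with an exploitation round, so waiting time `m - i` needs at least `i + 1`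
rounds. -/
theorem Exw_run_eq_zero (n i : ℕ) (hi : i < m) (hn : n ≤ i)
    (F : (Fin ℓ → ℝ≥0) → Fin ℓ → Fin ℓ → ℝ≥0∞) :
    Exw (run D m ε η c s f μ n) (m - i) (fun σ => F σ.weights σ.leader σ.explored) = 0 := by
  induction n generalizing i with
  | zero => exact Exw_run_zero (by omega) _
  | succ n ih =>
    rw [Exw_run_succ_lt (by omega) (by omega)]
    have := ih (i - 1) (by omega) (by omega)
    rwa [show m - (i - 1) = m - i + 1 by omega] at this

/-- With probability `1 - ε` an exploitation state remains one, with the same leader. -/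
theorem Exw_run_leader_succ_ge (n : ℕ) (g : Fin ℓ → ℝ≥0∞) :
    (1 - (exploreProb ε : ℝ≥0∞)) * Exw (run D m ε η c s f μ n) 0 (fun σ => g σ.leader)
      ≤ Exw (run D m ε η c s f μ (n + 1)) 0 fun σ => g σ.leader := by
  unfold Exw
  rw [Ex_run_succ, ← Ex_const_mul]
  refine Ex_mono _ fun σ _ => ?_
  by_cases h0 : σ.wait = 0
  · rw [Ex_step_exploit h0]
    simp only [h0, if_true, move]
    exact le_add_self
  · simp [h0]

theorem Exw_run_leader_add_ge (hε : ε ≤ 1 / 2) (n k : ℕ) (g : Fin ℓ → ℝ≥0∞) :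
    Exw (run D m ε η c s f μ n) 0 (fun σ => g σ.leader)
      ≤ 2 ^ k * Exw (run D m ε η c s f μ (n + k)) 0 fun σ => g σ.leader := by
  induction k with
  | zero => simp
  | succ k ih =>
    refine ih.trans ?_
    rw [pow_succ, mul_assoc]
    gcongr
    have h2 : (1 : ℝ≥0∞) ≤ 2 * (1 - (exploreProb ε : ℝ≥0∞)) := by
      have : exploreProb ε ≤ 1 / 2 := by
        refine (min_le_right _ _).trans ?_
        rw [Real.toNNReal_le_iff_le_coe]
        simpa using hε
      have h3 : (1 : ℝ≥0) ≤ 2 * (1 - exploreProb ε) := by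
        rw [← NNReal.coe_le_coe]
        have h4 : exploreProb ε ≤ 1 := min_le_left _ _
        rw [← NNReal.coe_le_coe] at this
        push_cast [NNReal.coe_sub h4] at this ⊢
        linarith
      exact_mod_cast h3
    calc _ ≤ 2 * (1 - (exploreProb ε : ℝ≥0∞)) *
          Exw (run D m ε η c s f μ (n + k)) 0 (fun σ => g σ.leader) := le_mul_of_one_le_left' h2
      _ ≤ _ := by
        rw [mul_assoc]
        gcongr
        exact Exw_run_leader_succ_ge (n + k) g

/-- These states branch off, with probability `ε` and unchanged leader, from the exploitation states
`i + 1` rounds earlier. Of the latter, at least a fraction `2 ^ (-(i + 1))` is still exploiting the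
same leader now. Comparing leader by leader, rather than only total masses, lets `g` be an arbitrary
cost. -/
theorem Exw_run_leader_le (hm : 2 ≤ m) (hε : ε ≤ 1 / 2) (n i : ℕ) (hi : i < m)
    (g : Fin ℓ → ℝ≥0∞) :
    Exw (run D m ε η c s f μ n) (m - i) (fun σ => g σ.leader)
      ≤ exploreProb ε * 2 ^ m * Exw (run D m ε η c s f μ n) 0 fun σ => g σ.leader := by
  rcases Nat.lt_or_ge i n with hn | hn
  · obtain ⟨n, rfl⟩ := Nat.exists_eq_add_of_le' hn
    rw [Exw_run_add hm n i hi fun _ l _ => g l, mul_assoc]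
    gcongr
    simp only [Finset.sum_const, Finset.card_univ, Fintype.card_fin, nsmul_eq_mul]
    simp only [← mul_assoc (ℓ : ℝ≥0∞)⁻¹, ENNReal.inv_mul_cancel
      (show (ℓ : ℝ≥0∞) ≠ 0 by exact_mod_cast NeZero.ne ℓ) (ENNReal.natCast_ne_top ℓ), one_mul]
    refine (Exw_run_leader_add_ge hε n (i + 1) g).trans ?_
    gcongr
    · norm_num
    · omega
  · rw [Exw_run_eq_zero n i hi hn fun _ l _ => g l]
    exact zero_le

theorem Ex_run_wait_ne_zero_le (hm : 2 ≤ m) (hε : ε ≤ 1 / 2) (n : ℕ) (g : Fin ℓ → ℝ≥0∞) :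
    Ex (run D m ε η c s f μ n) (fun σ => if σ.wait ≠ 0 then g σ.leader else 0)
      ≤ m * (exploreProb ε * 2 ^ m) * Exw (run D m ε η c s f μ n) 0 fun σ => g σ.leader := by
  calc _ ≤ Ex (run D m ε η c s f μ n) (fun σ => ∑ i ∈ Finset.range m,
        if σ.wait = m - i then g σ.leader else 0) := by
        refine Ex_mono _ fun σ hσ => ?_
        have hv := (valid_of_mem_support_run n hσ).2
        split_ifs with h0
        · refine le_trans ?_ (Finset.single_le_sum (f := fun i =>
            if σ.wait = m - i then g σ.leader else 0) (fun _ _ => zero_le)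
            (Finset.mem_range.2 (show m - σ.wait < m by omega)))
          rw [if_pos (by omega)]
        · exact zero_le
    _ = ∑ i ∈ Finset.range m, Exw (run D m ε η c s f μ n) (m - i) fun σ => g σ.leader :=
        Ex_sum _ _ _
    _ ≤ ∑ i ∈ Finset.range m, exploreProb ε * 2 ^ m *
          Exw (run D m ε η c s f μ n) 0 fun σ => g σ.leader :=
        Finset.sum_le_sum fun i hi => Exw_run_leader_le hm hε n i (Finset.mem_range.1 hi) g
    _ = _ := by rw [Finset.sum_const, Finset.card_range, nsmul_eq_mul]; ring

end Run

/-! ### The potential of the position and its growth in one round. -/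

section Move

variable {M : Type*} [MetricSpace M] {ℓ : ℕ} [NeZero ℓ] {D : ℝ} {m : ℕ} {ε η : ℝ}
  {c : CostFn M} {h h' : Fin ℓ → M} {f : Fin ℓ → ℝ≥0∞} {σ : AlgState M ℓ}

/-- The number of consecutive queries of the exploited heuristic so far. -/
def AlgState.leaderRun (σ : AlgState M ℓ) : ℕ := if σ.lastQuery = σ.leader then σ.run else 0

/-- The queries of the exploited heuristic that are missing until its state is known. -/
def AlgState.missing (m : ℕ) (σ : AlgState M ℓ) : ℕ := m - 2 - σ.leaderRun

/-- The coefficient of the distance between the base and the exploited heuristic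
in the potential function. -/
def AlgState.coeff (m : ℕ) (σ : AlgState M ℓ) : ℕ :=
  if σ.wait = 0 then 1 + 6 * σ.missing m else 1 + 6 * m + 2 * σ.wait

/-- The cost paid so far and the potential of the position, where `h` are the states of
the heuristics. -/
noncomputable def AlgState.potential (m : ℕ) (h : Fin ℓ → M) (σ : AlgState M ℓ) : ℝ≥0∞ :=
  σ.paid + edist σ.pos σ.base + σ.coeff m * edist σ.base (h σ.leader)

theorem greedy_le (hc : Admissible c) (b p : M) :
    edist b (greedy c b) + c (greedy c b) ≤ edist b p + c p := by
  unfold greedy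
  rw [dif_pos (hc.2 b)]
  exact (hc.2 b).choose_spec p

/-- Whether the state of the exploited heuristic is known in the coming round. -/
def AlgState.Known (m : ℕ) (σ : AlgState M ℓ) : Prop :=
  (if σ.wait = 0 then σ.leader else σ.explored) = σ.leader ∧
    m ≤ (if (if σ.wait = 0 then σ.leader else σ.explored) = σ.lastQuery then σ.run + 1 else 1) + 1

theorem move_of_known (hk : σ.Known m) :
    (move m c h σ).base = h σ.leader ∧ (move m c h σ).pos = h σ.leader ∧
      (move m c h σ).paid = σ.paid + (c (h σ.leader) + edist σ.pos (h σ.leader)) := by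
  unfold AlgState.Known at hk
  simp only [move, if_pos hk, and_self]

theorem move_of_not_known (hk : ¬ σ.Known m) :
    (move m c h σ).base = σ.base ∧ (move m c h σ).pos = greedy c σ.base ∧
      (move m c h σ).paid = σ.paid + (c (greedy c σ.base) + edist σ.pos (greedy c σ.base)) := by
  unfold AlgState.Known at hk
  simp only [move, if_neg hk, and_self]

theorem paid_move_of_known (hk : σ.Known m)
    (hf : ∀ i, f i = c (h' i) + edist (h i) (h' i)) :
    (move m c h' σ).paid ≤ σ.paid + edist σ.pos σ.base + edist σ.base (h σ.leader)
      + f σ.leader := by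
  rw [(move_of_known hk).2.2, hf]
  have h1 : edist σ.pos (h' σ.leader) ≤ edist σ.pos σ.base + edist σ.base (h σ.leader)
      + edist (h σ.leader) (h' σ.leader) :=
    (edist_triangle _ _ _).trans (add_le_add_left (edist_triangle _ _ _) _)
  calc _ ≤ σ.paid + (c (h' σ.leader) + (edist σ.pos σ.base + edist σ.base (h σ.leader)
      + edist (h σ.leader) (h' σ.leader))) := by gcongr
    _ = _ := by ring

/-- The detour from the base to the greedy state and back costs at most twice the greedy objective,
which is compared with the leader's new state. The triangle inequality through the leader's old
state produces `f`. -/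
theorem paid_move_of_not_known (hc : Admissible c) (hk : ¬ σ.Known m)
    (hf : ∀ i, f i = c (h' i) + edist (h i) (h' i)) :
    (move m c h' σ).paid + edist (move m c h' σ).pos (move m c h' σ).base
      ≤ σ.paid + edist σ.pos σ.base + 2 * f σ.leader + 2 * edist σ.base (h σ.leader) := by
  obtain ⟨h1, h2, h3⟩ := move_of_not_known (c := c) (h := h') hk
  rw [h1, h2, h3, hf]
  set p := greedy c σ.base
  have h4 : edist σ.base p + c p ≤ edist σ.base (h σ.leader) + edist (h σ.leader) (h' σ.leader)
      + c (h' σ.leader) :=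
    (greedy_le hc _ _).trans (add_le_add_left (edist_triangle _ _ _) _)
  have h5 : edist σ.pos p ≤ edist σ.pos σ.base + edist σ.base p := edist_triangle _ _ _
  calc _ ≤ σ.paid + (c p + (edist σ.pos σ.base + edist σ.base p)) + edist σ.base p := by
        rw [edist_comm p]
        gcongr
    _ ≤ σ.paid + edist σ.pos σ.base + 2 * (edist σ.base p + c p) := by
        calc _ ≤ σ.paid + (c p + (edist σ.pos σ.base + edist σ.base p)) + edist σ.base p + c p :=
              le_self_add
          _ = _ := by ring
    _ ≤ σ.paid + edist σ.pos σ.base + 2 * (edist σ.base (h σ.leader)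
          + edist (h σ.leader) (h' σ.leader) + c (h' σ.leader)) := by gcongr
    _ = _ := by ring

theorem edist_base_move_le (hf : ∀ i, f i = c (h' i) + edist (h i) (h' i)) :
    edist (move m c h' σ).base (h' σ.leader) ≤ edist σ.base (h σ.leader) + f σ.leader := by
  by_cases hk : σ.Known m
  · rw [(move_of_known hk).1, edist_self]
    exact zero_le
  · rw [(move_of_not_known hk).1, hf]
    exact (edist_triangle _ _ _).trans (add_le_add_right le_add_self _)

/-- One move, with the final potential coefficient `κ`. -/
theorem potential_move_le (hc : Admissible c) (hf : ∀ i, f i = c (h' i) + edist (h i) (h' i))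
    (κ : ℝ≥0∞) :
    (move m c h' σ).paid + edist (move m c h' σ).pos (move m c h' σ).base
        + κ * edist (move m c h' σ).base (h' σ.leader)
      ≤ σ.paid + edist σ.pos σ.base + (2 + κ) * edist σ.base (h σ.leader)
        + (2 + κ) * f σ.leader := by
  by_cases hk : σ.Known m
  -- The loss `2` in the coefficient is needed only for greedy steps; here position, base and leader
  -- coincide afterwards.
  · rw [(move_of_known hk).2.1, (move_of_known hk).1, edist_self, mul_zero, add_zero, add_zero]
    refine (paid_move_of_known hk hf).trans ?_
    have : (1 : ℝ≥0∞) ≤ 2 + κ := by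
      calc (1 : ℝ≥0∞) ≤ 2 := by norm_num
        _ ≤ _ := le_self_add
    gcongr
    · exact le_mul_of_one_le_left' this
    · exact le_mul_of_one_le_left' this
  · calc _ ≤ σ.paid + edist σ.pos σ.base + 2 * f σ.leader + 2 * edist σ.base (h σ.leader)
          + κ * (edist σ.base (h σ.leader) + f σ.leader) := by
          exact add_le_add (paid_move_of_not_known hc hk hf)
            (mul_le_mul' le_rfl (edist_base_move_le hf))
      _ = _ := by ring

theorem coeff_le_of_wait_eq_zero (h0 : σ.wait = 0) : σ.coeff m ≤ 1 + 6 * m := by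
  unfold AlgState.coeff AlgState.missing
  rw [if_pos h0]
  omega

/-- Whether the coming round may be one with a greedy step. -/
def AlgState.Bad (m : ℕ) (σ : AlgState M ℓ) : Prop := σ.wait ≠ 0 ∨ σ.leaderRun + 2 < m

/-- The query of the coming round is the last of the `m - 1` required ones, so `m - 2` earlier
queries suffice. -/
theorem known_of_not_bad (hb : ¬ σ.Bad m) : σ.Known m := by
  unfold AlgState.Bad AlgState.leaderRun at hb
  unfold AlgState.Known
  push Not at hb
  obtain ⟨h0, h1⟩ := hb
  simp only [h0, if_true, true_and]
  simp only [eq_comm (a := σ.leader)]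
  split_ifs at h1 ⊢ <;> omega

theorem leaderRun_move_of_wait_eq_zero (h0 : σ.wait = 0) :
    (move m c h σ).leaderRun = σ.leaderRun + 1 := by
  unfold AlgState.leaderRun
  simp only [move, h0, if_true]
  simp only [eq_comm (a := σ.leader)]
  split_ifs <;> rfl

/-- The leader is left only in proportion to its own loss. A switch moves the target by at most `D`,
while the loss is normalised by `2 D`, so switching is charged to `η` times the leader's cost. -/
theorem Ex_round_leader_ne_le (hD : 0 < D) (hη : 0 ≤ η) (hσ : σ.Valid m) :
    Ex (round (hedgeDist σ.weights) (hedgeDist (newWeights D η f σ.weights σ.explored)) σ.leader)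
        (fun j => if j = σ.leader then 0 else 1)
      ≤ ENNReal.ofReal (η * ((f σ.leader).toReal / (2 * D))) := by
  set y := (f σ.leader).toReal / (2 * D)
  have hy : 0 ≤ y := loss_nonneg hD _
  have h1 := le_hedgeDist_update (g := singleLoss σ.explored ((f σ.explored).toReal / (2 * D)))
    hη hσ.1 (singleLoss_nonneg (loss_nonneg hD _)) σ.leader
  have h2 : singleLoss σ.explored ((f σ.explored).toReal / (2 * D)) σ.leader ≤ y := by
    unfold singleLoss
    split_ifs with h
    · rw [← h]
    · exact hy
  have h3 : Real.exp (-η * y) ≤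
      Real.exp (-η * singleLoss σ.explored ((f σ.explored).toReal / (2 * D)) σ.leader) := by
    apply Real.exp_le_exp.2
    nlinarith
  have h4 : Real.exp (-η * y) ≤ 1 := Real.exp_le_one_iff.2 (by nlinarith [mul_nonneg hη hy])
  refine (Ex_round_ne_le (q := (Real.exp (-η * y)).toNNReal) (hedgeDist_pos hσ.1 _) ?_
    (Real.toNNReal_le_one.2 h4)).trans ?_
  · exact (mul_le_mul_left (Real.toNNReal_le_toNNReal h3) _).trans h1
  · change 1 - ENNReal.ofReal (Real.exp (-η * y)) ≤ _
    rw [← ENNReal.ofReal_one, ← ENNReal.ofReal_sub _ (Real.exp_pos _).le]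
    apply ENNReal.ofReal_le_ofReal
    linarith [Real.add_one_le_exp (-η * y)]

open Classical in
/-- One round of the algorithm: the growth of the potential is the cost of the exploited heuristic,
up to a constant factor in bad rounds. -/
theorem Ex_step_potential_le (hD : 0 < D) (hM : ∀ s s' : M, dist s s' ≤ D) (hη : 0 ≤ η)
    (hm : 2 ≤ m) (hε : 8 * m * ε ≤ 4) (hc : Admissible c)
    (hf : ∀ i, f i = c (h' i) + edist (h i) (h' i))
    (hf2 : ∀ i, f i ≤ ENNReal.ofReal (2 * D)) (hσ : σ.Valid m) :
    Ex (step D m ε η c h' f σ) (AlgState.potential m h')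
      ≤ σ.potential m h + f σ.leader
        + (if σ.Bad m then (3 + 8 * m + (1 + 6 * m) * ENNReal.ofReal η) * f σ.leader else 0) := by
  have hMe : ∀ s s' : M, edist s s' ≤ ENNReal.ofReal D := fun s s' => by
    rw [edist_dist]
    exact ENNReal.ofReal_le_ofReal (hM s s')
  set Δ := edist σ.base (h σ.leader) with hΔ
  set A := σ.paid + edist σ.pos σ.base with hA
  by_cases h0 : σ.wait = 0
  · rw [Ex_step_exploit h0]
    set p : ℝ≥0∞ := (exploreProb ε : ℝ≥0∞)
    have hp1 : p ≤ 1 := by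
      have : exploreProb ε ≤ 1 := min_le_left _ _
      exact ENNReal.coe_le_coe.2 this
    have hpp : p + (1 - p) = 1 := add_tsub_cancel_of_le hp1
    have hℓ : ∀ a : ℝ≥0∞, (ℓ : ℝ≥0∞)⁻¹ * ∑ _e : Fin ℓ, a = a := fun a => by
      rw [Finset.sum_const, Finset.card_univ, Fintype.card_fin, nsmul_eq_mul, ← mul_assoc,
        ENNReal.inv_mul_cancel (by exact_mod_cast NeZero.ne ℓ) (ENNReal.natCast_ne_top ℓ), one_mul]
    by_cases hb : σ.Bad m
    · have hN : σ.leaderRun + 2 < m := by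
        unfold AlgState.Bad at hb
        tauto
      -- Budget of a bad exploitation round: the extra query lowers the coefficient by `6`. Of this,
      -- `2` pays for the greedy step and `4` for the expected jump to `1 + 8 m` when an exploration
      -- is scheduled.
      have hp8 : p * (8 * m) ≤ 4 := by
        have h1 : p ≤ ENNReal.ofReal ε := by
          have : exploreProb ε ≤ ε.toNNReal := min_le_right _ _
          exact ENNReal.coe_le_coe.2 this
        calc p * (8 * m) ≤ ENNReal.ofReal ε * ENNReal.ofReal (8 * m) := by
              gcongr
              rw [ENNReal.ofReal_mul (by norm_num)]
              simp
          _ = ENNReal.ofReal (8 * m * ε) := by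
              rw [← ENNReal.ofReal_mul' (by positivity), mul_comm]
          _ ≤ ENNReal.ofReal 4 := ENNReal.ofReal_le_ofReal hε
          _ = 4 := by simp
      obtain ⟨N, hN'⟩ : ∃ N, σ.missing m = N + 1 :=
        ⟨σ.missing m - 1, by unfold AlgState.missing; omega⟩
      have hκ : σ.coeff m = 7 + 6 * N := by
        unfold AlgState.coeff
        rw [if_pos h0, hN']
        ring
      have hκ0 : (move m c h' σ).coeff m = 1 + 6 * N := by
        unfold AlgState.coeff
        rw [if_pos (show (move m c h' σ).wait = 0 from h0)]
        unfold AlgState.missing at hN' ⊢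
        rw [leaderRun_move_of_wait_eq_zero h0]
        omega
      have hκ1 : ∀ e, ({ move m c h' σ with wait := m, explored := e } : AlgState M ℓ).coeff m
          = 1 + 8 * m := fun e => by
        unfold AlgState.coeff
        simp only [show m ≠ 0 by omega, if_false]
        ring
      simp only [AlgState.potential, hκ0, hκ1, hℓ]
      have hNm : N ≤ m := by unfold AlgState.missing at hN'; omega
      set B := (move m c h' σ).paid + edist (move m c h' σ).pos (move m c h' σ).base with hB
      set E := edist (move m c h' σ).base (h' σ.leader) with hE
      have hpot := potential_move_le (m := m) (σ := σ) hc hf (((1 + 6 * N : ℕ) : ℝ≥0∞) + 4)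
      calc _ = (p + (1 - p)) * B + (p * (1 + 8 * m) + (1 - p) * (1 + 6 * N)) * E := by
            change p * (B + ((1 + 8 * m : ℕ) : ℝ≥0∞) * E)
              + (1 - p) * (B + ((1 + 6 * N : ℕ) : ℝ≥0∞) * E) = _
            push_cast
            ring
        _ ≤ B + (((1 + 6 * N : ℕ) : ℝ≥0∞) + 4) * E := by
            rw [hpp, one_mul]
            refine add_le_add le_rfl (mul_le_mul' ?_ le_rfl)
            push_cast
            calc _ = (p + (1 - p)) + (1 - p) * (6 * N) + p * (8 * m) := by ring
              _ ≤ 1 + 1 * (6 * N) + 4 := by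
                rw [hpp]
                gcongr
                exact tsub_le_self
              _ = _ := by ring
        _ ≤ _ := hpot
        _ ≤ _ := by
            rw [if_pos hb]
            change _ ≤ A + ((σ.coeff m : ℕ) : ℝ≥0∞) * Δ + _ + _
            rw [hκ]
            push_cast
            calc _ = A + (7 + 6 * N) * Δ + (7 + 6 * N) * f σ.leader := by ring
              _ ≤ A + (7 + 6 * N) * Δ + (4 + 8 * m) * f σ.leader := by
                gcongr A + (7 + 6 * N) * Δ + ?_ * f σ.leader
                have : 7 + 6 * N ≤ 4 + 8 * m := by
                  unfold AlgState.missing at hN'; omega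
                exact_mod_cast this
              _ = A + (7 + 6 * N) * Δ + f σ.leader + (3 + 8 * m) * f σ.leader := by ring
              _ ≤ _ := add_le_add le_rfl (mul_le_mul' le_self_add le_rfl)
    -- The algorithm ends on its leader's state, so both distances vanish and even a scheduled
    -- exploration leaves the potential equal to the cost paid.
    · have hk := known_of_not_bad hb
      have hb' : ∀ e, ({ move m c h' σ with wait := m, explored := e } : AlgState M ℓ).potential m h'
          = (move m c h' σ).paid := fun e => by
        simp only [AlgState.potential, (move_of_known hk).2.1, (move_of_known hk).1]
        simp [move]
      have hb'' : (move m c h' σ).potential m h' = (move m c h' σ).paid := by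
        simp only [AlgState.potential, (move_of_known hk).2.1, (move_of_known hk).1]
        simp [move]
      simp only [hb', hb'', hℓ]
      rw [← add_mul, hpp, one_mul, if_neg hb, add_zero]
      refine (paid_move_of_known hk hf).trans ?_
      unfold AlgState.potential
      gcongr
      refine le_mul_of_one_le_left' ?_
      have : 1 ≤ σ.coeff m := by
        unfold AlgState.coeff
        rw [if_pos h0]
        omega
      exact_mod_cast this
  have hb : σ.Bad m := Or.inl h0
  rw [if_pos hb]
  have hcoeff : σ.coeff m = 1 + 6 * m + 2 * σ.wait := by
    unfold AlgState.coeff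
    rw [if_neg h0]
  by_cases h1 : σ.wait = 1
  -- The coefficient falls from `3 + 6 m` to at most `1 + 6 m`, whatever the new leader's run of
  -- queries; a new leader adds at most `D` times this coefficient.
  · rw [Ex_step_explore h1]
    set x' := newWeights D η f σ.weights σ.explored
    have hpt : ∀ j, ({ move m c h' σ with wait := 0, weights := x', leader := j } :
        AlgState M ℓ).potential m h'
        ≤ ((move m c h' σ).paid + edist (move m c h' σ).pos (move m c h' σ).base
          + (1 + 6 * m : ℕ) * edist (move m c h' σ).base (h' σ.leader))
          + (1 + 6 * m : ℕ) * (ENNReal.ofReal D * if j = σ.leader then 0 else 1) := by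
      intro j
      have hk := coeff_le_of_wait_eq_zero (m := m)
        (σ := { move m c h' σ with wait := 0, weights := x', leader := j }) rfl
      have hd : edist (move m c h' σ).base (h' j) ≤ edist (move m c h' σ).base (h' σ.leader)
          + ENNReal.ofReal D * if j = σ.leader then 0 else 1 := by
        split_ifs with hj
        · rw [hj]; simp
        · rw [mul_one]
          exact (edist_triangle _ (h' σ.leader) _).trans (add_le_add_right (hMe _ _) _)
      unfold AlgState.potential
      calc _ ≤ (move m c h' σ).paid + edist (move m c h' σ).pos (move m c h' σ).base
          + (1 + 6 * m : ℕ) * (edist (move m c h' σ).base (h' σ.leader)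
          + ENNReal.ofReal D * if j = σ.leader then 0 else 1) := by
            gcongr
        _ = _ := by ring
    refine (Ex_mono _ fun j _ => hpt j).trans ?_
    rw [Ex_add, Ex_const, Ex_const_mul, Ex_const_mul]
    have hsw : ENNReal.ofReal D * Ex (round (hedgeDist σ.weights) (hedgeDist x') σ.leader)
        (fun j => if j = σ.leader then 0 else 1) ≤ ENNReal.ofReal η * f σ.leader := by
      have hft : f σ.leader ≠ ∞ := ((hf2 _).trans_lt ENNReal.ofReal_lt_top).ne
      calc _ ≤ ENNReal.ofReal D * ENNReal.ofReal (η * ((f σ.leader).toReal / (2 * D))) := by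
            gcongr
            exact Ex_round_leader_ne_le hD hη hσ
        _ = ENNReal.ofReal (η * ((f σ.leader).toReal / 2)) := by
            rw [← ENNReal.ofReal_mul hD.le]
            congr 1
            field_simp
        _ ≤ ENNReal.ofReal (η * (f σ.leader).toReal) := by
            apply ENNReal.ofReal_le_ofReal
            have : 0 ≤ (f σ.leader).toReal := ENNReal.toReal_nonneg
            gcongr
            linarith
        _ = _ := by rw [ENNReal.ofReal_mul hη, ENNReal.ofReal_toReal hft]
    calc _ ≤ (σ.paid + edist σ.pos σ.base + (2 + ((1 + 6 * m : ℕ) : ℝ≥0∞)) * edist σ.base (h σ.leader)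
        + (2 + ((1 + 6 * m : ℕ) : ℝ≥0∞)) * f σ.leader)
          + (1 + 6 * m : ℕ) * (ENNReal.ofReal η * f σ.leader) := by
          exact add_le_add (potential_move_le hc hf _) (mul_le_mul' le_rfl hsw)
      _ ≤ (σ.paid + edist σ.pos σ.base + (2 + ((1 + 6 * m : ℕ) : ℝ≥0∞)) * edist σ.base (h σ.leader)
        + (4 + 8 * m : ℕ) * f σ.leader)
          + (1 + 6 * m : ℕ) * (ENNReal.ofReal η * f σ.leader) := by
          gcongr
          have : 2 + (1 + 6 * m) ≤ 4 + 8 * m := by omega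
          exact_mod_cast this
      _ = _ := by
          unfold AlgState.potential
          rw [hcoeff, h1]
          push_cast
          ring
  -- Counting down lowers the coefficient by exactly the `2` that a greedy step needs.
  · rw [Ex_step_wait h0 h1]
    obtain ⟨k, hk⟩ : ∃ k, σ.wait = k + 2 := ⟨σ.wait - 2, by omega⟩
    have hκ : ({ move m c h' σ with wait := σ.wait - 1 } : AlgState M ℓ).coeff m
        = 1 + 6 * m + 2 * (k + 1) := by
      unfold AlgState.coeff
      rw [hk]
      rfl
    unfold AlgState.potential
    rw [hκ, hcoeff]
    refine (potential_move_le hc hf _).trans ?_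
    have hkm : k + 2 ≤ m := hk ▸ hσ.2
    calc _ ≤ σ.paid + edist σ.pos σ.base
        + (2 + ((1 + 6 * m + 2 * (k + 1) : ℕ) : ℝ≥0∞)) * edist σ.base (h σ.leader)
        + (4 + 8 * m : ℕ) * f σ.leader := by
          gcongr
          have : 2 + (1 + 6 * m + 2 * (k + 1)) ≤ 4 + 8 * m := by omega
          exact_mod_cast this
      _ = σ.paid + edist σ.pos σ.base
        + ((1 + 6 * m + 2 * σ.wait : ℕ) : ℝ≥0∞) * edist σ.base (h σ.leader)
        + f σ.leader + (3 + 8 * m) * f σ.leader := by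
          rw [hk]
          push_cast
          ring
      _ ≤ _ := add_le_add le_rfl (mul_le_mul' le_self_add le_rfl)

end Move

/-! ### Bad rounds, HEDGE regret on sampled losses, and the summed potential. -/

section Run

variable {M : Type*} [MetricSpace M] {ℓ : ℕ} [NeZero ℓ] {D : ℝ} {m : ℕ} {ε η : ℝ}
  {c : ℕ → CostFn M} {s : ℕ → Fin ℓ → M} {f : ℕ → Fin ℓ → ℝ≥0∞} {μ : PMF (AlgState M ℓ)}

/-- Each exploitation round lengthens the leader's run by one. A short run in an exploitation state
was thus already short one round earlier, or an exploration has just ended. -/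
theorem Ex_run_short_succ_le (hm : 2 ≤ m) (n j : ℕ) (g : Fin ℓ → ℝ≥0∞) :
    Ex (run D m ε η c s f μ (n + 1))
        (fun σ => if σ.wait = 0 ∧ σ.leaderRun < j + 1 then g σ.leader else 0)
      ≤ Ex (run D m ε η c s f μ n)
          (fun σ => if σ.wait = 0 ∧ σ.leaderRun < j then g σ.leader else 0)
        + Ex (run D m ε η c s f μ n) (fun σ => (if σ.wait = 1 then 1 else 0) *
            Ex (step D m ε η (c n) (s (n + 1)) (f n) σ) fun τ => g τ.leader) := by
  rw [Ex_run_succ, ← Ex_add]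
  refine Ex_mono _ fun σ _ => ?_
  by_cases h0 : σ.wait = 0
  · have hp : (1 - (exploreProb ε : ℝ≥0∞)) ≤ 1 := tsub_le_self
    have hr := leaderRun_move_of_wait_eq_zero (m := m) (c := c n) (h := s (n + 1)) h0
    have h2 : (move m (c n) (s (n + 1)) σ).wait = 0 := h0
    rw [Ex_step_exploit h0, hr]
    simp only [show m ≠ 0 by omega, h2, h0, false_and, true_and, if_false, Finset.sum_const_zero,
      mul_zero, zero_add, add_lt_add_iff_right, zero_ne_one, zero_mul, add_zero]
    exact mul_le_of_le_one_left (zero_le) hp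
  by_cases h1 : σ.wait = 1
  · refine le_trans ?_ le_add_self
    simp only [h1, if_true, one_mul]
    exact Ex_mono _ fun τ _ => by split_ifs <;> simp
  · have : σ.wait - 1 ≠ 0 := by omega
    rw [Ex_step_wait h0 h1]
    simp [this]

/-- A run shorter than `j` means that an exploration ended in one of the last `j` rounds. Each
possibility has weight of order `ε`; a factor of at most `2` per round carries the comparison
forward to the present exploitation states, and `exp (-η)` accounts for a change of leader. -/
theorem Ex_run_short_le (hD : 0 < D) (hη : 0 ≤ η) (hm : 2 ≤ m) (hε : ε ≤ 1 / 2)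
    (hf : ∀ n i, f n i ≤ ENNReal.ofReal (2 * D)) (n j : ℕ) (g : Fin ℓ → ℝ≥0∞) :
    (Real.exp (-η)).toNNReal * Ex (run D m ε η c s f μ (n + j))
        (fun σ => if σ.wait = 0 ∧ σ.leaderRun < j then g σ.leader else 0)
      ≤ j * (exploreProb ε * 2 ^ m) * 2 ^ j
        * Exw (run D m ε η c s f μ (n + j)) 0 fun σ => g σ.leader := by
  induction j with
  | zero => simp [Ex_zero]
  | succ j ih =>
    have h1 := Ex_run_step_leader_le (m := m) (ε := ε) (c := c) (s := s) (μ := μ) hD hη hf (n + j)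
      (fun k => if k = 1 then 1 else 0) g
    have h2 := Exw_run_leader_le (D := D) (η := η) (c := c) (s := s) (f := f) (μ := μ) hm hε
      (n + j) (m - 1) (by omega) g
    rw [show m - (m - 1) = 1 by omega] at h2
    have h3 : Ex (run D m ε η c s f μ (n + j)) (fun σ => (if σ.wait = 1 then 1 else 0) * g σ.leader)
        = Exw (run D m ε η c s f μ (n + j)) 1 fun σ => g σ.leader := by
      unfold Exw
      simp
    set U := Exw (run D m ε η c s f μ (n + j)) 0 fun σ => g σ.leader
    have h4 : U ≤ 2 * Exw (run D m ε η c s f μ (n + (j + 1))) 0 fun σ => g σ.leader := by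
      have := Exw_run_leader_add_ge (D := D) (η := η) (c := c) (s := s) (f := f) (μ := μ)
        (m := m) hε (n + j) 1 g
      rw [pow_one] at this
      exact this
    rw [h3] at h1
    refine (mul_le_mul' le_rfl (Ex_run_short_succ_le hm (n + j) j g)).trans ?_
    calc _ ≤ j * (exploreProb ε * 2 ^ m) * 2 ^ j * U + exploreProb ε * 2 ^ m * U := by
          rw [mul_add]
          exact add_le_add ih (h1.trans h2)
      _ ≤ j * (exploreProb ε * 2 ^ m) * 2 ^ j * U + exploreProb ε * 2 ^ m * 2 ^ j * U := by
          refine add_le_add le_rfl (mul_le_mul' (le_mul_of_one_le_right' ?_) le_rfl)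
          exact one_le_pow₀ (by norm_num)
      _ = (j + 1) * (exploreProb ε * 2 ^ m) * 2 ^ j * U := by ring
      _ ≤ (j + 1) * (exploreProb ε * 2 ^ m) * 2 ^ j *
          (2 * Exw (run D m ε η c s f μ (n + (j + 1))) 0 fun σ => g σ.leader) :=
          mul_le_mul' le_rfl h4
      _ = _ := by push_cast; ring

open Classical in
-- Bad states are either waiting or recovering from a recent exploration, both of weight `O(ε)`. The
-- shift by `m` excludes the start of the instance, where runs are short for lack of time.
theorem Ex_run_bad_le (hD : 0 < D) (hη : 0 ≤ η) (hm : 2 ≤ m) (hε : ε ≤ 1 / 2)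
    (hf : ∀ n i, f n i ≤ ENNReal.ofReal (2 * D)) (n : ℕ) (g : Fin ℓ → ℝ≥0∞) :
    (Real.exp (-η)).toNNReal * Ex (run D m ε η c s f μ (n + m))
        (fun σ => if σ.Bad m then g σ.leader else 0)
      ≤ 2 * m * 4 ^ m * exploreProb ε
        * Ex (run D m ε η c s f μ (n + m)) fun σ => g σ.leader := by
  have hq : ((Real.exp (-η)).toNNReal : ℝ≥0∞) ≤ 1 := by
    exact_mod_cast Real.toNNReal_le_one.2 (Real.exp_le_one_iff.2 (by linarith))
  have h1 := Ex_run_wait_ne_zero_le (D := D) (η := η) (c := c) (s := s) (f := f) (μ := μ) hm hε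
    (n + m) g
  have h2 := Ex_run_short_le (c := c) (s := s) (μ := μ) hD hη hm hε hf n m g
  have h24 : (2 : ℝ≥0∞) ^ m ≤ 4 ^ m := by gcongr; norm_num
  have h4 : (2 : ℝ≥0∞) ^ m * 2 ^ m = 4 ^ m := by rw [← mul_pow]; norm_num
  set U := Exw (run D m ε η c s f μ (n + m)) 0 fun σ => g σ.leader
  have hU : U ≤ Ex (run D m ε η c s f μ (n + m)) fun σ => g σ.leader :=
    Ex_mono _ fun σ _ => by split_ifs <;> simp
  calc _ ≤ (Real.exp (-η)).toNNReal * (Ex (run D m ε η c s f μ (n + m))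
          (fun σ => if σ.wait ≠ 0 then g σ.leader else 0) + Ex (run D m ε η c s f μ (n + m))
          (fun σ => if σ.wait = 0 ∧ σ.leaderRun < m then g σ.leader else 0)) := by
        rw [← Ex_add]
        refine mul_le_mul' le_rfl (Ex_mono _ fun σ _ => ?_)
        by_cases h0 : σ.wait = 0
        · by_cases h3 : σ.leaderRun + 2 < m
          · rw [if_pos (show σ.Bad m from Or.inr h3), if_pos (show σ.wait = 0 ∧ σ.leaderRun < m from ⟨h0, by omega⟩)]
            exact le_add_self
          · rw [if_neg (show ¬ σ.Bad m from fun h => h.elim (fun h => h h0) h3)]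
            exact zero_le
        · rw [if_pos (show σ.Bad m from Or.inl h0), if_pos h0]
          exact le_self_add
    _ ≤ m * (exploreProb ε * 2 ^ m) * U + m * (exploreProb ε * 2 ^ m) * 2 ^ m * U := by
        rw [mul_add]
        exact add_le_add ((mul_le_of_le_one_left zero_le hq).trans h1) h2
    _ = (m * exploreProb ε) * 2 ^ m * U + m * exploreProb ε * (2 ^ m * 2 ^ m) * U := by ring
    _ ≤ (m * exploreProb ε) * 4 ^ m * U + m * exploreProb ε * 4 ^ m * U := by
        rw [h4]
        gcongr
    _ = 2 * m * 4 ^ m * exploreProb ε * U := by ring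
    _ ≤ _ := mul_le_mul' le_rfl hU

/-- Weights change only at waiting time one, where `hedgePot_update` applies to the explored
heuristic. -/
theorem Ex_run_hedgePot_succ_le (hD : 0 < D) (hη : 0 ≤ η)
    (hf : ∀ n i, f n i ≤ ENNReal.ofReal (2 * D)) (n : ℕ) (i : Fin ℓ) :
    Ex (run D m ε η c s f μ (n + 1)) (fun σ => ENNReal.ofReal (hedgePot σ.weights i))
        + ENNReal.ofReal (1 - Real.exp (-η)) * Exw (run D m ε η c s f μ n) 1
          (fun σ => hedgeDist σ.weights σ.explored * (f n σ.explored / ENNReal.ofReal (2 * D)))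
      ≤ Ex (run D m ε η c s f μ n) (fun σ => ENNReal.ofReal (hedgePot σ.weights i))
        + ENNReal.ofReal η * Exw (run D m ε η c s f μ n) 1
          (fun σ => if σ.explored = i then f n i / ENNReal.ofReal (2 * D) else 0) := by
  unfold Exw
  rw [Ex_run_succ, ← Ex_const_mul, ← Ex_const_mul, ← Ex_add, ← Ex_add]
  refine Ex_mono _ fun σ hσ => ?_
  have hv := (valid_of_mem_support_run n hσ).1
  have hγ : 0 ≤ 1 - Real.exp (-η) := sub_nonneg.2 (Real.exp_le_one_iff.2 (by linarith))
  by_cases h0 : σ.wait = 0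
  · simp only [Ex_step_exploit h0, h0, zero_ne_one, if_false, move, Finset.sum_const,
        Finset.card_univ, Fintype.card_fin, nsmul_eq_mul]
    rw [← mul_assoc (ℓ : ℝ≥0∞)⁻¹, ENNReal.inv_mul_cancel (by exact_mod_cast NeZero.ne ℓ)
        (ENNReal.natCast_ne_top ℓ), one_mul, ← add_mul, add_tsub_cancel_of_le, one_mul]
    · simp
    · exact_mod_cast min_le_left _ _
  by_cases h1 : σ.wait = 1
  · simp only [Ex_step_explore h1, h1, if_true, Ex_const]
    set e := σ.explored
    have hy0 := loss_nonneg hD (f n e)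
    have hy1 := loss_le_one hD (hf n e)
    have key := hedgePot_update (η := η) hv hy0 hy1 e i
    have hy : ∀ j, f n j / ENNReal.ofReal (2 * D)
        = ENNReal.ofReal ((f n j).toReal / (2 * D)) := fun j => by
      rw [ENNReal.ofReal_div_of_pos (by positivity),
        ENNReal.ofReal_toReal ((hf n j).trans_lt ENNReal.ofReal_lt_top).ne]
    have hx : (hedgeDist σ.weights e : ℝ≥0∞) = ENNReal.ofReal (hedgeDist σ.weights e) :=
      (ENNReal.ofReal_coe_nnreal).symm
    have hi : (if e = i then f n i / ENNReal.ofReal (2 * D) else 0)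
        = ENNReal.ofReal (if e = i then (f n e).toReal / (2 * D) else 0) := by
      split_ifs with h
      · rw [hy, h]
      · simp
    have hi0 : 0 ≤ (if e = i then (f n e).toReal / (2 * D) else 0) := by
      split_ifs
      · exact hy0
      · exact le_rfl
    have hx0 : (0 : ℝ) ≤ hedgeDist σ.weights e := NNReal.coe_nonneg _
    rw [hi, hy, hx, ← ENNReal.ofReal_mul hx0, ← ENNReal.ofReal_mul hγ, ← ENNReal.ofReal_mul hη,
      ← ENNReal.ofReal_add (hedgePot_nonneg (newWeights_pos hv e) i) (by positivity),
      ← ENNReal.ofReal_add (hedgePot_nonneg hv i) (mul_nonneg hη hi0)]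
    exact ENNReal.ofReal_le_ofReal key
  · rw [Ex_step_wait h0 h1]
    simp [h1, move]

theorem inv_card_mul_sum_const (a : ℝ≥0∞) : (ℓ : ℝ≥0∞)⁻¹ * ∑ _e : Fin ℓ, a = a := by
  rw [Finset.sum_const, Finset.card_univ, Fintype.card_fin, nsmul_eq_mul, ← mul_assoc,
    ENNReal.inv_mul_cancel (by exact_mod_cast NeZero.ne ℓ) (ENNReal.natCast_ne_top ℓ), one_mul]

/-- The regret bound of HEDGE on the sampled losses. -/
theorem sum_Exw_run_le (hD : 0 < D) (hη : 0 ≤ η) (hm : 2 ≤ m)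
    (hf : ∀ n i, f n i ≤ ENNReal.ofReal (2 * D)) (N : ℕ) (i : Fin ℓ) :
    ENNReal.ofReal (1 - Real.exp (-η)) * exploreProb ε * (ℓ : ℝ≥0∞)⁻¹ / ENNReal.ofReal (2 * D)
        * ∑ n ∈ Finset.range N, Exw (run D m ε η c s f μ n) 0 (fun σ => f (n + m) σ.leader)
      ≤ ENNReal.ofReal (Real.log ℓ) +
        ENNReal.ofReal η * exploreProb ε * (ℓ : ℝ≥0∞)⁻¹ / ENNReal.ofReal (2 * D)
          * ∑ n ∈ Finset.range N, f (n + m) i := by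
  set κ := ENNReal.ofReal (2 * D)
  set pot : ℕ → ℝ≥0∞ := fun n =>
    Ex (run D m ε η c s f μ n) (fun σ => ENNReal.ofReal (hedgePot σ.weights i)) with hpot
  -- No loss is fed in the rounds before the `m`-th transition is complete, so the uniform start
  -- gives `log ℓ` up to this time.
  have hstart : ∀ n ≤ m, pot n ≤ ENNReal.ofReal (Real.log ℓ) := by
    intro n hn
    induction n with
    | zero =>
      simp only [hpot, run, Ex_bind, Ex_fresh, hedgePot_one]
      rw [inv_card_mul_sum_const, Ex_const]
    | succ n ih =>
      have h1 := Ex_run_hedgePot_succ_le (ε := ε) (c := c) (s := s) (μ := μ) (m := m) hD hη hf n i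
      have h2 := Exw_run_eq_zero (m := m) (D := D) (ε := ε) (η := η) (c := c) (s := s) (f := f) (μ := μ)
        n (m - 1) (by omega) (by omega) fun w _ e => if e = i then f n i / κ else 0
      rw [show m - (m - 1) = 1 by omega] at h2
      rw [h2, mul_zero, add_zero] at h1
      exact (le_self_add.trans h1).trans (ih (by omega))
  have key : ENNReal.ofReal (1 - Real.exp (-η)) * exploreProb ε * (ℓ : ℝ≥0∞)⁻¹ / κ
        * ∑ n ∈ Finset.range N, Exw (run D m ε η c s f μ n) 0 (fun σ => f (n + m) σ.leader)
        + pot (N + m)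
      ≤ ENNReal.ofReal (Real.log ℓ) +
        ENNReal.ofReal η * exploreProb ε * (ℓ : ℝ≥0∞)⁻¹ / κ
          * ∑ n ∈ Finset.range N, f (n + m) i := by
    induction N with
    | zero => simpa using hstart m le_rfl
    | succ N ih =>
      have h1 := Ex_run_hedgePot_succ_le (ε := ε) (c := c) (s := s) (μ := μ) (m := m) hD hη hf
        (N + m) i
      -- The exploration completed in the step from `N + m` is traced back to the exploitation state
      -- at `N`, where the explored heuristic is still uniform and independent of the weights.
      have h2 := Exw_run_add (D := D) (ε := ε) (η := η) (c := c) (s := s) (f := f) (μ := μ)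
        hm N (m - 1) (by omega) fun w _ e => hedgeDist w e * (f (N + m) e / κ)
      have h3 := Exw_run_add (D := D) (ε := ε) (η := η) (c := c) (s := s) (f := f) (μ := μ)
        hm N (m - 1) (by omega) fun w _ e => if e = i then f (N + m) i / κ else 0
      rw [show m - (m - 1) = 1 by omega, show m - 1 + 1 = m by omega] at h2 h3
      -- The HEDGE average of the losses is the expected loss of the leader at time `N`, evaluated
      -- with the costs of index `N + m`.
      have h4 : Exw (run D m ε η c s f μ N) 0 (fun σ => (ℓ : ℝ≥0∞)⁻¹ *
            ∑ e, hedgeDist σ.weights e * (f (N + m) e / κ))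
          = (ℓ : ℝ≥0∞)⁻¹ / κ * Exw (run D m ε η c s f μ N) 0 fun σ => f (N + m) σ.leader := by
        unfold Exw
        rw [Ex_run_leader N (fun _ l k _ => if k = 0 then f (N + m) l else 0)
          (fun _ _ _ _ => rfl), ← Ex_const_mul]
        refine Ex_congr _ fun σ _ => ?_
        split_ifs with h
        · simp only [Finset.mul_sum]
          exact Finset.sum_congr rfl fun e _ => by simp only [div_eq_mul_inv]; ring
        · simp
      have h5 : Exw (run D m ε η c s f μ N) 0 (fun _ => (ℓ : ℝ≥0∞)⁻¹ *
            ∑ e, if e = i then f (N + m) i / κ else 0) ≤ (ℓ : ℝ≥0∞)⁻¹ / κ * f (N + m) i := by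
        refine Ex_le_const _ fun σ _ => ?_
        rw [Finset.sum_ite_eq' Finset.univ i, if_pos (Finset.mem_univ i)]
        split_ifs
        · refine le_of_eq ?_
          simp only [div_eq_mul_inv]; ring
        · exact zero_le
      rw [h2, h4, h3] at h1
      have h6 := h1.trans (add_le_add le_rfl (mul_le_mul' le_rfl (mul_le_mul' le_rfl h5)))
      rw [Finset.sum_range_succ, Finset.sum_range_succ, show N + 1 + m = N + m + 1 by omega]
      set a := Exw (run D m ε η c s f μ N) 0 fun σ => f (N + m) σ.leader
      set S := ∑ n ∈ Finset.range N, Exw (run D m ε η c s f μ n) 0 (fun σ => f (n + m) σ.leader)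
      set T := ∑ n ∈ Finset.range N, f (n + m) i
      set γ := ENNReal.ofReal (1 - Real.exp (-η))
      calc _ = γ * exploreProb ε * (ℓ : ℝ≥0∞)⁻¹ / κ * S
            + (pot (N + m + 1) + γ * (exploreProb ε * ((ℓ : ℝ≥0∞)⁻¹ / κ * a))) := by
            simp only [div_eq_mul_inv]; ring
        _ ≤ γ * exploreProb ε * (ℓ : ℝ≥0∞)⁻¹ / κ * S + (pot (N + m)
            + ENNReal.ofReal η * (exploreProb ε * ((ℓ : ℝ≥0∞)⁻¹ / κ * f (N + m) i))) :=
            add_le_add le_rfl h6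
        _ = γ * exploreProb ε * (ℓ : ℝ≥0∞)⁻¹ / κ * S + pot (N + m)
            + ENNReal.ofReal η * (exploreProb ε * ((ℓ : ℝ≥0∞)⁻¹ / κ * f (N + m) i)) := by ring
        _ ≤ _ := add_le_add ih le_rfl
        _ = _ := by simp only [div_eq_mul_inv]; ring
  exact le_self_add.trans key

open Classical in
theorem Ex_run_potential_le (hD : 0 < D) (hM : ∀ s s' : M, dist s s' ≤ D) (hη : 0 ≤ η)
    (hm : 2 ≤ m) (hε : 8 * m * ε ≤ 4) (hc : ∀ n, Admissible (c n))
    (hf : ∀ n i, f n i = c n (s (n + 1) i) + edist (s n i) (s (n + 1) i))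
    (hf2 : ∀ n i, f n i ≤ ENNReal.ofReal (2 * D)) (N : ℕ) :
    Ex (run D m ε η c s f μ N) (AlgState.potential m (s N))
      ≤ Ex μ (fun σ => σ.paid) + (1 + 6 * m) * ENNReal.ofReal D
        + ∑ n ∈ Finset.range N, (Ex (run D m ε η c s f μ n) (fun σ => f n σ.leader)
          + (3 + 8 * m + (1 + 6 * m) * ENNReal.ofReal η) *
            Ex (run D m ε η c s f μ n) fun σ => if σ.Bad m then f n σ.leader else 0) := by
  induction N with
  | zero =>
    simp only [run, Ex_bind, Ex_fresh, Finset.range_zero, Finset.sum_empty, add_zero]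
    rw [← Ex_const μ ((1 + 6 * m : ℝ≥0∞) * _), ← Ex_add]
    refine Ex_mono _ fun σ _ => ?_
    rw [← inv_card_mul_sum_const (ℓ := ℓ) (σ.paid + _)]
    refine mul_le_mul' le_rfl (Finset.sum_le_sum fun i _ => ?_)
    have hk := coeff_le_of_wait_eq_zero (m := m) (σ :=
      { weights := fun _ => 1, leader := i, wait := 0, explored := i, lastQuery := i, run := 0,
        base := σ.pos, pos := σ.pos, paid := σ.paid }) rfl
    simp only [AlgState.potential, edist_self, add_zero]
    refine add_le_add le_rfl (mul_le_mul' (by exact_mod_cast hk) ?_)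
    rw [edist_dist]
    exact ENNReal.ofReal_le_ofReal (hM _ _)
  | succ N ih =>
    rw [Ex_run_succ, Finset.sum_range_succ, ← add_assoc]
    refine le_trans ?_ (add_le_add ih le_rfl)
    rw [← Ex_const_mul, ← Ex_add, ← Ex_add]
    refine Ex_mono _ fun σ hσ => ?_
    refine (Ex_step_potential_le hD hM hη hm hε (hc N) (hf N) (hf2 N)
      (valid_of_mem_support_run N hσ)).trans ?_
    rw [add_assoc]
    refine add_le_add le_rfl (add_le_add le_rfl ?_)
    split_ifs <;> simp

end Run

/-! ### The cost of one instance against a fixed heuristic. -/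

/-- The cost factor of a bad round. -/
noncomputable def badFactor (m : ℕ) (γ₀ : ℝ) : ℝ := 3 + 8 * m + (1 + 6 * m) * (1 - γ₀)⁻¹

/-- The regret of `ALG` is at most this multiple of `γ`, in the exponent. -/
noncomputable def regretExponent (m : ℕ) (γ₀ : ℝ) : ℝ :=
  badFactor m γ₀ * (2 * m * 4 ^ m) * (1 - γ₀)⁻¹ + (1 - γ₀)⁻¹ * m + m * 2 ^ m + (1 - γ₀)⁻¹

/-- The additive term in the cost of `ALG`. -/
noncomputable def startupCost (D : ℝ) (m : ℕ) (γ₀ : ℝ) : ℝ :=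
  (1 + 6 * m) * D + m * (1 + badFactor m γ₀) * (2 * D)

section Run

variable {M : Type*} [MetricSpace M] {ℓ : ℕ} [NeZero ℓ] {D : ℝ} {m : ℕ} {ε η γ γ₀ : ℝ}
  {c : ℕ → CostFn M} {s : ℕ → Fin ℓ → M} {f : ℕ → Fin ℓ → ℝ≥0∞} {μ : PMF (AlgState M ℓ)}

theorem inv_one_sub_le_exp (hγ0 : 0 ≤ γ) (hγ : γ ≤ γ₀) (hγ₀ : γ₀ < 1) :
    (1 - γ)⁻¹ ≤ Real.exp ((1 - γ₀)⁻¹ * γ) := by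
  have h1 : 0 < 1 - γ := by linarith
  have h2 : (1 - γ)⁻¹ = (1 - γ)⁻¹ * γ + 1 := by field_simp; ring
  have h3 : (1 - γ)⁻¹ ≤ (1 - γ₀)⁻¹ := inv_anti₀ (by linarith) (by linarith)
  rw [h2]
  refine (Real.add_one_le_exp _).trans (Real.exp_le_exp.2 ?_)
  gcongr

theorem neg_log_one_sub_le (hγ : γ < 1) : -Real.log (1 - γ) ≤ (1 - γ)⁻¹ * γ := by
  have h1 : 0 < 1 - γ := by linarith
  rw [← Real.log_inv]
  refine (Real.log_le_sub_one_of_pos (inv_pos.2 h1)).trans_eq ?_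
  field_simp
  ring

theorem coe_exploreProb (hε : ε ≤ 1 / 2) : (exploreProb ε : ℝ≥0∞) = ENNReal.ofReal ε := by
  unfold exploreProb
  rw [min_eq_right (Real.toNNReal_le_one.2 (by linarith))]
  rfl

theorem one_add_ofReal_le {a : ℝ} (ha : 0 ≤ a) :
    1 + ENNReal.ofReal a ≤ ENNReal.ofReal (Real.exp a) := by
  rw [← ENNReal.ofReal_one, ← ENNReal.ofReal_add zero_le_one ha]
  exact ENNReal.ofReal_le_ofReal (by linarith [Real.add_one_le_exp a])

open Classical in
-- HEDGE controls the right-hand side only. Three comparisons lead to it, each a factor `exp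
-- (O(γ))`: bad rounds against all rounds, the leader at `n + m` against the leader at `n`, and all
-- states at `n` against exploitation states.
theorem round_cost_le (hD : 0 < D) (hm : 2 ≤ m) (hγ0 : 0 ≤ γ) (hγ : γ ≤ γ₀) (hγ₀ : γ₀ < 1)
    (hη : Real.exp (-η) = 1 - γ) (hη0 : 0 ≤ η) (hεγ : ε ≤ γ) (hε : ε ≤ 1 / 2)
    (hf : ∀ n i, f n i ≤ ENNReal.ofReal (2 * D)) (n : ℕ) :
    Ex (run D m ε η c s f μ (n + m)) (fun σ => f (n + m) σ.leader)
        + ENNReal.ofReal (badFactor m γ₀) * Ex (run D m ε η c s f μ (n + m))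
          (fun σ => if σ.Bad m then f (n + m) σ.leader else 0)
      ≤ ENNReal.ofReal (Real.exp ((badFactor m γ₀ * (2 * m * 4 ^ m) * (1 - γ₀)⁻¹
          + (1 - γ₀)⁻¹ * m + m * 2 ^ m) * γ))
        * Exw (run D m ε η c s f μ n) 0 fun σ => f (n + m) σ.leader := by
  have hγ1 : 0 < 1 - γ := by linarith
  have hγ₀1 : 0 < 1 - γ₀ := by linarith
  have hg : 0 ≤ (1 - γ₀)⁻¹ := inv_nonneg.2 hγ₀1.le
  have hC : 0 ≤ badFactor m γ₀ := by unfold badFactor; positivity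
  have hbad := Ex_run_bad_le (c := c) (s := s) (μ := μ) hD hη0 hm hε hf n (f (n + m))
  have hback := Ex_run_leader_add_le (m := m) (ε := ε) (c := c) (s := s) (μ := μ) hD hη0 hf n m
    (f (n + m))
  have hwait := Ex_run_wait_ne_zero_le (D := D) (η := η) (c := c) (s := s) (f := f) (μ := μ) hm hε
    n (f (n + m))
  have hq : ((Real.exp (-η)).toNNReal : ℝ≥0∞) = ENNReal.ofReal (1 - γ) := by rw [hη]; rfl
  rw [hq] at hbad hback
  rw [coe_exploreProb hε] at hbad hwait
  set v := Ex (run D m ε η c s f μ (n + m)) (fun σ => f (n + m) σ.leader)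
  set b := Ex (run D m ε η c s f μ (n + m)) (fun σ => if σ.Bad m then f (n + m) σ.leader else 0)
  set u := Exw (run D m ε η c s f μ n) 0 fun σ => f (n + m) σ.leader
  set z := Ex (run D m ε η c s f μ n) fun σ => f (n + m) σ.leader
  have hqq : ENNReal.ofReal (1 - γ)⁻¹ * ENNReal.ofReal (1 - γ) = 1 := by
    rw [← ENNReal.ofReal_mul (inv_nonneg.2 hγ1.le), inv_mul_cancel₀ hγ1.ne', ENNReal.ofReal_one]
  have hz : z ≤ ENNReal.ofReal (Real.exp (m * 2 ^ m * γ)) * u := by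
    calc z = Ex (run D m ε η c s f μ n) (fun σ => if σ.wait ≠ 0 then f (n + m) σ.leader else 0)
          + u := by
          change _ = _ + Exw _ _ _
          unfold Exw
          rw [← Ex_add]
          refine Ex_congr _ fun σ _ => ?_
          by_cases h : σ.wait = 0 <;> simp [h]
      _ ≤ m * (ENNReal.ofReal ε * 2 ^ m) * u + u := add_le_add hwait le_rfl
      _ = (1 + m * 2 ^ m * ENNReal.ofReal ε) * u := by ring
      _ ≤ (1 + m * 2 ^ m * ENNReal.ofReal γ) * u := by gcongr
      _ = (1 + ENNReal.ofReal (m * 2 ^ m * γ)) * u := by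
          rw [ENNReal.ofReal_mul (by positivity), ENNReal.ofReal_mul (by positivity),
            ENNReal.ofReal_natCast, ENNReal.ofReal_pow (by norm_num), ENNReal.ofReal_ofNat]
      _ ≤ _ := mul_le_mul' (one_add_ofReal_le (by positivity)) le_rfl
  have hv : v ≤ ENNReal.ofReal (Real.exp ((1 - γ₀)⁻¹ * m * γ)) * z := by
    calc v = ENNReal.ofReal (1 - γ)⁻¹ ^ m * (ENNReal.ofReal (1 - γ) ^ m * v) := by
          rw [← mul_assoc, ← mul_pow, hqq, one_pow, one_mul]
      _ ≤ ENNReal.ofReal (Real.exp ((1 - γ₀)⁻¹ * γ)) ^ m * z := by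
          gcongr
          exact inv_one_sub_le_exp hγ0 hγ hγ₀
      _ = _ := by
          rw [← ENNReal.ofReal_pow (Real.exp_pos _).le, ← Real.exp_nat_mul]
          ring_nf
  have hb : ENNReal.ofReal (badFactor m γ₀) * b
      ≤ ENNReal.ofReal (badFactor m γ₀ * (2 * m * 4 ^ m) * (1 - γ₀)⁻¹ * γ) * v := by
    have h3 : (1 - γ)⁻¹ ≤ (1 - γ₀)⁻¹ := inv_anti₀ (by linarith) (by linarith)
    calc _ = ENNReal.ofReal (badFactor m γ₀) * (ENNReal.ofReal (1 - γ)⁻¹ *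
          (ENNReal.ofReal (1 - γ) * b)) := by
          rw [← mul_assoc (ENNReal.ofReal (1 - γ)⁻¹), hqq, one_mul]
      _ ≤ ENNReal.ofReal (badFactor m γ₀) * (ENNReal.ofReal (1 - γ₀)⁻¹ *
          (2 * m * 4 ^ m * ENNReal.ofReal γ * v)) := by
          refine mul_le_mul' le_rfl (mul_le_mul' (ENNReal.ofReal_le_ofReal h3) (hbad.trans ?_))
          gcongr
      _ = _ := by
          rw [ENNReal.ofReal_mul (by positivity), ENNReal.ofReal_mul (by positivity),
            ENNReal.ofReal_mul (by positivity), ENNReal.ofReal_mul (by positivity),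
            ENNReal.ofReal_mul (by positivity),
            ENNReal.ofReal_natCast, ENNReal.ofReal_pow (by norm_num), ENNReal.ofReal_ofNat,
            ENNReal.ofReal_ofNat]
          ring
  calc _ ≤ v + ENNReal.ofReal (badFactor m γ₀ * (2 * m * 4 ^ m) * (1 - γ₀)⁻¹ * γ) * v :=
        add_le_add le_rfl hb
    _ = (1 + ENNReal.ofReal (badFactor m γ₀ * (2 * m * 4 ^ m) * (1 - γ₀)⁻¹ * γ)) * v := by ring
    _ ≤ ENNReal.ofReal (Real.exp (badFactor m γ₀ * (2 * m * 4 ^ m) * (1 - γ₀)⁻¹ * γ)) *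
        (ENNReal.ofReal (Real.exp ((1 - γ₀)⁻¹ * m * γ)) *
        (ENNReal.ofReal (Real.exp (m * 2 ^ m * γ)) * u)) :=
        mul_le_mul' (one_add_ofReal_le (by positivity)) (hv.trans (mul_le_mul' le_rfl hz))
    _ = _ := by
        rw [← mul_assoc, ← mul_assoc, ← ENNReal.ofReal_mul (Real.exp_pos _).le, ← Real.exp_add,
          ← ENNReal.ofReal_mul (Real.exp_pos _).le, ← Real.exp_add]
        ring_nf

theorem sum_sampled_le (hD : 0 < D) (hm : 2 ≤ m) (hγ0 : 0 ≤ γ) (hγ : γ ≤ γ₀) (hγ₀ : γ₀ < 1)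
    (hη : η = -Real.log (1 - γ)) (hε : ε ≤ 1 / 2)
    {V : ℝ} (hV : 2 * D * (ℓ * Real.log ℓ) ≤ V * (γ * ε))
    (hℓ : ℓ = 1 ∨ 0 < γ ∧ 0 < ε)
    (hf : ∀ n i, f n i ≤ ENNReal.ofReal (2 * D)) (N : ℕ) (i : Fin ℓ) :
    ∑ n ∈ Finset.range N, Exw (run D m ε η c s f μ n) 0 (fun σ => f (n + m) σ.leader)
      ≤ ENNReal.ofReal V + ENNReal.ofReal (Real.exp ((1 - γ₀)⁻¹ * γ))
        * ∑ n ∈ Finset.range N, f (n + m) i := by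
  have hγ1 : 0 < 1 - γ := by linarith
  have hγ₀1 : 0 < 1 - γ₀ := by linarith
  -- For a single heuristic `log ℓ = 0`, so the actual rates vanish and cannot be divided by; but
  -- then the leader is `i`.
  rcases hℓ with rfl | ⟨hγp, hεp⟩
  · refine le_trans ?_ le_add_self
    refine le_trans (Finset.sum_le_sum fun n _ => ?_)
      (le_mul_of_one_le_left' (ENNReal.one_le_ofReal.2 (Real.one_le_exp (by positivity))))
    refine Ex_le_const _ fun σ _ => ?_
    change (if σ.wait = 0 then f (n + m) σ.leader else 0) ≤ _
    rw [Subsingleton.elim σ.leader i]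
    split_ifs <;> simp
  have hexp : Real.exp (-η) = 1 - γ := by rw [hη, neg_neg, Real.exp_log hγ1]
  have hη0 : 0 ≤ η := by
    rw [hη, neg_nonneg]
    exact Real.log_nonpos hγ1.le (by linarith)
  have hη1 : η ≤ Real.exp ((1 - γ₀)⁻¹ * γ) * γ := by
    rw [hη]
    refine (neg_log_one_sub_le (by linarith)).trans ?_
    gcongr
    exact inv_one_sub_le_exp hγ0 hγ hγ₀
  have key := sum_Exw_run_le (ε := ε) (c := c) (s := s) (μ := μ) hD hη0 hm hf N i
  rw [hexp, show 1 - (1 - γ) = γ by ring, coe_exploreProb hε] at key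
  have hℓ0 : (0 : ℝ) < ℓ := by exact_mod_cast NeZero.pos ℓ
  have hX : ∀ a : ℝ, ENNReal.ofReal a * ENNReal.ofReal ε * (ℓ : ℝ≥0∞)⁻¹ / ENNReal.ofReal (2 * D)
      = ENNReal.ofReal a * ENNReal.ofReal (ε / (ℓ * (2 * D))) := fun a => by
    rw [ENNReal.ofReal_div_of_pos (by positivity), ENNReal.ofReal_mul hℓ0.le,
      ENNReal.ofReal_natCast, div_eq_mul_inv, div_eq_mul_inv, ENNReal.mul_inv]
    · ring
    · exact Or.inl (by exact_mod_cast NeZero.ne ℓ)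
    · exact Or.inl (ENNReal.natCast_ne_top ℓ)
  rw [hX, hX] at key
  set X := ENNReal.ofReal γ * ENNReal.ofReal (ε / (ℓ * (2 * D))) with hXdef
  have hXr : X = ENNReal.ofReal (γ * (ε / (ℓ * (2 * D)))) := (ENNReal.ofReal_mul hγ0).symm
  have hX0 : X ≠ 0 := by
    rw [hXr]
    exact (ENNReal.ofReal_pos.2 (by positivity)).ne'
  have hXt : X ≠ ∞ := by rw [hXr]; exact ENNReal.ofReal_ne_top
  rw [← ENNReal.mul_le_mul_iff_right hX0 hXt]
  refine key.trans ?_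
  rw [mul_add]
  refine add_le_add ?_ ?_
  · rw [hXr, ← ENNReal.ofReal_mul (by positivity)]
    apply ENNReal.ofReal_le_ofReal
    rw [show γ * (ε / (ℓ * (2 * D))) * V = V * (γ * ε) / (2 * D * ℓ) by field_simp,
      le_div_iff₀ (by positivity)]
    linarith
  · rw [← mul_assoc X]
    refine mul_le_mul' ?_ le_rfl
    calc _ ≤ ENNReal.ofReal (Real.exp ((1 - γ₀)⁻¹ * γ) * γ)
          * ENNReal.ofReal (ε / (ℓ * (2 * D))) := by gcongr
      _ = _ := by rw [ENNReal.ofReal_mul (Real.exp_pos _).le, hXdef]; ring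

/-- The cost of an instance of `ALG`, compared with the heuristic `i`. -/
theorem Ex_run_paid_le (hD : 0 < D) (hM : ∀ s s' : M, dist s s' ≤ D) (hm : 2 ≤ m)
    (hγ0 : 0 ≤ γ) (hγ : γ ≤ γ₀) (hγ₀ : γ₀ < 1)
    (hη : η = -Real.log (1 - γ)) (hεγ : ε ≤ γ) (hε : 8 * m * ε ≤ 4)
    {V : ℝ} (hV : 2 * D * (ℓ * Real.log ℓ) ≤ V * (γ * ε))
    (hℓ : ℓ = 1 ∨ 0 < γ ∧ 0 < ε) (hc : ∀ n, Admissible (c n))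
    (hf : ∀ n i, f n i = c n (s (n + 1) i) + edist (s n i) (s (n + 1) i))
    (hf2 : ∀ n i, f n i ≤ ENNReal.ofReal (2 * D)) (N : ℕ) (i : Fin ℓ) :
    Ex (run D m ε η c s f μ N) (fun σ => σ.paid)
      ≤ Ex μ (fun σ => σ.paid) + ENNReal.ofReal (startupCost D m γ₀)
        + ENNReal.ofReal (Real.exp (regretExponent m γ₀ * γ))
          * (ENNReal.ofReal V + ∑ n ∈ Finset.range N, f n i) := by
  classical
  have hγ1 : 0 < 1 - γ := by linarith
  have hγ₀1 : 0 < 1 - γ₀ := by linarith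
  have hg : 0 < (1 - γ₀)⁻¹ := inv_pos.2 hγ₀1
  have hexp : Real.exp (-η) = 1 - γ := by rw [hη, neg_neg, Real.exp_log hγ1]
  have hη0 : 0 ≤ η := by
    rw [hη, neg_nonneg]
    exact Real.log_nonpos hγ1.le (by linarith)
  have hη1 : η ≤ (1 - γ₀)⁻¹ := by
    rw [hη]
    refine (neg_log_one_sub_le (by linarith)).trans ?_
    have h3 : (1 - γ)⁻¹ ≤ (1 - γ₀)⁻¹ := inv_anti₀ (by linarith) (by linarith)
    calc (1 - γ)⁻¹ * γ ≤ (1 - γ₀)⁻¹ * 1 := by gcongr; linarith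
      _ = _ := mul_one _
  have hm' : (2 : ℝ) ≤ m := by exact_mod_cast hm
  have hε2 : ε ≤ 1 / 2 := by nlinarith
  have hC : 0 ≤ badFactor m γ₀ := by unfold badFactor; positivity
  have hpot := Ex_run_potential_le (μ := μ) (c := c) (s := s) (f := f) hD hM hη0 hm hε hc hf hf2 N
  have hbf : (3 + 8 * m + (1 + 6 * m) * ENNReal.ofReal η : ℝ≥0∞)
      ≤ ENNReal.ofReal (badFactor m γ₀) := by
    calc (3 + 8 * m + (1 + 6 * m) * ENNReal.ofReal η : ℝ≥0∞)
        = ENNReal.ofReal (3 + 8 * m + (1 + 6 * m) * η) := by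
          rw [ENNReal.ofReal_add (by positivity) (by positivity),
            ENNReal.ofReal_add (by positivity) (by positivity), ENNReal.ofReal_mul (by positivity),
            ENNReal.ofReal_mul (by positivity), ENNReal.ofReal_add (by positivity) (by positivity),
            ENNReal.ofReal_mul (by positivity), ENNReal.ofReal_natCast, ENNReal.ofReal_one]
          simp
      _ ≤ _ := by
          apply ENNReal.ofReal_le_ofReal
          unfold badFactor
          gcongr
  set a : ℕ → ℝ≥0∞ := fun n => Ex (run D m ε η c s f μ n) (fun σ => f n σ.leader)
    + ENNReal.ofReal (badFactor m γ₀) *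
      Ex (run D m ε η c s f μ n) (fun σ => if σ.Bad m then f n σ.leader else 0) with ha
  have ha1 : ∀ n, a n ≤ (1 + ENNReal.ofReal (badFactor m γ₀)) * ENNReal.ofReal (2 * D) := by
    intro n
    rw [add_mul, one_mul]
    refine add_le_add (Ex_le_const _ fun σ _ => hf2 _ _)
      (mul_le_mul' le_rfl (Ex_le_const _ fun σ _ => ?_))
    split_ifs
    · exact hf2 _ _
    · exact zero_le
  -- The delayed comparison says nothing about the first `m` rounds, which are bounded by `2 D` each
  -- and enter `startupCost`.
  have hfirst : ∀ k ≤ m, ∑ n ∈ Finset.range k, a n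
      ≤ m * ((1 + ENNReal.ofReal (badFactor m γ₀)) * ENNReal.ofReal (2 * D)) := by
    intro k hk
    refine (Finset.sum_le_sum fun n _ => ha1 n).trans ?_
    rw [Finset.sum_const, Finset.card_range, nsmul_eq_mul]
    gcongr
  have hsum : ∑ n ∈ Finset.range N, a n
      ≤ m * ((1 + ENNReal.ofReal (badFactor m γ₀)) * ENNReal.ofReal (2 * D))
        + ENNReal.ofReal (Real.exp (regretExponent m γ₀ * γ))
          * (ENNReal.ofReal V + ∑ n ∈ Finset.range N, f n i) := by
    rcases le_total N m with hN | hN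
    · exact (hfirst N hN).trans le_self_add
    obtain ⟨N, rfl⟩ := Nat.exists_eq_add_of_le hN
    rw [Finset.sum_range_add, Finset.sum_range_add]
    refine add_le_add (hfirst m le_rfl) ?_
    simp only [add_comm m]
    have h1 : ∀ n, a (n + m) ≤ _ := fun n =>
      round_cost_le (c := c) (s := s) (μ := μ) hD hm hγ0 hγ hγ₀ hexp hη0 hεγ hε2 hf2 n
    refine (Finset.sum_le_sum fun n _ => h1 n).trans ?_
    rw [← Finset.mul_sum]
    have h2 := sum_sampled_le (c := c) (s := s) (μ := μ) hD hm hγ0 hγ hγ₀ hη hε2 hV hℓ hf2 N i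
    refine (mul_le_mul' le_rfl h2).trans ?_
    have h3 : Real.exp (regretExponent m γ₀ * γ) = Real.exp ((badFactor m γ₀ * (2 * m * 4 ^ m)
          * (1 - γ₀)⁻¹ + (1 - γ₀)⁻¹ * m + m * 2 ^ m) * γ) * Real.exp ((1 - γ₀)⁻¹ * γ) := by
      rw [← Real.exp_add]
      unfold regretExponent
      ring_nf
    rw [h3, ENNReal.ofReal_mul (Real.exp_pos _).le, mul_assoc (ENNReal.ofReal _) (ENNReal.ofReal _)]
    refine mul_le_mul' le_rfl ?_
    rw [mul_add]
    refine add_le_add (le_mul_of_one_le_left'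
      (ENNReal.one_le_ofReal.2 (Real.one_le_exp (by positivity)))) ?_
    exact mul_le_mul' le_rfl le_add_self
  have hstart : (1 + 6 * m : ℝ≥0∞) * ENNReal.ofReal D
      + m * ((1 + ENNReal.ofReal (badFactor m γ₀)) * ENNReal.ofReal (2 * D))
      = ENNReal.ofReal (startupCost D m γ₀) := by
    unfold startupCost
    have h1 : ENNReal.ofReal ((1 + 6 * m) * D) = (1 + 6 * m : ℝ≥0∞) * ENNReal.ofReal D := by
      rw [ENNReal.ofReal_mul (by positivity), ENNReal.ofReal_add (by positivity) (by positivity),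
        ENNReal.ofReal_mul (by positivity), ENNReal.ofReal_natCast]
      simp
    have h2 : ENNReal.ofReal (m * (1 + badFactor m γ₀) * (2 * D))
        = m * ((1 + ENNReal.ofReal (badFactor m γ₀)) * ENNReal.ofReal (2 * D)) := by
      rw [ENNReal.ofReal_mul (by positivity), ENNReal.ofReal_mul (by positivity),
        ENNReal.ofReal_add zero_le_one hC, ENNReal.ofReal_natCast, ENNReal.ofReal_one, mul_assoc]
    rw [ENNReal.ofReal_add (by positivity) (by positivity), h1, h2]
  calc _ ≤ Ex (run D m ε η c s f μ N) (AlgState.potential m (s N)) :=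
        Ex_mono _ fun σ _ => le_self_add.trans le_self_add
    _ ≤ _ := hpot
    _ ≤ Ex μ (fun σ => σ.paid) + (1 + 6 * m) * ENNReal.ofReal D + ∑ n ∈ Finset.range N, a n := by
        refine add_le_add le_rfl (Finset.sum_le_sum fun n _ => add_le_add le_rfl ?_)
        exact mul_le_mul' hbf le_rfl
    _ ≤ _ := add_le_add le_rfl hsum
    _ = _ := by rw [← hstart]; ring

end Run

/-! ### The offline optimum: monotonicity, growth per round, concatenation. -/

section Offline

variable {M : Type*} [MetricSpace M] {s₀ : M} {c : ℕ → CostFn M} {D : ℝ} {R ω ω₀ : ℝ≥0}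

theorem edist_le_ofReal (hM : ∀ s s' : M, dist s s' ≤ D) (s s' : M) :
    edist s s' ≤ ENNReal.ofReal D := by
  rw [edist_dist]
  exact ENNReal.ofReal_le_ofReal (hM s s')

theorem pathCost_self (s : ℕ → M) (a : ℕ) : pathCost c s a a = 0 := by simp [pathCost]

theorem pathCost_succ (s : ℕ → M) {a t : ℕ} (h : a ≤ t) :
    pathCost c s a (t + 1) = pathCost c s a t + (c t (s t) + edist (s (t - 1)) (s t)) :=
  Finset.sum_Ico_succ_top h _

theorem pathCost_congr {s s' : ℕ → M} {a b : ℕ} (h : ∀ t, a ≤ t + 1 → t < b → s t = s' t) :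
    pathCost c s a b = pathCost c s' a b := by
  refine Finset.sum_congr rfl fun t ht => ?_
  rw [Finset.mem_Ico] at ht
  rw [h t (by omega) ht.2, h (t - 1) (by omega) (by omega)]

theorem pathCost_mono_left (s : ℕ → M) {a a' b b' : ℕ} (h : a ≤ a') (h' : b' ≤ b) :
    pathCost c s a' b' ≤ pathCost c s a b :=
  Finset.sum_le_sum_of_subset (Finset.Ico_subset_Ico h h')

/-- A path is extended by a move to a state of cost zero. -/
theorem exists_pathCost_succ_le (hM : ∀ s s' : M, dist s s' ≤ D) (hc : ∀ t, Admissible (c t))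
    (s : ℕ → M) {a t : ℕ} (h : a ≤ t) :
    ∃ s' : ℕ → M, (∀ i, i ≠ t → s' i = s i) ∧
      pathCost c s' a (t + 1) ≤ pathCost c s a t + ENNReal.ofReal D := by
  obtain ⟨z, hz⟩ := (hc t).1
  refine ⟨Function.update s t z, fun i hi => Function.update_of_ne hi _ _, ?_⟩
  rw [pathCost_succ _ h, Function.update_self, hz, zero_add]
  refine add_le_add (le_of_eq (pathCost_congr fun i _ hi => ?_)) (edist_le_ofReal hM _ _)
  exact Function.update_of_ne hi.ne _ _

theorem offlineOn_self (s₀ : M) (a : ℕ) : offlineOn c a a = 0 :=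
  le_antisymm ((iInf_le _ fun _ => s₀).trans_eq (pathCost_self _ _)) zero_le

theorem offlineOn_succ_le (hM : ∀ s s' : M, dist s s' ≤ D) (hc : ∀ t, Admissible (c t))
    {a t : ℕ} (h : a ≤ t) : offlineOn c a (t + 1) ≤ offlineOn c a t + ENNReal.ofReal D := by
  unfold offlineOn
  rw [ENNReal.iInf_add]
  refine le_iInf fun s => ?_
  obtain ⟨s', -, hs'⟩ := exists_pathCost_succ_le hM hc s h
  exact (iInf_le _ s').trans hs'

theorem offline_le {s : ℕ → M} (hs : s 0 = s₀) (t : ℕ) :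
    offline s₀ c t ≤ pathCost c s 1 (t + 1) := iInf₂_le s hs

theorem offline_zero : offline s₀ c 0 = 0 :=
  le_antisymm ((offline_le (s := fun _ => s₀) rfl 0).trans_eq (pathCost_self _ _)) zero_le

theorem offline_succ_le (hM : ∀ s s' : M, dist s s' ≤ D) (hc : ∀ t, Admissible (c t)) (t : ℕ) :
    offline s₀ c (t + 1) ≤ offline s₀ c t + ENNReal.ofReal D := by
  rw [offline.eq_1 s₀ c t]
  simp only [ENNReal.iInf_add]
  refine le_iInf₂ fun s hs => ?_
  obtain ⟨s', h1, h2⟩ := exists_pathCost_succ_le hM hc s (show 1 ≤ t + 1 by omega)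
  exact (offline_le ((h1 0 (by omega)).trans hs) _).trans h2

theorem offline_mono {t t' : ℕ} (h : t ≤ t') : offline s₀ c t ≤ offline s₀ c t' :=
  le_iInf₂ fun s hs => (offline_le hs t).trans (pathCost_mono_left s le_rfl (by omega))

theorem offline_ne_top (hM : ∀ s s' : M, dist s s' ≤ D) (hc : ∀ t, Admissible (c t)) (t : ℕ) :
    offline s₀ c t ≠ ∞ := by
  induction t with
  | zero => simp [offline_zero]
  | succ t ih =>
    exact ((offline_succ_le hM hc t).trans_lt
      (ENNReal.add_lt_top.2 ⟨ih.lt_top, ENNReal.ofReal_lt_top⟩)).ne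

theorem offlineOn_le_offline {a t : ℕ} (ha : 1 ≤ a) :
    offlineOn c a (t + 1) ≤ offline s₀ c t :=
  le_iInf₂ fun s _ => (iInf_le _ s).trans (pathCost_mono_left s ha le_rfl)

/-- Concatenation of an optimal solution up to round `b` with one of the later rounds. -/
theorem offline_le_add (hM : ∀ s s' : M, dist s s' ≤ D) {b t : ℕ} (h : b < t) :
    offline s₀ c t ≤ offline s₀ c b + ENNReal.ofReal D + offlineOn c (b + 1) (t + 1) := by
  rw [offline.eq_1 s₀ c b]
  unfold offlineOn
  simp only [ENNReal.iInf_add, ENNReal.add_iInf]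
  refine le_iInf fun s' => le_iInf₂ fun s hs => ?_
  refine (offline_le (s := fun i => if i ≤ b then s i else s' i) (by simpa using hs) t).trans ?_
  have hsplit : ∀ u : ℕ → M, pathCost c u 1 (t + 1)
      = pathCost c u 1 (b + 1) + pathCost c u (b + 1) (t + 1) := fun u =>
    (Finset.sum_Ico_consecutive _ (by omega) (by omega)).symm
  have hfirst : ∀ u : ℕ → M, pathCost c u (b + 1) (t + 1)
      = (c (b + 1) (u (b + 1)) + edist (u b) (u (b + 1))) + pathCost c u (b + 2) (t + 1) :=
    fun u => Finset.sum_eq_sum_Ico_succ_bot (by omega) _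
  rw [hsplit, hfirst, hfirst s', add_assoc (pathCost c s 1 (b + 1))]
  refine add_le_add (le_of_eq (pathCost_congr fun i _ hi => if_pos (by omega))) ?_
  rw [← add_assoc (ENNReal.ofReal D)]
  refine add_le_add ?_ (le_of_eq (pathCost_congr fun i hi _ => if_neg (by omega)))
  rw [if_neg (by omega), add_comm (ENNReal.ofReal D)]
  refine (add_le_add le_rfl (edist_le_ofReal hM _ _)).trans ?_
  gcongr
  exact le_self_add

end Offline

/-! ### Guess and offline optimum in the doubling scheme. -/

section Phase

variable {M : Type*} [MetricSpace M] {s₀ : M} {c : ℕ → CostFn M} {D : ℝ} {R ω ω₀ : ℝ≥0}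

theorem phase_succ_cases (t : ℕ) :
    ((R : ℝ≥0∞) * 2 ^ (phase R ω c t).1 * ω < offlineOn c (phase R ω c t).2 (t + 1)
        ∧ phase R ω c (t + 1) = ((phase R ω c t).1 + 1, t + 1)) ∨
      (offlineOn c (phase R ω c t).2 (t + 1) ≤ (R : ℝ≥0∞) * 2 ^ (phase R ω c t).1 * ω
        ∧ phase R ω c (t + 1) = phase R ω c t) := by
  rw [phase.eq_2]
  split_ifs with h
  · exact Or.inl ⟨h, rfl⟩
  · exact Or.inr ⟨not_lt.1 h, rfl⟩

theorem phase_one (s₀ : M) : phase R ω c 1 = (0, 1) := by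
  rcases phase_succ_cases (R := R) (ω := ω) (c := c) 0 with ⟨h, -⟩ | ⟨-, h⟩
  · have : offlineOn c 1 1 = 0 := offlineOn_self s₀ 1
    simp only [phase, zero_add, this] at h
    exact absurd h not_lt_zero
  · exact h

theorem phase_snd_pos (t : ℕ) : 1 ≤ (phase R ω c t).2 := by
  induction t with
  | zero => simp [phase]
  | succ t ih =>
    rcases phase_succ_cases (R := R) (ω := ω) (c := c) t with ⟨-, h⟩ | ⟨-, h⟩ <;> rw [h]
    · simp
    · exact ih

theorem phase_snd_le (s₀ : M) {t : ℕ} (ht : 1 ≤ t) : (phase R ω c t).2 ≤ t := by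
  induction t, ht using Nat.le_induction with
  | base => rw [phase_one s₀]
  | succ t _ ih =>
    rcases phase_succ_cases (R := R) (ω := ω) (c := c) t with ⟨-, h⟩ | ⟨-, h⟩ <;> rw [h]
    omega

theorem offlineOn_phase_le (s₀ : M) {t : ℕ} (ht : 1 ≤ t) :
    offlineOn c (phase R ω c t).2 t ≤ (R : ℝ≥0∞) * 2 ^ (phase R ω c t).1 * ω := by
  obtain ⟨t, rfl⟩ := Nat.exists_eq_add_of_le' ht
  rcases phase_succ_cases (R := R) (ω := ω) (c := c) t with ⟨-, h⟩ | ⟨h', h⟩ <;> rw [h]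
  · rw [offlineOn_self s₀]
    exact zero_le
  · exact h'

/-- The phase before the current one. -/
theorem phase_pred (s₀ : M) {t : ℕ} (ht : 1 ≤ t) :
    ∃ b n, (phase R ω c t).2 = b + 1 ∧ t = b + (n + 1) ∧ (phase R ω c (b + 1)).2 = b + 1 ∧
      ((b = 0 ∧ (phase R ω c t).1 = 0) ∨ (1 ≤ b ∧ (phase R ω c t).1 = (phase R ω c b).1 + 1 ∧
        (R : ℝ≥0∞) * 2 ^ (phase R ω c b).1 * ω < offlineOn c (phase R ω c b).2 (b + 1))) := by
  induction t, ht using Nat.le_induction with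
  | base => exact ⟨0, 0, by simp [phase_one s₀]⟩
  | succ t ht ih =>
    rcases phase_succ_cases (R := R) (ω := ω) (c := c) t with ⟨h', h⟩ | ⟨-, h⟩
    · exact ⟨t, 0, by rw [h], rfl, by rw [h], Or.inr ⟨ht, by rw [h], h'⟩⟩
    · obtain ⟨b, n, h1, h2, h3, h4⟩ := ih
      exact ⟨b, n + 1, by rw [h, h1], by omega, h3, by rwa [h]⟩

/-- The preceding phase ended because its own optimum exceeded half of the present threshold, and
the optimum of an interval is a lower bound for the whole. -/
theorem le_offline_of_phase (s₀ : M) {t : ℕ} (ht : 1 ≤ t) (hk : (phase R ω c t).1 ≠ 0) :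
    (R : ℝ≥0∞) * 2 ^ (phase R ω c t).1 * ω ≤ 2 * offline s₀ c t := by
  obtain ⟨b, n, -, h2, -, h | ⟨-, h4, h5⟩⟩ := phase_pred (R := R) (ω := ω) (c := c) s₀ ht
  · exact absurd h.2 hk
  · rw [h4]
    calc _ = 2 * ((R : ℝ≥0∞) * 2 ^ (phase R ω c b).1 * ω) := by ring
      _ ≤ 2 * offline s₀ c b := by
        gcongr
        exact h5.le.trans (offlineOn_le_offline (phase_snd_pos b))
      _ ≤ _ := by
        gcongr
        exact offline_mono (by omega)

/-- With threshold `W`, the current phase adds at most `W + 2 D`: one `D` for joining the solutions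
and one for the last round, not yet tested. Since `W ≥ ω₀`, this is at most `(1 + 2 D / ω₀) W`, and
halving thresholds backwards doubles the constant. -/
theorem offline_le_phase (hD : 0 < D) (hM : ∀ s s' : M, dist s s' ≤ D)
    (hc : ∀ t, Admissible (c t)) (hω₀ : 0 < ω₀) (hω : ω₀ ≤ ω) (hR : 1 ≤ R) (t : ℕ) :
    offline s₀ c t ≤ ENNReal.ofReal (2 + 4 * D / ω₀) * (R * 2 ^ (phase R ω c t).1 * ω) := by
  induction t using Nat.strong_induction_on with
  | _ t ih =>
  rcases Nat.eq_zero_or_pos t with rfl | ht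
  · rw [offline_zero]; exact zero_le
  obtain ⟨b, n, h1, h2, -, h⟩ := phase_pred (R := R) (ω := ω) (c := c) s₀ ht
  have h3 := offlineOn_phase_le (R := R) (ω := ω) (c := c) s₀ ht
  have h4 : offlineOn c (b + 1) (t + 1) ≤ offlineOn c (b + 1) t + ENNReal.ofReal D :=
    offlineOn_succ_le hM hc (by omega)
  have h5 := offline_le_add (s₀ := s₀) (c := c) hM (show b < t by omega)
  rw [h1] at h3
  set W := (R : ℝ≥0∞) * 2 ^ (phase R ω c t).1 * ω with hW
  have hDW : ENNReal.ofReal D ≤ ENNReal.ofReal (D / ω₀) * W := by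
    have hωW : (ω₀ : ℝ≥0∞) ≤ W := by
      calc (ω₀ : ℝ≥0∞) ≤ ω := by exact_mod_cast hω
        _ = 1 * 1 * ω := by ring
        _ ≤ _ := by
          rw [hW]
          gcongr
          · exact_mod_cast hR
          · exact one_le_pow₀ (by norm_num)
    calc ENNReal.ofReal D = ENNReal.ofReal (D / ω₀) * ω₀ := by
          rw [← ENNReal.ofReal_coe_nnreal, ← ENNReal.ofReal_mul (by positivity),
            div_mul_cancel₀ _ (by exact_mod_cast hω₀.ne')]
      _ ≤ _ := by gcongr
  have hb : 2 * offline s₀ c b ≤ ENNReal.ofReal (2 + 4 * D / ω₀) * W := by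
    rcases h with ⟨rfl, -⟩ | ⟨-, hk, -⟩
    · rw [offline_zero, mul_zero]; exact zero_le
    · refine (mul_le_mul' le_rfl (ih b (by omega))).trans_eq ?_
      rw [hW, hk]
      ring
  have hsum : offline s₀ c t ≤ offline s₀ c b + (1 + 2 * ENNReal.ofReal (D / ω₀)) * W := by
    calc _ ≤ offline s₀ c b + ENNReal.ofReal D + (W + ENNReal.ofReal D) :=
          h5.trans (add_le_add le_rfl (h4.trans (add_le_add h3 le_rfl)))
      _ = offline s₀ c b + (W + 2 * ENNReal.ofReal D) := by ring
      _ ≤ offline s₀ c b + (W + 2 * (ENNReal.ofReal (D / ω₀) * W)) := by gcongr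
      _ = _ := by ring
  have hB : ENNReal.ofReal (2 + 4 * D / ω₀) = 2 * (1 + 2 * ENNReal.ofReal (D / ω₀)) := by
    rw [show 2 + 4 * D / (ω₀ : ℝ) = 2 * (1 + 2 * (D / ω₀)) by ring,
      ENNReal.ofReal_mul (by norm_num), ENNReal.ofReal_add (by norm_num) (by positivity),
      ENNReal.ofReal_mul (by norm_num)]
    simp
  rw [hB] at hb ⊢
  have h2 : 2 * offline s₀ c t ≤ 2 * (2 * (1 + 2 * ENNReal.ofReal (D / ω₀)) * W) := by
    calc _ ≤ 2 * (offline s₀ c b + (1 + 2 * ENNReal.ofReal (D / ω₀)) * W) := by gcongr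
      _ = 2 * offline s₀ c b + 2 * (1 + 2 * ENNReal.ofReal (D / ω₀)) * W := by ring
      _ ≤ 2 * (1 + 2 * ENNReal.ofReal (D / ω₀)) * W
          + 2 * (1 + 2 * ENNReal.ofReal (D / ω₀)) * W := add_le_add hb le_rfl
      _ = _ := by ring
  exact (ENNReal.mul_le_mul_iff_right (by norm_num) (by norm_num)).1 h2

/-- The last rounds of the phases that end before round `T + 1`. -/
noncomputable def phaseEnds (R ω : ℝ≥0) (c : ℕ → CostFn M) (T : ℕ) : Finset ℕ :=
  insert T ((Finset.range T).filter fun t => (phase R ω c (t + 1)).2 = t + 1)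

/-- The two extra elements account for `T` itself and for round `0`, which precedes the first phase.
-/
theorem card_phaseEnds_le (s₀ : M) (T : ℕ) :
    (phaseEnds R ω c T).card ≤ (phase R ω c T).1 + 2 := by
  have key : ((Finset.range T).filter fun t => (phase R ω c (t + 1)).2 = t + 1).card
      ≤ (phase R ω c T).1 + 1 := by
    induction T with
    | zero => simp
    | succ T ih =>
      rw [Finset.range_add_one, Finset.filter_insert]
      rcases phase_succ_cases (R := R) (ω := ω) (c := c) T with ⟨-, h⟩ | ⟨-, h⟩
      · rw [h]
        simp only [if_true]
        exact (Finset.card_insert_le _ _).trans (by omega)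
      · rw [h]
        split_ifs with h1
        · rcases Nat.eq_zero_or_pos T with rfl | hT
          · simp
          · have := phase_snd_le (R := R) (ω := ω) (c := c) s₀ hT
            omega
        · exact ih
  exact (Finset.card_insert_le _ _).trans (by omega)

end Phase

/-! ### From the doubling algorithm to single instances. -/

section Law

variable {M : Type*} [MetricSpace M] {s₀ : M} {ℓ : ℕ} [NeZero ℓ] {c : ℕ → CostFn M} {D : ℝ}
  {m : ℕ} {R ω : ℝ≥0} {H : Fin ℓ → OnlineAlg M s₀}

/-- Restarts are determined by the input, so within a phase the law is that of a single instance,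
shifted by `b` and started from the law at the end of the previous phase. -/
theorem law_eq_run {b n : ℕ} (h : (phase R ω c (b + (n + 1))).2 = b + 1) :
    law D m R ω H c (b + (n + 1))
      = run D m (epsParam D ℓ m (2 ^ (phase R ω c (b + (n + 1))).1 * ω))
          (etaParam D ℓ m (2 ^ (phase R ω c (b + (n + 1))).1 * ω)) (fun j => c (b + j + 1))
          (fun j i => (H i).traj c (b + j)) (fun j i => (H i).stepCost c (b + j + 1))
          (law D m R ω H c b) (n + 1) := by
  induction n with
  | zero =>
    simp only [zero_add] at h ⊢
    simp only [law, run, h, if_true, PMF.bind_bind]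
  | succ n ih =>
    rw [show b + (n + 1 + 1) = b + (n + 1) + 1 by ring] at h ⊢
    have h' : phase R ω c (b + (n + 1) + 1) = phase R ω c (b + (n + 1)) := by
      rcases phase_succ_cases (R := R) (ω := ω) (c := c) (b + (n + 1)) with ⟨-, h'⟩ | ⟨-, h'⟩
      · rw [h'] at h
        simp at h
      · exact h'
    rw [h'] at h ⊢
    have hne : ¬ (phase R ω c (b + (n + 1))).2 = b + (n + 1) + 1 := by omega
    rw [law, h']
    simp only [hne, if_false, PMF.pure_bind]
    rw [ih h]
    rfl

theorem totalCost_add (A : OnlineAlg M s₀) (b n : ℕ) :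
    A.totalCost c (b + n) = A.totalCost c b + ∑ j ∈ Finset.range n, A.stepCost c (b + j + 1) := by
  induction n with
  | zero => simp
  | succ n ih =>
    rw [Finset.sum_range_succ, ← add_assoc (A.totalCost c b), ← ih]
    exact Finset.sum_Icc_succ_top (by omega) _

theorem traj_zero (A : OnlineAlg M s₀) : A.traj c 0 = s₀ := by
  simp [OnlineAlg.traj, history, A.state_nil]

theorem offline_le_totalCost (A : OnlineAlg M s₀) (t : ℕ) :
    offline s₀ c t ≤ A.totalCost c t := by
  refine (offline_le (s := A.traj c) (traj_zero A) t).trans_eq ?_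
  unfold pathCost OnlineAlg.totalCost
  exact Finset.sum_congr (by ext; simp) fun _ _ => rfl

theorem offline_le_opt (t : ℕ) : offline s₀ c t ≤ opt H c t :=
  le_iInf fun _ => offline_le_totalCost _ _

theorem opt_mono {t t' : ℕ} (h : t ≤ t') : opt H c t ≤ opt H c t' := by
  refine iInf_mono fun i => ?_
  obtain ⟨n, rfl⟩ := Nat.exists_eq_add_of_le h
  rw [totalCost_add]
  exact le_self_add

theorem totalCost_ne_top (hH : ∀ i t, 1 ≤ t → (H i).stepCost c t ≤ ENNReal.ofReal (2 * D))
    (i : Fin ℓ) (t : ℕ) : (H i).totalCost c t ≠ ∞ :=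
  ENNReal.sum_ne_top.2 fun t ht =>
    ((hH i t (Finset.mem_Icc.1 ht).1).trans_lt ENNReal.ofReal_lt_top).ne

theorem opt_ne_top (hH : ∀ i t, 1 ≤ t → (H i).stepCost c t ≤ ENNReal.ofReal (2 * D)) (t : ℕ) :
    opt H c t ≠ ∞ :=
  ((iInf_le _ 0).trans_lt (totalCost_ne_top hH 0 t).lt_top).ne

/-- The best heuristic at the end of the interval costs at least `opt` up to its beginning. With
these comparators the phase costs telescope. -/
theorem exists_sum_stepCost_le
    (hH : ∀ i t, 1 ≤ t → (H i).stepCost c t ≤ ENNReal.ofReal (2 * D)) (b n : ℕ) :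
    ∃ i, ∑ j ∈ Finset.range n, (H i).stepCost c (b + j + 1) ≤ opt H c (b + n) - opt H c b := by
  obtain ⟨i, hi⟩ := exists_eq_ciInf_of_finite (f := fun i => (H i).totalCost c (b + n))
  refine ⟨i, ENNReal.le_sub_of_add_le_left (opt_ne_top hH b) ?_⟩
  change _ ≤ ⨅ i, (H i).totalCost c (b + n)
  rw [← hi, totalCost_add]
  exact add_le_add (iInf_le _ i) le_rfl

end Law

/-! ### Balancing the parameters. -/

section Parameters

variable {D : ℝ} {ℓ m : ℕ} {ω ω' : ℝ}

/-- The constant in `γ = rateConst * ω ^ (-1 / 3)`. -/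
noncomputable def rateConst (D : ℝ) (ℓ m : ℕ) : ℝ :=
  (D * ℓ * Real.log ℓ) ^ (1 / 3 : ℝ) * (m : ℝ) ^ (2 / 3 : ℝ)

theorem base_nonneg (hD : 0 ≤ D) : 0 ≤ D * ℓ * Real.log ℓ :=
  mul_nonneg (by positivity) (Real.log_natCast_nonneg ℓ)

theorem rateConst_nonneg (hD : 0 ≤ D) : 0 ≤ rateConst D ℓ m :=
  mul_nonneg (Real.rpow_nonneg (base_nonneg hD) _) (by positivity)

theorem rpow_third_pow {x : ℝ} (hx : 0 ≤ x) : (x ^ (1 / 3 : ℝ)) ^ 3 = x := by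
  rw [← Real.rpow_natCast, ← Real.rpow_mul hx]
  norm_num

theorem rpow_two_thirds {x : ℝ} (hx : 0 ≤ x) : x ^ (2 / 3 : ℝ) = (x ^ (1 / 3 : ℝ)) ^ 2 := by
  rw [← Real.rpow_natCast, ← Real.rpow_mul hx]
  norm_num

theorem gammaParam_eq (hω : 0 ≤ ω) :
    gammaParam D ℓ m ω = rateConst D ℓ m / ω ^ (1 / 3 : ℝ) := by
  unfold gammaParam rateConst
  rw [show (-1 / 3 : ℝ) = -(1 / 3) by ring, Real.rpow_neg hω]
  exact (div_eq_mul_inv _ _).symm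

theorem gammaParam_nonneg (hD : 0 ≤ D) (hω : 0 ≤ ω) : 0 ≤ gammaParam D ℓ m ω := by
  rw [gammaParam_eq hω]
  exact div_nonneg (rateConst_nonneg hD) (by positivity)

theorem gammaParam_anti (hD : 0 ≤ D) (hω : 0 < ω) (h : ω ≤ ω') :
    gammaParam D ℓ m ω' ≤ gammaParam D ℓ m ω := by
  rw [gammaParam_eq hω.le, gammaParam_eq (hω.le.trans h)]
  have := rateConst_nonneg (ℓ := ℓ) (m := m) hD
  gcongr

theorem epsParam_eq (hm : 0 < m) : epsParam D ℓ m ω = gammaParam D ℓ m ω / m ^ 2 := by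
  unfold epsParam gammaParam
  have hm' : (0 : ℝ) < m := by exact_mod_cast hm
  have h : (m : ℝ) ^ (-4 / 3 : ℝ) = (m : ℝ) ^ (2 / 3 : ℝ) / m ^ 2 := by
    rw [← Real.rpow_natCast, ← Real.rpow_sub hm']
    norm_num
  rw [h]
  ring

/-- Since `γ ε = γ² / m²` and `rateConst ^ 3 = D ℓ ln ℓ m²`, the term `log ℓ` in the HEDGE bound,
divided by its prefactor `γ ε / (2 D ℓ)`, becomes `2 * rateConst * ω ^ (2/3)`. -/
theorem regret_balance (hD : 0 ≤ D) (hω : 0 < ω) (hm : 0 < m) :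
    2 * D * (ℓ * Real.log ℓ) = 2 * rateConst D ℓ m * ω ^ (2 / 3 : ℝ)
      * (gammaParam D ℓ m ω * epsParam D ℓ m ω) := by
  have hm' : (0 : ℝ) < m := by exact_mod_cast hm
  have hz : 0 < ω ^ (1 / 3 : ℝ) := by positivity
  rw [epsParam_eq hm, gammaParam_eq hω.le, rpow_two_thirds hω.le]
  have h : rateConst D ℓ m ^ 3 = D * ℓ * Real.log ℓ * m ^ 2 := by
    unfold rateConst
    rw [mul_pow, rpow_third_pow (base_nonneg hD), rpow_two_thirds hm'.le, ← pow_mul, mul_comm 2 3,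
      pow_mul, rpow_third_pow hm'.le]
  field_simp
  rw [h]

/-- This is `2 ^ (-2/3) ≤ 2/3`, obtained from `(5/4) ^ 3 ≤ 2`. It makes the sum over phases
geometric. -/
theorem rpow_third_sq_le (hω : 0 ≤ ω) (hω' : 0 ≤ ω') (h : ω' = 2 * ω) :
    (ω ^ (1 / 3 : ℝ)) ^ 2 ≤ 2 / 3 * (ω' ^ (1 / 3 : ℝ)) ^ 2 := by
  have hv3 := rpow_third_pow hω
  have hz3 := rpow_third_pow hω'
  have hq0 : 0 ≤ ω ^ (1 / 3 : ℝ) := by positivity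
  have hz0 : 0 ≤ ω' ^ (1 / 3 : ℝ) := by positivity
  have h7 : 5 / 4 * ω ^ (1 / 3 : ℝ) ≤ ω' ^ (1 / 3 : ℝ) := by
    refine le_of_pow_le_pow_left₀ (n := 3) (by norm_num) hz0 ?_
    rw [hz3, mul_pow, hv3]
    linarith
  nlinarith

end Parameters

/-! ### Summing the regret over the phases. -/

/-- The increment of the potential `x + C₃ (ρ² (x - Y)⁺ ^ (2/3) + min x Y) + C₂ ω ^ (2/3)`
in a phase. -/
theorem regret_increment {A E G S C₂ C₃ ρ β x y Y z a b : ℝ} (hE : E = Real.exp A - 1)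
    (hA : 0 ≤ A) (hG : 0 ≤ G) (hβ : 0 ≤ β) (hz : 0 < z) (hγ : G / z ≤ 1)
    (hC₂ : C₂ = 3 * (S + 2 * G * (1 + E))) (hC₃ : C₃ = E * (1 + 2 * G * β)) (hyx : y ≤ x)
    (ha0 : 0 ≤ a) (hb0 : 0 ≤ b) (hx : x = a ^ 3 + min x Y) (hy : y = b ^ 3 + min y Y)
    (hba : b ≤ a) (haz : a ≤ β * ρ ^ 2 * z) :
    y + C₃ * (ρ ^ 2 * b ^ 2 + min y Y) + 2 / 3 * (C₂ * z ^ 2) + S * z ^ 2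
        + Real.exp (A * (G / z)) * (2 * G * z ^ 2 + (x - y))
      ≤ x + C₃ * (ρ ^ 2 * a ^ 2 + min x Y) + C₂ * z ^ 2 := by
  have hE0 : 0 ≤ E := by rw [hE]; linarith [Real.add_one_le_exp A]
  have hγ0 : 0 ≤ G / z := by positivity
  have hexp : Real.exp (A * (G / z)) ≤ 1 + E * (G / z) := by
    have := exp_neg_mul_le (η := -A) hγ0 hγ
    rw [neg_neg] at this
    rw [hE]
    linarith
  have hmin : min y Y ≤ min x Y := min_le_min_right _ hyx
  -- The difference of the two sides is `(a - b) ^ 2 * (a + 2 * b) / 2`. A factor `a ≤ β ρ² z` then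
  -- cancels the `z` in `γ = G / z`.
  have h1 : a ^ 3 - b ^ 3 ≤ 3 / 2 * a * (a ^ 2 - b ^ 2) := by
    nlinarith [mul_nonneg (sq_nonneg (a - b)) (by linarith : 0 ≤ a + 2 * b)]
  have hab : 0 ≤ a ^ 2 - b ^ 2 := by nlinarith
  have h2 : G / z * (a ^ 3 - b ^ 3) ≤ 2 * G * β * (ρ ^ 2 * (a ^ 2 - b ^ 2)) := by
    calc _ ≤ G / z * (3 / 2 * (β * ρ ^ 2 * z) * (a ^ 2 - b ^ 2)) := by
          gcongr
          exact h1.trans (by gcongr)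
      _ = 3 / 2 * (G * β * (ρ ^ 2 * (a ^ 2 - b ^ 2))) := by field_simp
      _ ≤ _ := by
          have : 0 ≤ G * β * (ρ ^ 2 * (a ^ 2 - b ^ 2)) := by positivity
          linarith
  have h3 : G / z * (x - y) ≤ (1 + 2 * G * β)
      * (ρ ^ 2 * a ^ 2 + min x Y - (ρ ^ 2 * b ^ 2 + min y Y)) := by
    have h4 : x - y = (a ^ 3 - b ^ 3) + (min x Y - min y Y) := by linarith
    have h5 : G / z * (min x Y - min y Y) ≤ min x Y - min y Y :=
      mul_le_of_le_one_left (sub_nonneg.2 hmin) hγ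
    have h6 : 0 ≤ 2 * G * β * (min x Y - min y Y) :=
      mul_nonneg (by positivity) (sub_nonneg.2 hmin)
    have h7 : 0 ≤ ρ ^ 2 * (a ^ 2 - b ^ 2) := by positivity
    rw [h4, mul_add]
    nlinarith
  have h8 : Real.exp (A * (G / z)) * (x - y) ≤ (x - y) + E * (G / z * (x - y)) := by
    nlinarith
  have h9 : Real.exp (A * (G / z)) * (2 * G * z ^ 2) ≤ (1 + E) * (2 * G * z ^ 2) := by
    gcongr
    nlinarith
  have h10 := mul_le_mul_of_nonneg_left h3 hE0
  -- The free third of `C₂ z ^ 2` is exactly `(S + 2 G (1 + E)) z ^ 2`: start-up cost plus inflated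
  -- HEDGE term.
  rw [hC₂, hC₃]
  nlinarith

section Regret

variable {M : Type*} [MetricSpace M] {s₀ : M} {ℓ : ℕ} [NeZero ℓ] {c : ℕ → CostFn M} {D : ℝ}
  {m : ℕ} {R ω ω₀ : ℝ≥0} {H : Fin ℓ → OnlineAlg M s₀}

theorem expectedCost_phase_le (hD : 0 < D) (hM : ∀ s s' : M, dist s s' ≤ D) (hm : 2 ≤ m)
    (hω₀ : 0 < ω₀) (hγ : gammaParam D ℓ m ω₀ < 1) (hω : ω₀ ≤ ω) (hc : ∀ t, Admissible (c t))
    (hH : ∀ i t, 1 ≤ t → (H i).stepCost c t ≤ ENNReal.ofReal (2 * D)) {b n : ℕ}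
    (h : (phase R ω c (b + (n + 1))).2 = b + 1) :
    expectedCost D m R ω H c (b + (n + 1)) ≤ expectedCost D m R ω H c b
      + ENNReal.ofReal (startupCost D m (gammaParam D ℓ m ω₀))
      + ENNReal.ofReal (Real.exp (regretExponent m (gammaParam D ℓ m ω₀)
          * gammaParam D ℓ m (2 ^ (phase R ω c (b + (n + 1))).1 * ω)))
        * (ENNReal.ofReal (2 * rateConst D ℓ m
            * (2 ^ (phase R ω c (b + (n + 1))).1 * ω : ℝ) ^ (2 / 3 : ℝ))
          + (opt H c (b + (n + 1)) - opt H c b)) := by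
  set w : ℝ := 2 ^ (phase R ω c (b + (n + 1))).1 * ω with hw
  have hω₀' : (0 : ℝ) < ω₀ := by exact_mod_cast hω₀
  have hω₀w : (ω₀ : ℝ) ≤ w := by
    have h1 : (ω₀ : ℝ) ≤ ω := by exact_mod_cast hω
    exact h1.trans (le_mul_of_one_le_left (by positivity) (one_le_pow₀ (by norm_num)))
  have hw0 : 0 < w := hω₀'.trans_le hω₀w
  have hm' : (2 : ℝ) ≤ m := by exact_mod_cast hm
  have hγ0 : 0 ≤ gammaParam D ℓ m w := gammaParam_nonneg hD.le hw0.le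
  have hγw : gammaParam D ℓ m w ≤ gammaParam D ℓ m ω₀ := gammaParam_anti hD.le hω₀' hω₀w
  have hε := epsParam_eq (D := D) (ℓ := ℓ) (m := m) (ω := w) (by omega)
  have hεγ : epsParam D ℓ m w ≤ gammaParam D ℓ m w := by
    rw [hε]
    exact div_le_self hγ0 (by nlinarith)
  -- Here `8 m ε = 8 γ / m`, with `γ < 1` and `m ≥ 2`.
  have hε8 : 8 * m * epsParam D ℓ m w ≤ 4 := by
    rw [hε, mul_div_assoc', div_le_iff₀ (by positivity)]
    nlinarith
  have hℓ : ℓ = 1 ∨ 0 < gammaParam D ℓ m w ∧ 0 < epsParam D ℓ m w := by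
    rcases Nat.lt_or_ge 1 ℓ with h1 | h1
    · right
      have h2 : 0 < Real.log ℓ := Real.log_pos (by exact_mod_cast h1)
      have h3 : (0 : ℝ) < ℓ := by positivity
      have h4 : 0 < gammaParam D ℓ m w := by unfold gammaParam; positivity
      exact ⟨h4, by rw [hε]; positivity⟩
    · left
      have := NeZero.pos ℓ
      omega
  obtain ⟨i, hi⟩ := exists_sum_stepCost_le (c := c) hH b (n + 1)
  have key := Ex_run_paid_le (μ := law D m R ω H c b) (c := fun j => c (b + j + 1))
    (s := fun j i => (H i).traj c (b + j)) (f := fun j i => (H i).stepCost c (b + j + 1))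
    hD hM hm hγ0 hγw hγ rfl hεγ hε8 (regret_balance hD.le hw0 (by omega)).le hℓ (fun _ => hc _)
    (fun _ _ => rfl) (fun _ i => hH i _ (by omega)) (n + 1) i
  have hE : ∀ t, expectedCost D m R ω H c t = Ex (law D m R ω H c t) fun σ => σ.paid :=
    fun _ => rfl
  rw [hE, hE, law_eq_run h]
  refine key.trans (add_le_add le_rfl (mul_le_mul' le_rfl (add_le_add le_rfl hi)))

theorem expectedCost_zero : expectedCost D m R ω H c 0 = 0 := by
  change Ex (law D m R ω H c 0) (fun σ => σ.paid) = 0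
  rw [law, Ex_fresh]
  simp

/-- The bound on the expected cost, in terms of the cost `x` of the best heuristic. -/
noncomputable def costBound (C₂ C₃ : ℝ) (R : ℝ≥0) (Y x w : ℝ) : ℝ :=
  x + C₃ * (((R : ℝ) ^ (1 / 3 : ℝ)) ^ 2 * (max (x - Y) 0 ^ (1 / 3 : ℝ)) ^ 2 + min x Y)
    + C₂ * (w ^ (1 / 3 : ℝ)) ^ 2

theorem regretExponent_nonneg {γ₀ : ℝ} (hγ₀ : γ₀ < 1) : 0 ≤ regretExponent m γ₀ := by
  have h1 : 0 < 1 - γ₀ := by linarith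
  unfold regretExponent badFactor
  positivity

theorem startupCost_nonneg {γ₀ : ℝ} (hD : 0 < D) (hγ₀ : γ₀ < 1) : 0 ≤ startupCost D m γ₀ := by
  have h1 : 0 < 1 - γ₀ := by linarith
  unfold startupCost badFactor
  positivity

/-- Induction over phase ends, with `costBound` as the potential. The allowance `Y` covers rounds
where competitiveness is unavailable: the part of the best cost below `Y` is charged linearly, only
the excess at the power `2/3`. -/
theorem expectedCost_le (hD : 0 < D) (hM : ∀ s s' : M, dist s s' ≤ D) (hm : 2 ≤ m)
    (hω₀ : 0 < ω₀) (hγ : gammaParam D ℓ m ω₀ < 1) (hω : ω₀ ≤ ω) (hc : ∀ t, Admissible (c t))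
    (hH : ∀ i t, 1 ≤ t → (H i).stepCost c t ≤ ENNReal.ofReal (2 * D))
    {B E S C₂ C₃ Y : ℝ} (hB : 0 ≤ B) (hY0 : 0 ≤ Y)
    (hE : E = Real.exp (regretExponent m (gammaParam D ℓ m ω₀)) - 1)
    (hS : S = startupCost D m (gammaParam D ℓ m ω₀) / ((ω₀ : ℝ) ^ (1 / 3 : ℝ)) ^ 2)
    (hC₂ : C₂ = 3 * (S + 2 * rateConst D ℓ m * (1 + E)))
    (hC₃ : C₃ = E * (1 + 2 * rateConst D ℓ m * B ^ (1 / 3 : ℝ))) {T : ℕ}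
    (hY : ∀ t ∈ phaseEnds R ω c T,
      (opt H c t).toReal ≤ B * (R : ℝ) ^ 2 * (2 ^ (phase R ω c t).1 * ω) + Y) :
    expectedCost D m R ω H c T ≤ ENNReal.ofReal
      (costBound C₂ C₃ R Y (opt H c T).toReal (2 ^ (phase R ω c T).1 * ω)) := by
  have hω₀' : (0 : ℝ) < ω₀ := by exact_mod_cast hω₀
  have hA := regretExponent_nonneg (m := m) hγ
  have hE0 : 0 ≤ E := by
    rw [hE]
    linarith [Real.add_one_le_exp (regretExponent m (gammaParam D ℓ m ω₀))]
  have hG := rateConst_nonneg (ℓ := ℓ) (m := m) hD.le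
  have hS0 : 0 ≤ S := by
    rw [hS]
    exact div_nonneg (startupCost_nonneg hD hγ) (by positivity)
  have hC₂0 : 0 ≤ C₂ := by rw [hC₂]; positivity
  have hC₃0 : 0 ≤ C₃ := by rw [hC₃]; positivity
  have hnn : ∀ x w : ℝ, 0 ≤ x → 0 ≤ costBound C₂ C₃ R Y x w := fun x w hx => by
    have := le_min hx hY0
    unfold costBound
    positivity
  suffices key : ∀ t ≤ T, t ∈ phaseEnds R ω c T → expectedCost D m R ω H c t ≤ ENNReal.ofReal
      (costBound C₂ C₃ R Y (opt H c t).toReal (2 ^ (phase R ω c t).1 * ω)) from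
    key T le_rfl (Finset.mem_insert_self _ _)
  intro t
  induction t using Nat.strong_induction_on with
  | _ t ih =>
  intro htT hend
  rcases Nat.eq_zero_or_pos t with rfl | ht
  · rw [expectedCost_zero]; exact zero_le
  obtain ⟨b, n, h1, rfl, h3, h4⟩ := phase_pred (R := R) (ω := ω) (c := c) s₀ ht
  have hbend : b ∈ phaseEnds R ω c T :=
    Finset.mem_insert_of_mem (Finset.mem_filter.2 ⟨Finset.mem_range.2 (by omega), h3⟩)
  have hstep := expectedCost_phase_le hD hM hm hω₀ hγ hω hc hH h1
  set w : ℝ := 2 ^ (phase R ω c (b + (n + 1))).1 * ω with hw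
  set x := (opt H c (b + (n + 1))).toReal with hx
  set y := (opt H c b).toReal with hy
  have hx0 : 0 ≤ x := ENNReal.toReal_nonneg
  have hy0 : 0 ≤ y := ENNReal.toReal_nonneg
  have hyx : y ≤ x := ENNReal.toReal_mono (opt_ne_top hH _) (opt_mono (by omega))
  have hω₀w : (ω₀ : ℝ) ≤ w := by
    have h1 : (ω₀ : ℝ) ≤ ω := by exact_mod_cast hω
    exact h1.trans (le_mul_of_one_le_left (by positivity) (one_le_pow₀ (by norm_num)))
  have hw0 : 0 < w := hω₀'.trans_le hω₀w
  set z := w ^ (1 / 3 : ℝ) with hz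
  have hz0 : 0 < z := by positivity
  set a := max (x - Y) 0 ^ (1 / 3 : ℝ) with ha
  set b' := max (y - Y) 0 ^ (1 / 3 : ℝ) with hb'
  have hsplit : ∀ u : ℝ, u = (max (u - Y) 0 ^ (1 / 3 : ℝ)) ^ 3 + min u Y := fun u => by
    rw [rpow_third_pow (le_max_right _ _)]
    rcases le_total u Y with h | h
    · rw [max_eq_right (by linarith), min_eq_left h]; ring
    · rw [max_eq_left (by linarith), min_eq_right h]; ring
  have hSz : startupCost D m (gammaParam D ℓ m ω₀) ≤ S * z ^ 2 := by
    have h5 : (ω₀ : ℝ) ^ (1 / 3 : ℝ) ≤ z := Real.rpow_le_rpow hω₀'.le hω₀w (by norm_num)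
    rw [hS, div_mul_eq_mul_div, le_div_iff₀ (by positivity)]
    have := startupCost_nonneg (m := m) hD hγ
    gcongr
  have hγw : gammaParam D ℓ m w = rateConst D ℓ m / z := gammaParam_eq hw0.le
  have hγ1 : rateConst D ℓ m / z ≤ 1 := by
    rw [← hγw]
    exact (gammaParam_anti hD.le hω₀' hω₀w).trans hγ.le
  have haz : a ≤ B ^ (1 / 3 : ℝ) * ((R : ℝ) ^ (1 / 3 : ℝ)) ^ 2 * z := by
    refine le_of_pow_le_pow_left₀ (n := 3) (by norm_num) (by positivity) ?_
    rw [ha, rpow_third_pow (le_max_right _ _), mul_pow, mul_pow, ← pow_mul, mul_comm 2 3, pow_mul,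
      rpow_third_pow hB, rpow_third_pow R.coe_nonneg, hz, rpow_third_pow hw0.le]
    refine max_le ?_ (by positivity)
    linarith [hY _ hend]
  have hinc := regret_increment (S := S) (Y := Y) hE hA hG (by positivity) hz0 hγ1 hC₂ hC₃ hyx
    (a := a) (b := b') (by positivity) (by positivity) (hsplit x) (hsplit y)
    (Real.rpow_le_rpow (le_max_right _ _) (max_le_max_right _ (by linarith)) (by norm_num)) haz
  have hprev : expectedCost D m R ω H c b ≤ ENNReal.ofReal (y + C₃ * (((R : ℝ) ^ (1 / 3 : ℝ)) ^ 2
      * b' ^ 2 + min y Y) + 2 / 3 * (C₂ * z ^ 2)) := by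
    rcases h4 with ⟨rfl, -⟩ | ⟨-, hk, -⟩
    · rw [expectedCost_zero]; exact zero_le
    refine (ih b (by omega) (by omega) hbend).trans (ENNReal.ofReal_le_ofReal ?_)
    unfold costBound
    have hwk : w = 2 * (2 ^ (phase R ω c b).1 * ω) := by rw [hw, hk]; ring
    have h6 := rpow_third_sq_le (by positivity) hw0.le hwk
    have := mul_le_mul_of_nonneg_left h6 hC₂0
    linarith
  refine hstep.trans ?_
  have hsub : opt H c (b + (n + 1)) - opt H c b = ENNReal.ofReal (x - y) := by
    rw [ENNReal.ofReal_sub _ hy0, hx, hy, ENNReal.ofReal_toReal (opt_ne_top hH _),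
      ENNReal.ofReal_toReal (opt_ne_top hH _)]
  have hmin : 0 ≤ min y Y := le_min hy0 hY0
  rw [hsub, hγw, rpow_two_thirds hw0.le, ← ENNReal.ofReal_add (by positivity) (by linarith),
    ← ENNReal.ofReal_mul (Real.exp_pos _).le]
  refine (add_le_add (add_le_add hprev (ENNReal.ofReal_le_ofReal hSz)) le_rfl).trans ?_
  have hxy : 0 ≤ x - y := by linarith
  rw [← ENNReal.ofReal_add (by positivity) (by positivity),
    ← ENNReal.ofReal_add (by positivity) (by positivity)]
  exact ENNReal.ofReal_le_ofReal hinc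

end Regret

/-! ### The competitive event and its probability. -/

section Final

/-- If `r² ≤ x`, the left side is at most the first summand; otherwise it is at most the second.
This makes the allowance `R √OFF` harmless. -/
theorem mul_sqrt_le {r x : ℝ} (hr : 0 ≤ r) (hx : 0 ≤ x) :
    r * √x ≤ (r ^ (1 / 3 : ℝ)) ^ 2 * (x ^ (1 / 3 : ℝ)) ^ 2 + r ^ 2 := by
  have h1 := rpow_third_pow hr
  have h2 := rpow_third_pow hx
  have h3 : (√x) ^ 2 = x := Real.sq_sqrt hx
  set ρ := r ^ (1 / 3 : ℝ)
  set ξ := x ^ (1 / 3 : ℝ)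
  have hρ : 0 ≤ ρ := by positivity
  have hξ : 0 ≤ ξ := by positivity
  have hs := Real.sqrt_nonneg x
  rcases le_total (ρ ^ 2) ξ with h | h
  · have h4 : ρ * √x ≤ ξ ^ 2 := by
      refine le_of_pow_le_pow_left₀ (n := 2) (by norm_num) (by positivity) ?_
      rw [mul_pow, h3, ← h2]
      calc ρ ^ 2 * ξ ^ 3 ≤ ξ * ξ ^ 3 := by gcongr
        _ = _ := by ring
    calc r * √x = ρ ^ 2 * (ρ * √x) := by rw [← h1]; ring
      _ ≤ ρ ^ 2 * ξ ^ 2 := by gcongr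
      _ ≤ _ := le_add_of_nonneg_right (by positivity)
  · have h4 : √x ≤ r := by
      refine le_of_pow_le_pow_left₀ (n := 2) (by norm_num) hr ?_
      rw [h3, ← h2, ← h1]
      calc ξ ^ 3 ≤ (ρ ^ 2) ^ 3 := by gcongr
        _ = _ := by ring
    calc r * √x ≤ r * r := by gcongr
      _ = r ^ 2 := by ring
      _ ≤ _ := le_add_of_nonneg_left (by positivity)

theorem rpow_third_sq_le_two_mul {w x : ℝ} (hw : 0 ≤ w) (hx : 0 ≤ x) (h : w ≤ 2 * x) :
    (w ^ (1 / 3 : ℝ)) ^ 2 ≤ 2 * (x ^ (1 / 3 : ℝ)) ^ 2 := by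
  have h1 := rpow_third_pow hw
  have h2 := rpow_third_pow hx
  have hw0 : 0 ≤ w ^ (1 / 3 : ℝ) := by positivity
  have hx0 : 0 ≤ x ^ (1 / 3 : ℝ) := by positivity
  have h7 : w ^ (1 / 3 : ℝ) ≤ 13 / 10 * x ^ (1 / 3 : ℝ) := by
    refine le_of_pow_le_pow_left₀ (n := 3) (by norm_num) (by positivity) ?_
    rw [h1, mul_pow, h2]
    linarith
  nlinarith

/-- The additive constant of the regret bound. -/
noncomputable def regretConst (D C₂ C₃ : ℝ) (R ω α : ℝ≥0) : ℝ :=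
  C₃ * (R ^ 2 + 2 * R + R * D + α) + C₂ * (ω ^ (1 / 3 : ℝ)) ^ 2

theorem costBound_le {D C₂ C₃ o x w : ℝ} {R ω α : ℝ≥0} (hD : 0 ≤ D) (hC₂ : 0 ≤ C₂) (hC₃ : 0 ≤ C₃)
    (hR : 1 ≤ R) (ho : 0 ≤ o) (hox : o ≤ x) (hw0 : 0 ≤ w) (hw : w = ω ∨ w ≤ 2 * o) :
    costBound C₂ C₃ R (R * (√(2 + o) + D) + α) x w
      ≤ x + (2 * C₃ + 2 * C₂) * (((R : ℝ) ^ (1 / 3 : ℝ)) ^ 2 * (x ^ (1 / 3 : ℝ)) ^ 2)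
        + regretConst D C₂ C₃ R ω α := by
  have hx : 0 ≤ x := ho.trans hox
  have hR0 : (0 : ℝ) ≤ R := R.coe_nonneg
  have hR1 : (1 : ℝ) ≤ R := by exact_mod_cast hR
  have hρ : 1 ≤ (R : ℝ) ^ (1 / 3 : ℝ) := Real.one_le_rpow hR1 (by norm_num)
  have hY : R * (√(2 + o) + D) + α ≤ ((R : ℝ) ^ (1 / 3 : ℝ)) ^ 2 * (x ^ (1 / 3 : ℝ)) ^ 2
      + (R ^ 2 + 2 * R + R * D + α) := by
    have h1 : √(2 + o) ≤ 2 + √x := by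
      rw [Real.sqrt_le_left (by positivity)]
      nlinarith [Real.sq_sqrt hx, Real.sqrt_nonneg x]
    have h2 := mul_sqrt_le hR0 hx
    nlinarith [mul_le_mul_of_nonneg_left h1 hR0]
  have hpow : max (x - (R * (√(2 + o) + D) + α)) 0 ^ (1 / 3 : ℝ) ≤ x ^ (1 / 3 : ℝ) := by
    refine Real.rpow_le_rpow (le_max_right _ _) (max_le ?_ hx) (by norm_num)
    have : 0 ≤ R * (√(2 + o) + D) + α := by positivity
    linarith
  have hwz : (w ^ (1 / 3 : ℝ)) ^ 2 ≤ ((ω : ℝ) ^ (1 / 3 : ℝ)) ^ 2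
      + 2 * (((R : ℝ) ^ (1 / 3 : ℝ)) ^ 2 * (x ^ (1 / 3 : ℝ)) ^ 2) := by
    rcases hw with rfl | hw
    · exact le_add_of_nonneg_right (by positivity)
    · refine (rpow_third_sq_le_two_mul hw0 hx (by linarith)).trans ?_
      have h1 : 1 ≤ ((R : ℝ) ^ (1 / 3 : ℝ)) ^ 2 := one_le_pow₀ hρ
      have h2 : 0 ≤ ((ω : ℝ) ^ (1 / 3 : ℝ)) ^ 2 := by positivity
      have h3 : 0 ≤ (x ^ (1 / 3 : ℝ)) ^ 2 := by positivity
      nlinarith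
  unfold costBound regretConst
  have h1 : ((R : ℝ) ^ (1 / 3 : ℝ)) ^ 2 * (max (x - (R * (√(2 + o) + D) + α)) 0 ^ (1 / 3 : ℝ)) ^ 2
      ≤ ((R : ℝ) ^ (1 / 3 : ℝ)) ^ 2 * (x ^ (1 / 3 : ℝ)) ^ 2 := by gcongr
  have h2 := mul_le_mul_of_nonneg_left
    (add_le_add h1 ((min_le_right x (R * (√(2 + o) + D) + α)).trans hY)) hC₃
  have h3 := mul_le_mul_of_nonneg_left hwz hC₂
  linarith

variable {M : Type*} [MetricSpace M] {s₀ : M} {ℓ : ℕ} [NeZero ℓ] {c : ℕ → CostFn M} {D : ℝ}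
  {m : ℕ} {R ω ω₀ : ℝ≥0} {H : Fin ℓ → OnlineAlg M s₀}

/-- From some round on, the offline optimum is at least of the order of the square root of
its final value, which it hardly exceeds in this round. -/
theorem exists_offline_sqrt (hM : ∀ s s' : M, dist s s' ≤ D) (hD : 0 < D)
    (hc : ∀ t, Admissible (c t)) (T : ℕ) :
    ∃ τ, (∀ t, τ ≤ t → 2 + (offline s₀ c T).toReal ≤ (2 + (offline s₀ c t).toReal) ^ 2) ∧
      (offline s₀ c τ).toReal ≤ √(2 + (offline s₀ c T).toReal) + D := by
  classical
  have hT : ∃ t, 2 + (offline s₀ c T).toReal ≤ (2 + (offline s₀ c t).toReal) ^ 2 := by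
    refine ⟨T, ?_⟩
    have : 0 ≤ (offline s₀ c T).toReal := ENNReal.toReal_nonneg
    nlinarith
  have hmono : ∀ {t t' : ℕ}, t ≤ t' → (offline s₀ c t).toReal ≤ (offline s₀ c t').toReal :=
    fun h => ENNReal.toReal_mono (offline_ne_top hM hc _) (offline_mono h)
  -- In the first round with this property the optimum exceeds that of the previous round, where the
  -- property fails, by at most `D`.
  refine ⟨Nat.find hT, fun t ht => ?_, ?_⟩
  · refine (Nat.find_spec hT).trans ?_
    have h0 : 0 ≤ (offline s₀ c (Nat.find hT)).toReal := ENNReal.toReal_nonneg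
    have := hmono ht
    gcongr
  · rcases Nat.eq_zero_or_pos (Nat.find hT) with h | h
    · rw [h, offline_zero]
      simp only [ENNReal.toReal_zero]
      positivity
    · obtain ⟨k, hk⟩ := Nat.exists_eq_add_of_le' h
      have h1 := Nat.find_min hT (show k < Nat.find hT by omega)
      rw [not_le] at h1
      have h2 : (offline s₀ c k).toReal ≤ √(2 + (offline s₀ c T).toReal) := by
        apply Real.le_sqrt_of_sq_le
        have : 0 ≤ (offline s₀ c k).toReal := ENNReal.toReal_nonneg
        nlinarith
      have h3 : (offline s₀ c (k + 1)).toReal ≤ (offline s₀ c k).toReal + D := by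
        refine (ENNReal.toReal_mono (ENNReal.add_ne_top.2 ⟨offline_ne_top hM hc _,
          ENNReal.ofReal_ne_top⟩) (offline_succ_le hM hc k)).trans_eq ?_
        rw [ENNReal.toReal_add (offline_ne_top hM hc _) ENNReal.ofReal_ne_top,
          ENNReal.toReal_ofReal hD.le]
      rw [hk]
      linarith

theorem ofReal_regret {C K x : ℝ} (hC : 0 ≤ C) (hK : 0 ≤ K) (hx : 0 ≤ x) :
    ENNReal.ofReal (x + C * (((R : ℝ) ^ (1 / 3 : ℝ)) ^ 2 * (x ^ (1 / 3 : ℝ)) ^ 2) + K)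
      = ENNReal.ofReal x + (C.toNNReal : ℝ≥0∞) * (R : ℝ≥0∞) ^ (2 / 3 : ℝ)
        * ENNReal.ofReal x ^ (2 / 3 : ℝ) + (K.toNNReal : ℝ≥0∞) := by
  rw [ENNReal.ofReal_add (by positivity) hK, ENNReal.ofReal_add hx (by positivity),
    ENNReal.ofReal_mul hC, ENNReal.ofReal_mul (by positivity), ← rpow_two_thirds R.coe_nonneg,
    ← rpow_two_thirds hx, ← ENNReal.ofReal_rpow_of_nonneg R.coe_nonneg (by norm_num),
    ← ENNReal.ofReal_rpow_of_nonneg hx (by norm_num), ENNReal.ofReal_coe_nnreal, mul_assoc]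
  rfl

theorem offline_mul_le_phase (hD : 0 < D) (hM : ∀ s s' : M, dist s s' ≤ D)
    (hc : ∀ t, Admissible (c t)) (hω₀ : 0 < ω₀) (hω : ω₀ ≤ ω) (hR : 1 ≤ R) (t : ℕ) :
    R * (offline s₀ c t).toReal
      ≤ (2 + 4 * D / ω₀) * (R : ℝ) ^ 2 * (2 ^ (phase R ω c t).1 * ω) := by
  have h := offline_le_phase (s₀ := s₀) hD hM hc hω₀ hω hR t
  have hB : (0 : ℝ) ≤ 2 + 4 * D / ω₀ := by positivity
  have h1 : ENNReal.ofReal (2 + 4 * D / ω₀) * (R * 2 ^ (phase R ω c t).1 * ω)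
      = ENNReal.ofReal ((2 + 4 * D / ω₀) * (R * 2 ^ (phase R ω c t).1 * ω)) := by
    rw [ENNReal.ofReal_mul hB, ENNReal.ofReal_mul (by positivity), ENNReal.ofReal_mul R.coe_nonneg,
      ENNReal.ofReal_coe_nnreal, ENNReal.ofReal_coe_nnreal, ENNReal.ofReal_pow (by norm_num),
      ENNReal.ofReal_ofNat]
  rw [h1] at h
  have h2 := ENNReal.toReal_le_of_le_ofReal (by positivity) h
  have h3 := mul_le_mul_of_nonneg_left h2 R.coe_nonneg
  linarith

theorem phase_le_offline (s₀ : M) (hM : ∀ s s' : M, dist s s' ≤ D)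
    (hc : ∀ t, Admissible (c t)) (hR : 1 ≤ R) (t : ℕ) :
    (phase R ω c t).1 = 0 ∨ 2 ^ (phase R ω c t).1 * (ω : ℝ) ≤ 2 * (offline s₀ c t).toReal := by
  rcases Nat.eq_zero_or_pos t with rfl | ht
  · exact Or.inl rfl
  refine or_iff_not_imp_left.2 fun hk => ?_
  have h := le_offline_of_phase s₀ ht hk
  have h1 : (2 : ℝ≥0∞) ^ (phase R ω c t).1 * ω ≤ 2 * offline s₀ c t := by
    refine le_trans ?_ h
    rw [mul_assoc]
    refine le_mul_of_one_le_left' ?_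
    exact_mod_cast hR
  have h2 := ENNReal.toReal_mono (ENNReal.mul_ne_top (by norm_num) (offline_ne_top hM hc t)) h1
  simpa using h2

/-- The regret bound, if one of the heuristics is competitive in the relevant rounds. -/
theorem expectedCost_le_of_competitive (hD : 0 < D) (hM : ∀ s s' : M, dist s s' ≤ D) (hm : 2 ≤ m)
    (hω₀ : 0 < ω₀) (hγ : gammaParam D ℓ m ω₀ < 1) (hω : ω₀ ≤ ω) (hR : 1 ≤ R)
    (hc : ∀ t, Admissible (c t))
    (hH : ∀ i t, 1 ≤ t → (H i).stepCost c t ≤ ENNReal.ofReal (2 * D))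
    {E S C₂ C₃ : ℝ}
    (hE : E = Real.exp (regretExponent m (gammaParam D ℓ m ω₀)) - 1)
    (hS : S = startupCost D m (gammaParam D ℓ m ω₀) / ((ω₀ : ℝ) ^ (1 / 3 : ℝ)) ^ 2)
    (hC₂ : C₂ = 3 * (S + 2 * rateConst D ℓ m * (1 + E)))
    (hC₃ : C₃ = E * (1 + 2 * rateConst D ℓ m * (2 + 4 * D / ω₀) ^ (1 / 3 : ℝ)))
    (hC₂0 : 0 ≤ C₂) (hC₃0 : 0 ≤ C₃) {α : ℝ≥0} {T τ : ℕ}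
    (hτ : (offline s₀ c τ).toReal ≤ √(2 + (offline s₀ c T).toReal) + D) {i : Fin ℓ}
    (hcomp : ∀ t ∈ phaseEnds R ω c T, (H i).totalCost c (max t τ)
      ≤ (R : ℝ≥0∞) * offline s₀ c (max t τ) + α) :
    expectedCost D m R ω H c T ≤ opt H c T
      + ((2 * C₃ + 2 * C₂).toNNReal : ℝ≥0∞) * (R : ℝ≥0∞) ^ (2 / 3 : ℝ) * opt H c T ^ (2 / 3 : ℝ)
      + ((regretConst D C₂ C₃ R ω α).toNNReal : ℝ≥0∞) := by
  set o := (offline s₀ c T).toReal with ho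
  have ho0 : 0 ≤ o := ENNReal.toReal_nonneg
  have hY : ∀ t ∈ phaseEnds R ω c T, (opt H c t).toReal ≤ (2 + 4 * D / ω₀) * (R : ℝ) ^ 2
      * (2 ^ (phase R ω c t).1 * ω) + (R * (√(2 + o) + D) + α) := by
    intro t ht
    -- As `opt` increases with time, competitiveness in the later round `max t τ` suffices; for `t <
    -- τ` the optimum there is at most `√(2 + o) + D`.
    have h1 : opt H c t ≤ (R : ℝ≥0∞) * offline s₀ c (max t τ) + α :=
      (opt_mono (le_max_left _ _)).trans ((iInf_le _ i).trans (hcomp t ht))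
    have hRo : (R : ℝ≥0∞) * offline s₀ c (max t τ) ≠ ∞ :=
      ENNReal.mul_ne_top ENNReal.coe_ne_top (offline_ne_top hM hc _)
    have h2 := ENNReal.toReal_mono (ENNReal.add_ne_top.2 ⟨hRo, ENNReal.coe_ne_top⟩) h1
    rw [ENNReal.toReal_add hRo ENNReal.coe_ne_top, ENNReal.toReal_mul, ENNReal.coe_toReal,
      ENNReal.coe_toReal] at h2
    have h3 : (offline s₀ c (max t τ)).toReal
        ≤ (offline s₀ c t).toReal + (√(2 + o) + D) := by
      have h4 : 0 ≤ (offline s₀ c t).toReal := ENNReal.toReal_nonneg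
      rcases le_total t τ with h | h
      · rw [max_eq_right h]
        linarith
      · rw [max_eq_left h]
        have : 0 ≤ √(2 + o) + D := by positivity
        linarith
    have h4 := offline_mul_le_phase (s₀ := s₀) (c := c) hD hM hc hω₀ hω hR t
    have h5 := mul_le_mul_of_nonneg_left h3 R.coe_nonneg
    linarith
  refine (expectedCost_le (B := 2 + 4 * D / ω₀) hD hM hm hω₀ hγ hω hc hH (by positivity)
    (by positivity) hE hS hC₂ hC₃ hY).trans ?_
  have hx0 : 0 ≤ (opt H c T).toReal := ENNReal.toReal_nonneg
  have hK : 0 ≤ regretConst D C₂ C₃ R ω α := by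
    unfold regretConst
    positivity
  have hopt : opt H c T = ENNReal.ofReal (opt H c T).toReal :=
    (ENNReal.ofReal_toReal (opt_ne_top hH T)).symm
  rw [hopt, ENNReal.toReal_ofReal hx0, ← ofReal_regret (by positivity) hK hx0]
  refine ENNReal.ofReal_le_ofReal (costBound_le hD.le hC₂0 hC₃0 hR ho0
    (ENNReal.toReal_mono (opt_ne_top hH T) (offline_le_opt T)) (by positivity) ?_)
  rcases phase_le_offline (ω := ω) s₀ hM hc hR T with h | h
  · left
    rw [h, pow_zero, one_mul]
  · exact Or.inr h

/-- The number of phases is negligible with respect to the failure probability. -/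
theorem card_phaseEnds_mul_le (s₀ : M) (hM : ∀ s s' : M, dist s s' ≤ D) (hω : 0 < ω)
    (hc : ∀ t, Admissible (c t)) (hR : 1 ≤ R) (β : ℝ) (T : ℕ) :
    ((phaseEnds R ω c T).card : ℝ)
        * (2 + (offline s₀ c T).toReal) ^ (-(β + 1 + Real.logb 2 (2 + 2 / ω)))
      ≤ (2 + (offline s₀ c T).toReal) ^ (-β) := by
  have hω' : (0 : ℝ) < ω := by exact_mod_cast hω
  set o := (offline s₀ c T).toReal with ho
  have ho0 : 0 ≤ o := ENNReal.toReal_nonneg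
  have hX : 0 < 2 + o := by linarith
  have hc0 : (0 : ℝ) < 2 + 2 / ω := by positivity
  have hcard : ((phaseEnds R ω c T).card : ℝ) ≤ (2 + 2 / ω) * (2 + o) := by
    have h1 : ((phaseEnds R ω c T).card : ℝ) ≤ (phase R ω c T).1 + 2 := by
      exact_mod_cast card_phaseEnds_le s₀ T
    have h2 : ((phase R ω c T).1 : ℝ) ≤ 2 / ω * o := by
      rcases phase_le_offline (ω := ω) s₀ hM hc hR T with h | h
      · rw [h, Nat.cast_zero]
        positivity
      · have h3 : ((phase R ω c T).1 : ℝ) ≤ 2 ^ (phase R ω c T).1 := by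
          exact_mod_cast Nat.lt_two_pow_self.le
        rw [div_mul_eq_mul_div, le_div_iff₀ hω']
        exact (mul_le_mul_of_nonneg_right h3 hω'.le).trans h
    have h4 : 0 ≤ 2 / (ω : ℝ) := by positivity
    nlinarith
  -- The bound on the failure probability has no multiplicative constant, so the constant in the
  -- number of phases is absorbed into the exponent, using that the base is at least `2`.
  have hL : 2 + 2 / (ω : ℝ) ≤ (2 + o) ^ Real.logb 2 (2 + 2 / ω) := by
    calc 2 + 2 / (ω : ℝ) = 2 ^ Real.logb 2 (2 + 2 / ω) :=
          (Real.rpow_logb (by norm_num) (by norm_num) hc0).symm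
      _ ≤ _ := Real.rpow_le_rpow (by norm_num) (by linarith)
          (Real.logb_nonneg (by norm_num) (by linarith [show 0 ≤ 2 / (ω : ℝ) by positivity]))
  set L := Real.logb 2 (2 + 2 / ω)
  have hsplit : (2 + o) ^ (-(β + 1 + L)) = (2 + o) ^ (-β) / ((2 + o) * (2 + o) ^ L) := by
    rw [neg_add, neg_add, Real.rpow_add hX, Real.rpow_add hX, Real.rpow_neg hX.le L,
      Real.rpow_neg_one]
    field_simp
  have hβ0 : 0 ≤ (2 + o) ^ (-β) := by positivity
  rw [hsplit, ← mul_div_assoc, div_le_iff₀ (by positivity), mul_comm]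
  refine mul_le_mul_of_nonneg_left ?_ hβ0
  calc _ ≤ (2 + 2 / ω) * (2 + o) := hcard
    _ ≤ (2 + o) ^ L * (2 + o) := by gcongr
    _ = _ := mul_comm _ _

theorem two_add_rpow (hM : ∀ s s' : M, dist s s' ≤ D) (hc : ∀ t, Admissible (c t)) (t : ℕ)
    (β : ℝ) : (2 + offline s₀ c t) ^ (-β)
      = ENNReal.ofReal ((2 + (offline s₀ c t).toReal) ^ (-β)) := by
  have h : 0 ≤ (offline s₀ c t).toReal := ENNReal.toReal_nonneg
  rw [← ENNReal.ofReal_rpow_of_pos (by positivity), ENNReal.ofReal_add (by norm_num) h,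
    ENNReal.ofReal_toReal (offline_ne_top hM hc t), ENNReal.ofReal_ofNat]

end Final

end MTS

/-! ### Assembling the bound. -/

theorem mainTheorem7 (D : ℝ) (hD : 0 < D) (ℓ : ℕ) [NeZero ℓ] (m : ℕ) (hm : 2 ≤ m)
    (ω₀ : ℝ≥0) (hω₀ : 0 < ω₀) (hγ : MTS.gammaParam D ℓ m ω₀ < 1) :
    ∃ C : ℝ≥0, ∀ (ω R : ℝ≥0), ω₀ ≤ ω → 1 ≤ R →
      ∀ (M : Type*) [MetricSpace M] (s₀ : M), (∀ s s' : M, dist s s' ≤ D) →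
      ∀ (Ω : Type*) [MeasurableSpace Ω] (P : MeasureTheory.Measure Ω)
        [MeasureTheory.IsProbabilityMeasure P] (H : Fin ℓ → Ω → MTS.OnlineAlg M s₀),
      (∀ (i : Fin ℓ) (w : Ω) (c : ℕ → MTS.CostFn M), (∀ t, MTS.Admissible (c t)) →
        ∀ t, 1 ≤ t → (H i w).stepCost c t ≤ ENNReal.ofReal (2 * D)) →
      (∃ i, MTS.CompetitiveWHP P (H i) R) →
      ∀ β : ℝ, 1 ≤ β → ∃ K : ℝ≥0,
        ∀ c : ℕ → MTS.CostFn M, (∀ t, MTS.Admissible (c t)) → ∀ T : ℕ,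
          P {w | MTS.opt (fun i => H i w) c T
                + C * (R : ℝ≥0∞) ^ (2 / 3 : ℝ) * MTS.opt (fun i => H i w) c T ^ (2 / 3 : ℝ) + K
              < MTS.expectedCost D m R ω (fun i => H i w) c T}
            ≤ (2 + MTS.offline s₀ c T) ^ (-β) := by
  obtain ⟨E, hE⟩ : ∃ E, E = Real.exp (MTS.regretExponent m (MTS.gammaParam D ℓ m ω₀)) - 1 :=
    ⟨_, rfl⟩
  obtain ⟨S, hS⟩ : ∃ S, S = MTS.startupCost D m (MTS.gammaParam D ℓ m ω₀)
    / ((ω₀ : ℝ) ^ (1 / 3 : ℝ)) ^ 2 := ⟨_, rfl⟩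
  obtain ⟨C₂, hC₂⟩ : ∃ C₂, C₂ = 3 * (S + 2 * MTS.rateConst D ℓ m * (1 + E)) := ⟨_, rfl⟩
  obtain ⟨C₃, hC₃⟩ : ∃ C₃, C₃ = E * (1 + 2 * MTS.rateConst D ℓ m
    * (2 + 4 * D / ω₀) ^ (1 / 3 : ℝ)) := ⟨_, rfl⟩
  have hE0 : 0 ≤ E := by
    rw [hE, sub_nonneg]
    exact Real.one_le_exp (MTS.regretExponent_nonneg hγ)
  have hG := MTS.rateConst_nonneg (ℓ := ℓ) (m := m) hD.le
  have hS0 : 0 ≤ S := by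
    rw [hS]
    exact div_nonneg (MTS.startupCost_nonneg hD hγ) (by positivity)
  have hC₂0 : 0 ≤ C₂ := by rw [hC₂]; positivity
  have hC₃0 : 0 ≤ C₃ := by rw [hC₃]; positivity
  refine ⟨(2 * C₃ + 2 * C₂).toNNReal, ?_⟩
  intro ω R hω hR M _ s₀ hM Ω _ P _ H hH hcomp β hβ
  obtain ⟨i, hi⟩ := hcomp
  set L := Real.logb 2 (2 + 2 / (ω : ℝ)) with hL
  have hL0 : 0 ≤ L :=
    Real.logb_nonneg (by norm_num) (by linarith [show 0 ≤ 2 / (ω : ℝ) by positivity])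
  -- The factor `2` compensates the square root in the choice of `τ`; the surplus `1 + L` pays for
  -- the union over the phase ends.
  obtain ⟨α, hα⟩ := hi (2 * (β + 1 + L)) (by linarith)
  refine ⟨(MTS.regretConst D C₂ C₃ R ω α).toNNReal, ?_⟩
  intro c hc T
  obtain ⟨τ, hτ1, hτ2⟩ := MTS.exists_offline_sqrt (s₀ := s₀) hM hD hc T
  have hsub : {w | MTS.opt (fun i => H i w) c T
        + (2 * C₃ + 2 * C₂).toNNReal * (R : ℝ≥0∞) ^ (2 / 3 : ℝ)
          * MTS.opt (fun i => H i w) c T ^ (2 / 3 : ℝ)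
        + (MTS.regretConst D C₂ C₃ R ω α).toNNReal
        < MTS.expectedCost D m R ω (fun i => H i w) c T}
      ⊆ ⋃ t ∈ MTS.phaseEnds R ω c T,
        {w | (R : ℝ≥0∞) * MTS.offline s₀ c (max t τ) + α < (H i w).totalCost c (max t τ)} := by
    intro w hw
    by_contra hcon
    simp only [Set.mem_iUnion, Set.mem_ofPred_eq, not_exists, not_lt] at hcon
    exact absurd hw (not_lt.2 (MTS.expectedCost_le_of_competitive (H := fun i => H i w) hD hM hm
      hω₀ hγ hω hR hc (fun j t ht => hH j w c hc t ht) hE hS hC₂ hC₃ hC₂0 hC₃0 hτ2 hcon))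
  calc _ ≤ P (⋃ t ∈ MTS.phaseEnds R ω c T,
        {w | (R : ℝ≥0∞) * MTS.offline s₀ c (max t τ) + α < (H i w).totalCost c (max t τ)}) :=
        MeasureTheory.measure_mono hsub
    _ ≤ ∑ t ∈ MTS.phaseEnds R ω c T,
        P {w | (R : ℝ≥0∞) * MTS.offline s₀ c (max t τ) + α < (H i w).totalCost c (max t τ)} :=
        MeasureTheory.measure_biUnion_finset_le _ _
    _ ≤ ∑ t ∈ MTS.phaseEnds R ω c T,
        ENNReal.ofReal ((2 + (MTS.offline s₀ c T).toReal) ^ (-(β + 1 + L))) := by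
        refine Finset.sum_le_sum fun t _ => (hα c hc (max t τ)).trans ?_
        rw [MTS.two_add_rpow hM hc]
        apply ENNReal.ofReal_le_ofReal
        have h0 : 0 ≤ (MTS.offline s₀ c (max t τ)).toReal := ENNReal.toReal_nonneg
        have h1 : 0 ≤ (MTS.offline s₀ c T).toReal := ENNReal.toReal_nonneg
        rw [show -(2 * (β + 1 + L)) = (2 : ℕ) * (-(β + 1 + L)) by push_cast; ring,
          Real.rpow_mul (by positivity), Real.rpow_natCast]
        exact Real.rpow_le_rpow_of_nonpos (by positivity) (hτ1 _ (le_max_right _ _)) (by linarith)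
    _ ≤ _ := by
        rw [Finset.sum_const, nsmul_eq_mul, MTS.two_add_rpow hM hc, ← ENNReal.ofReal_natCast,
          ← ENNReal.ofReal_mul (by positivity)]
        exact ENNReal.ofReal_le_ofReal
          (MTS.card_phaseEnds_mul_le s₀ hM (hω₀.trans_le hω) hc hR β T)
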